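/- A hypergraph is a finite set $V$ of $n=|V|$ vertices together with a set $\mathcal H\subseteq 2^V$ of $m=|\mathcal H|$ edges. Its rank is the maximum size of an edge ($0$ if there is no edge), and it is $r$-uniform if all its edges have size $r$. A hitting set is a set $T\subseteq V$ that intersects every edge; it is minimal if no proper subset is a hitting set. The hypergraph has transversal rank at least $k$ if it has a minimal hitting set with at least $k$ elements. It is $k$-conformal if, for every $S\subseteq V$, the set $S$ is contained in an edge if and only if every subset of $S$ with at most $k$ elements is contained in an edge. If $\mathcal H$ is $r$-uniform, a hyperclique is a set $C\subseteq V$ with $|C|\ge r$ such that every $r$-element subset of $C$ is an edge, and an independent set is, in the same way, a set $C\subseteq V$ with $|C|\ge r$ that contains no edge; they are maximal if they are inclusion-wise maximal with this property. Algorithms are single deterministic programs for a random access machine with uniform cost (registers and arrays of natural numbers; assignment, addition, truncated subtraction, indirect load and store, test for zero, output), and the input is the incidence matrix of the hypergraph, with the edges in any order, together with the parameter $k$ or $r$. An enumeration algorithm outputs each solution exactly once, in any order, and then terminates; its $i$-th delay is the number of steps between the $i$-th and the $(i+1)$-st output, where the time before the first output ($i=0$) and the time after the last output until termination are also counted as delays.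 All polynomials and the constants hidden in $O(1)$ are independent of the parameters $k$ and $r$ and of the input; $n$ is read as $\max(n,2)$ in the time bounds. Theorem. The following statements are equivalent. 1. There is an algorithm that decides, given a hypergraph and $k\ge 0$, whether the transversal rank is at least $k$, in time $\mathrm{poly}(m)\cdot n^{k+O(1)}$. 2. There is an algorithm that decides, given a hypergraph and $k\ge 0$, whether the hypergraph is $k$-conformal, in time $\mathrm{poly}(m)\cdot n^{k+O(1)}$. 3. There is an algorithm that, given a hypergraph of rank $r$ (for any $r$), enumerates its minimal hitting sets with $i$-th delay at most $\mathrm{poly}(i)\cdot n^{r+O(1)}$. 4. There is an algorithm that, given an $r$-uniform hypergraph (for any $r$), enumerates its maximal hypercliques with $i$-th delay at most $\mathrm{poly}(i)\cdot n^{r+O(1)}$. Moreover, these are also equivalent to statement 4 with maximal independent sets in place of maximal hypercliques. -/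

import Mathlib

/-! Hypergraphs on the vertex set `Fin n`, and a random access machine with uniform cost. -/

namespace HG

/-- A finite hypergraph with vertex set `Fin n`, identified with its set of edges (which may be
any sets of vertices, including the empty set). -/
abbrev FinHypergraph (n : ℕ) : Type := Finset (Finset (Fin n))

/-- The rank: the maximum edge cardinality (`0` if there is no edge). -/
def rank {n : ℕ} (H : FinHypergraph n) : ℕ := H.sup Finset.card

/-- `T` intersects every edge. Minimal hitting sets are `Minimal (IsHittingSet H)`. -/
def IsHittingSet {n : ℕ} (H : FinHypergraph n) (T : Finset (Fin n)) : Prop :=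
  ∀ E ∈ H, (E ∩ T).Nonempty

/-- The transversal rank is at least `k`: some minimal hitting set has at least `k` elements. -/
def TransversalRankGE {n : ℕ} (H : FinHypergraph n) (k : ℕ) : Prop :=
  ∃ T : Finset (Fin n), Minimal (IsHittingSet H) T ∧ k ≤ T.card

/-- `k`-conformality: a set of vertices is contained in an edge if and only if each of its subsets
with at most `k` elements is. -/
def IsConformal {n : ℕ} (H : FinHypergraph n) (k : ℕ) : Prop :=
  ∀ S : Finset (Fin n),
    (∃ E ∈ H, S ⊆ E) ↔ ∀ S' : Finset (Fin n), S' ⊆ S → S'.card ≤ k → ∃ E' ∈ H, S' ⊆ E'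

/-- All edges have size exactly `r`. -/
def IsUniform {n : ℕ} (H : FinHypergraph n) (r : ℕ) : Prop := ∀ E ∈ H, E.card = r

/-- A hyperclique of an `r`-uniform hypergraph: at least `r` vertices, and all `r`-subsets are
edges. -/
def IsHyperclique {n : ℕ} (H : FinHypergraph n) (r : ℕ) (C : Finset (Fin n)) : Prop :=
  r ≤ C.card ∧ ∀ S : Finset (Fin n), S ⊆ C → S.card = r → S ∈ H

/-- An independent set of an `r`-uniform hypergraph, the notion obtained from hypercliques by
swapping edges and non-edges: at least `r` vertices, and no edge is contained in it. -/
def IsIndependent {n : ℕ} (H : FinHypergraph n) (r : ℕ) (C : Finset (Fin n)) : Prop :=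
  r ≤ C.card ∧ ∀ E ∈ H, ¬ E ⊆ C

/-- Programs of a random access machine with registers `0, 1, 2, …` and arrays `0, 1, 2, …`, all
of them holding natural numbers. A program mentions only finitely many registers and arrays. -/
inductive Cmd : Type
  /-- do nothing -/
  | skip : Cmd
  /-- register `x` gets the constant `c` -/
  | const (x c : ℕ) : Cmd
  /-- register `x` gets the sum of the registers `y` and `z` -/
  | add (x y z : ℕ) : Cmd
  /-- register `x` gets the truncated difference of the registers `y` and `z` -/
  | sub (x y z : ℕ) : Cmd
  /-- register `x` gets the entry of array `a` whose index is in register `y` -/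
  | load (x a y : ℕ) : Cmd
  /-- the entry of array `a` whose index is in register `x` gets the value of register `y` -/
  | store (a x y : ℕ) : Cmd
  /-- write the value of register `x` to the output tape -/
  | write (x : ℕ) : Cmd
  /-- mark the end of a solution on the output tape -/
  | emit : Cmd
  /-- first `p`, then `q` -/
  | seq (p q : Cmd) : Cmd
  /-- `p` if register `x` is nonzero, and `q` otherwise -/
  | branch (x : ℕ) (p q : Cmd) : Cmd
  /-- repeat `p` as long as register `x` is nonzero -/
  | loop (x : ℕ) (p : Cmd) : Cmd

/-- The memory content. -/
@[ext] structure State : Type where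
  reg : ℕ → ℕ
  arr : ℕ → ℕ → ℕ

/-- Assign `v` to register `x`. -/
def State.setReg (s : State) (x v : ℕ) : State :=
  { s with reg := Function.update s.reg x v }

/-- Assign `v` to entry `i` of array `a`. -/
def State.setArr (s : State) (a i v : ℕ) : State :=
  { s with arr := Function.update s.arr a (Function.update (s.arr a) i v) }

/-- One elementary step, as seen from outside. -/
inductive Action : Type
  | silent : Action
  | write (v : ℕ) : Action
  | emit : Action

/-- `Run A s t s'`: program `A`, started in `s`, terminates in `s'`, and `t` is the list of its
elementary steps. Every instruction and every test of a register takes one step, so that the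
running time is the length of `t`. -/
inductive Run : Cmd → State → List Action → State → Prop
  | skip (s : State) : Run Cmd.skip s [Action.silent] s
  | const (x c : ℕ) (s : State) : Run (Cmd.const x c) s [Action.silent] (s.setReg x c)
  | add (x y z : ℕ) (s : State) :
      Run (Cmd.add x y z) s [Action.silent] (s.setReg x (s.reg y + s.reg z))
  | sub (x y z : ℕ) (s : State) :
      Run (Cmd.sub x y z) s [Action.silent] (s.setReg x (s.reg y - s.reg z))
  | load (x a y : ℕ) (s : State) :
      Run (Cmd.load x a y) s [Action.silent] (s.setReg x (s.arr a (s.reg y)))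
  | store (a x y : ℕ) (s : State) :
      Run (Cmd.store a x y) s [Action.silent] (s.setArr a (s.reg x) (s.reg y))
  | write (x : ℕ) (s : State) : Run (Cmd.write x) s [Action.write (s.reg x)] s
  | emit (s : State) : Run Cmd.emit s [Action.emit] s
  | seq {p q : Cmd} {s s' s'' : State} {t t' : List Action} :
      Run p s t s' → Run q s' t' s'' → Run (Cmd.seq p q) s (t ++ t') s''
  | branch_nonzero {x : ℕ} {p q : Cmd} {s s' : State} {t : List Action} :
      s.reg x ≠ 0 → Run p s t s' → Run (Cmd.branch x p q) s (Action.silent :: t) s'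
  | branch_zero {x : ℕ} {p q : Cmd} {s s' : State} {t : List Action} :
      s.reg x = 0 → Run q s t s' → Run (Cmd.branch x p q) s (Action.silent :: t) s'
  | loop_zero {x : ℕ} {p : Cmd} {s : State} :
      s.reg x = 0 → Run (Cmd.loop x p) s [Action.silent] s
  | loop_nonzero {x : ℕ} {p : Cmd} {s s' s'' : State} {t t' : List Action} :
      s.reg x ≠ 0 → Run p s t s' → Run (Cmd.loop x p) s' t' s'' →
        Run (Cmd.loop x p) s (Action.silent :: (t ++ t')) s''

/-- Is this step the end of a solution? -/
def Action.isEmit : Action → Bool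
  | Action.emit => true
  | _ => false

/-- The number that this step writes, if any. -/
def Action.written? : Action → Option ℕ
  | Action.write v => some v
  | _ => none

/-- The steps of a run, cut at the outputs: before the first output, between consecutive outputs,
and after the last one. A run with `N` outputs has `N + 1` blocks. -/
def blocks (t : List Action) : List (List Action) := t.splitOnP Action.isEmit

/-- The sets of numbers that a run outputs, in order. -/
def outputs (t : List Action) : List (Finset ℕ) :=
  (blocks t).dropLast.map fun b => (b.filterMap Action.written?).toFinset

/-- The initial state for the hypergraph whose edges are listed in `l` and the parameter `k`:
registers `0, 1, 2` hold `n`, the number of edges, and `k`, and array `0` holds the incidence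
matrix row by row (entry `j * n + v` is `1` if vertex `v` is in the `j`-th edge). All else is
`0`. -/
def encode {n : ℕ} (l : List (Finset (Fin n))) (k : ℕ) : State where
  reg := fun x => if x = 0 then n else if x = 1 then l.length else if x = 2 then k else 0
  arr := fun a x =>
    if a = 0 ∧ ∃ E ∈ l[x / n]?, ∃ v ∈ E, (v : ℕ) = x % n then 1 else 0

/-- The property `P` of a hypergraph and a parameter `k` is decidable in time
`poly(m) * n ^ (k + O(1))` by a single program, for every order in which the `m` edges are given.
The answer is yes if register `0` is nonzero in the end. (`max n 2` is `n` unless `n ≤ 1`.) -/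
def DecidableInTime (P : (n : ℕ) → FinHypergraph n → ℕ → Prop) : Prop :=
  ∃ (A : Cmd) (p : Polynomial ℕ) (c : ℕ),
    ∀ (n : ℕ) (l : List (Finset (Fin n))) (k : ℕ), l.Nodup →
      ∃ (t : List Action) (s : State), Run A (encode l k) t s ∧
        (s.reg 0 ≠ 0 ↔ P n l.toFinset k) ∧
        t.length ≤ p.eval l.length * max n 2 ^ (k + c)

/-- A single program enumerates, for all hypergraphs `H` and parameters `r` with `Inst n H r`, the
sets `C` with `Sol n H r C`, each exactly once and in any order, with incremental delay
`poly(i) * n ^ (r + O(1))`, where `i` is the number of sets output so far. The time before the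
first output and the time after the last one count as delays. -/
def EnumerableWithDelay (Inst : (n : ℕ) → FinHypergraph n → ℕ → Prop)
    (Sol : (n : ℕ) → FinHypergraph n → ℕ → Finset (Fin n) → Prop) : Prop :=
  ∃ (A : Cmd) (p : Polynomial ℕ) (c : ℕ),
    ∀ (n : ℕ) (l : List (Finset (Fin n))) (r : ℕ), l.Nodup → Inst n l.toFinset r →
      ∃ (t : List Action) (s : State), Run A (encode l r) t s ∧
        (∃ sols : List (Finset (Fin n)), sols.Nodup ∧
          (∀ C : Finset (Fin n), C ∈ sols ↔ Sol n l.toFinset r C) ∧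
          outputs t = sols.map fun C => C.map Fin.valEmbedding) ∧
        ∀ (i : ℕ) (b : List Action), (blocks t)[i]? = some b →
          b.length + 1 ≤ p.eval i * max n 2 ^ (r + c)

end HG

namespace HG

/-! All statements are compared with conformality. Call a set covered if some edge contains it, and
violating if it is not covered although all its subsets with at most `k` elements are; a hypergraph
is `k`-conformal when it has no violating set.

Transversal rank: a set hits the complements of all edges iff it is not covered. Hence the minimal
hitting sets of the complementary hypergraph are the minimal uncovered sets, and there is one with
more than `k` elements iff there is a violating set (`isConformal_iff_transversalRank`).

From enumeration to conformality (`conformal_of_enumerable`): out of the at most `2 * n ^ k` sets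
with at most `k` vertices a hypergraph `F` is formed whose solutions correspond to the maximal sets
`D` with all small subsets covered. For hitting sets, `F` consists of the uncovered small sets and
`D` is the complement of a solution; for independent sets, of the uncovered `k`-sets; for
hypercliques, of the covered `k`-sets. The input is `k`-conformal iff every `D` is covered, and by
maximality a covered `D` is an edge. So at most `m` outputs are covered, and the answer is known
after at most `m + 1` outputs (`monitor_run`).

From conformality to enumeration (`enumerable_of_conformal`): up to complements, the solutions are
the maximal sets with at least `q` vertices that contain no set of a family `F` of forbidden sets
with at most `r` vertices, where `q = 0` or `q = r`. Regard the solutions found so far as a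
hypergraph `C`. If a solution is missing, then some allowed set with at most `r` vertices is not
covered by `C`, which exhaustive search detects, or `C` is not `r`-conformal (`IsSplit.mem_of_sol`).
In the second case a violating set is found with `n + 1` conformality tests, because adding a set
`W` to every edge destroys exactly the violating sets that meet `W` (`isConformal_image_union`,
`violatorC_spec`). Either set contains no forbidden set and is extended greedily to a new solution.
The tests see only the `i` solutions found so far, which gives the delay.

The rest implements this on the machine: structured programs, rules for total correctness that count
loop iterations, and a translation `embC` that runs a given algorithm as a subroutine in relocated
memory and intercepts its outputs (`embC_sim`). -/

@[simp] theorem State.setReg_reg (s : State) (x v y : ℕ) :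
    (s.setReg x v).reg y = if y = x then v else s.reg y := by
  simp [State.setReg, Function.update_apply]

@[simp] theorem State.setReg_arr (s : State) (x v : ℕ) : (s.setReg x v).arr = s.arr := rfl

@[simp] theorem State.setArr_reg (s : State) (a i v : ℕ) : (s.setArr a i v).reg = s.reg := rfl

@[simp] theorem State.setArr_arr (s : State) (a i v b : ℕ) :
    (s.setArr a i v).arr b = if b = a then Function.update (s.arr a) i v else s.arr b := by
  simp [State.setArr, Function.update_apply]

/-! ### Running time counted in loop iterations -/

/-- `RunIter c s t L s'` refines `Run c s t s'` by the number `L` of loop iterations. -/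
inductive RunIter : Cmd → State → List Action → ℕ → State → Prop
  | skip (s : State) : RunIter Cmd.skip s [Action.silent] 0 s
  | const (x c : ℕ) (s : State) : RunIter (Cmd.const x c) s [Action.silent] 0 (s.setReg x c)
  | add (x y z : ℕ) (s : State) :
      RunIter (Cmd.add x y z) s [Action.silent] 0 (s.setReg x (s.reg y + s.reg z))
  | sub (x y z : ℕ) (s : State) :
      RunIter (Cmd.sub x y z) s [Action.silent] 0 (s.setReg x (s.reg y - s.reg z))
  | load (x a y : ℕ) (s : State) :
      RunIter (Cmd.load x a y) s [Action.silent] 0 (s.setReg x (s.arr a (s.reg y)))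
  | store (a x y : ℕ) (s : State) :
      RunIter (Cmd.store a x y) s [Action.silent] 0 (s.setArr a (s.reg x) (s.reg y))
  | write (x : ℕ) (s : State) : RunIter (Cmd.write x) s [Action.write (s.reg x)] 0 s
  | emit (s : State) : RunIter Cmd.emit s [Action.emit] 0 s
  | seq {p q : Cmd} {s s' s'' : State} {t t' : List Action} {L L' : ℕ} :
      RunIter p s t L s' → RunIter q s' t' L' s'' →
        RunIter (Cmd.seq p q) s (t ++ t') (L + L') s''
  | branch_nonzero {x : ℕ} {p q : Cmd} {s s' : State} {t : List Action} {L : ℕ} :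
      s.reg x ≠ 0 → RunIter p s t L s' →
        RunIter (Cmd.branch x p q) s (Action.silent :: t) L s'
  | branch_zero {x : ℕ} {p q : Cmd} {s s' : State} {t : List Action} {L : ℕ} :
      s.reg x = 0 → RunIter q s t L s' →
        RunIter (Cmd.branch x p q) s (Action.silent :: t) L s'
  | loop_zero {x : ℕ} {p : Cmd} {s : State} :
      s.reg x = 0 → RunIter (Cmd.loop x p) s [Action.silent] 0 s
  | loop_nonzero {x : ℕ} {p : Cmd} {s s' s'' : State} {t t' : List Action} {L L' : ℕ} :
      s.reg x ≠ 0 → RunIter p s t L s' → RunIter (Cmd.loop x p) s' t' L' s'' →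
        RunIter (Cmd.loop x p) s (Action.silent :: (t ++ t')) (L + L' + 1) s''

theorem RunIter.run {c : Cmd} {s s' : State} {t : List Action} {L : ℕ}
    (h : RunIter c s t L s') : Run c s t s' := by
  induction h with
  | skip s => exact .skip s
  | const x c s => exact .const x c s
  | add x y z s => exact .add x y z s
  | sub x y z s => exact .sub x y z s
  | load x a y s => exact .load x a y s
  | store a x y s => exact .store a x y s
  | write x s => exact .write x s
  | emit s => exact .emit s
  | seq _ _ h₁ h₂ => exact .seq h₁ h₂
  | branch_nonzero hx _ h => exact .branch_nonzero hx h
  | branch_zero hx _ h => exact .branch_zero hx h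
  | loop_zero hx => exact .loop_zero hx
  | loop_nonzero hx _ _ h₁ h₂ => exact .loop_nonzero hx h₁ h₂

/-- The number of instructions of a program. -/
def Cmd.size : Cmd → ℕ
  | .seq p q => p.size + q.size
  | .branch _ p q => p.size + q.size + 1
  | .loop _ p => p.size + 1
  | _ => 1

/-- An instruction is repeated only by a new loop iteration. So, up to a factor that depends on the
program alone, it suffices to count iterations. -/
theorem RunIter.length_le {c : Cmd} {s s' : State} {t : List Action} {L : ℕ}
    (h : RunIter c s t L s') : t.length ≤ c.size * (L + 1) := by
  induction h with
  | seq _ _ h₁ h₂ => simp only [List.length_append, Cmd.size]; nlinarith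
  | branch_nonzero hx _ h => simp only [List.length_cons, Cmd.size]; nlinarith
  | branch_zero hx _ h => simp only [List.length_cons, Cmd.size]; nlinarith
  | loop_nonzero hx _ _ h₁ h₂ =>
    simp only [List.length_cons, List.length_append, Cmd.size] at *; nlinarith
  | _ => simp [Cmd.size]

/-! ### Expressions and structured programs -/

/-- Arithmetic expressions over the even registers; register `2 * x` is the variable `x`. -/
inductive Exp : Type
  | lit (c : ℕ) : Exp
  | var (x : ℕ) : Exp
  | add (e f : Exp) : Exp
  | sub (e f : Exp) : Exp
  | get (a : ℕ) (e : Exp) : Exp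
  | cond (e f g : Exp) : Exp

/-- The value of an expression. -/
@[simp] def Exp.ev (s : State) : Exp → ℕ
  | .lit c => c
  | .var x => s.reg x
  | .add e f => e.ev s + f.ev s
  | .sub e f => e.ev s - f.ev s
  | .get a e => s.arr a (e.ev s)
  | .cond e f g => if e.ev s = 0 then g.ev s else f.ev s

/-- The view of the memory in which the odd registers, used for intermediate results, are
hidden. -/
def abs (σ : State) : State := ⟨fun x => σ.reg (2 * x), σ.arr⟩

/-- Evaluate an expression into register `2 * d + 1`. -/
def Exp.code (d : ℕ) : Exp → Cmd
  | .lit c => .const (2 * d + 1) c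
  | .var x => .seq (.const (2 * d + 1) 0) (.add (2 * d + 1) (2 * d + 1) (2 * x))
  | .add e f => .seq (e.code d) (.seq (f.code (d + 1)) (.add (2 * d + 1) (2 * d + 1) (2 * d + 3)))
  | .sub e f => .seq (e.code d) (.seq (f.code (d + 1)) (.sub (2 * d + 1) (2 * d + 1) (2 * d + 3)))
  | .get a e => .seq (e.code d) (.load (2 * d + 1) a (2 * d + 1))
  | .cond e f g => .seq (e.code d) (.branch (2 * d + 1) (f.code d) (g.code d))

/-- A trace without outputs. -/
def Silent (t : List Action) : Prop := ∀ a ∈ t, a = Action.silent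

theorem Silent.append {t t' : List Action} (h : Silent t) (h' : Silent t') : Silent (t ++ t') := by
  intro a ha
  rcases List.mem_append.1 ha with ha | ha
  exacts [h a ha, h' a ha]

theorem Silent.cons {t : List Action} (h : Silent t) : Silent (Action.silent :: t) := by
  intro a ha
  rcases List.mem_cons.1 ha with ha | ha
  exacts [ha, h a ha]

theorem silent_singleton : Silent [Action.silent] := by intro a ha; simpa using ha

theorem abs_setReg_odd (σ : State) (d v : ℕ) : abs (σ.setReg (2 * d + 1) v) = abs σ := by
  ext x
  · simp only [abs, State.setReg_reg]
    rw [if_neg (by omega)]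
  · rfl

theorem abs_setReg_even (σ : State) (x v : ℕ) :
    abs (σ.setReg (2 * x) v) = (abs σ).setReg x v := by
  ext y
  · simp [abs]
  · rfl

theorem abs_setArr (σ : State) (a i v : ℕ) : abs (σ.setArr a i v) = (abs σ).setArr a i v := rfl

/-- Temporaries form a stack in the odd registers. The last clause lets the first operand of a
binary operation survive while the second one is evaluated one level higher. -/
theorem Exp.code_run (e : Exp) : ∀ (d : ℕ) (σ : State), ∃ t σ', RunIter (e.code d) σ t 0 σ' ∧
    Silent t ∧ abs σ' = abs σ ∧ σ'.reg (2 * d + 1) = e.ev (abs σ) ∧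
    ∀ i < d, σ'.reg (2 * i + 1) = σ.reg (2 * i + 1) := by
  induction e with
  | lit c =>
    intro d σ
    refine ⟨_, _, .const _ _ _, silent_singleton, abs_setReg_odd _ _ _, by simp, ?_⟩
    intro i hi
    simp; omega
  | var x =>
    intro d σ
    refine ⟨_, _, .seq (.const _ _ _) (.add _ _ _ _), silent_singleton.append silent_singleton,
      by rw [abs_setReg_odd, abs_setReg_odd], ?_, ?_⟩
    · simp [abs]; omega
    · intro i hi
      simp only [State.setReg_reg]
      rw [if_neg (by omega), if_neg (by omega)]
  | add e f he hf =>
    intro d σ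
    obtain ⟨t, σ₁, h₁, hs₁, ha₁, hv₁, hk₁⟩ := he d σ
    obtain ⟨t', σ₂, h₂, hs₂, ha₂, hv₂, hk₂⟩ := hf (d + 1) σ₁
    refine ⟨_, _, .seq h₁ (.seq h₂ (.add _ _ _ _)), hs₁.append (hs₂.append silent_singleton),
      by rw [abs_setReg_odd, ha₂, ha₁], ?_, ?_⟩
    · have h3 : 2 * d + 3 = 2 * (d + 1) + 1 := by ring
      simp only [State.setReg_reg, if_true, Exp.ev]
      rw [h3, hv₂, hk₂ d (by omega), hv₁, ha₁]
    · intro i hi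
      simp only [State.setReg_reg]
      rw [if_neg (by omega), hk₂ i (by omega), hk₁ i hi]
  | sub e f he hf =>
    intro d σ
    obtain ⟨t, σ₁, h₁, hs₁, ha₁, hv₁, hk₁⟩ := he d σ
    obtain ⟨t', σ₂, h₂, hs₂, ha₂, hv₂, hk₂⟩ := hf (d + 1) σ₁
    refine ⟨_, _, .seq h₁ (.seq h₂ (.sub _ _ _ _)), hs₁.append (hs₂.append silent_singleton),
      by rw [abs_setReg_odd, ha₂, ha₁], ?_, ?_⟩
    · have h3 : 2 * d + 3 = 2 * (d + 1) + 1 := by ring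
      simp only [State.setReg_reg, if_true, Exp.ev]
      rw [h3, hv₂, hk₂ d (by omega), hv₁, ha₁]
    · intro i hi
      simp only [State.setReg_reg]
      rw [if_neg (by omega), hk₂ i (by omega), hk₁ i hi]
  | get a e he =>
    intro d σ
    obtain ⟨t, σ₁, h₁, hs₁, ha₁, hv₁, hk₁⟩ := he d σ
    refine ⟨_, _, .seq h₁ (.load _ _ _ _), hs₁.append silent_singleton,
      by rw [abs_setReg_odd, ha₁], ?_, ?_⟩
    · simp only [State.setReg_reg, if_true, Exp.ev, hv₁]
      rw [← ha₁]
      rfl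
    · intro i hi
      simp only [State.setReg_reg]
      rw [if_neg (by omega), hk₁ i hi]
  | cond e f g he hf hg =>
    intro d σ
    obtain ⟨t, σ₁, h₁, hs₁, ha₁, hv₁, hk₁⟩ := he d σ
    by_cases hz : e.ev (abs σ) = 0
    · obtain ⟨t', σ₂, h₂, hs₂, ha₂, hv₂, hk₂⟩ := hg d σ₁
      refine ⟨_, _, .seq h₁ (.branch_zero (by rw [hv₁, hz]) h₂), hs₁.append hs₂.cons,
        by rw [ha₂, ha₁], ?_, fun i hi => by rw [hk₂ i hi, hk₁ i hi]⟩
      simp only [Exp.ev, hz, if_true]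
      rw [hv₂, ha₁]
    · obtain ⟨t', σ₂, h₂, hs₂, ha₂, hv₂, hk₂⟩ := hf d σ₁
      refine ⟨_, _, .seq h₁ (.branch_nonzero (by rwa [hv₁]) h₂), hs₁.append hs₂.cons,
        by rw [ha₂, ha₁], ?_, fun i hi => by rw [hk₂ i hi, hk₁ i hi]⟩
      simp only [Exp.ev, hz, if_false]
      rw [hv₂, ha₁]

infixr:60 " ;; " => Cmd.seq

/-- `x := e` -/
def setC (x : ℕ) (e : Exp) : Cmd := e.code 0 ;; Cmd.const (2 * x) 0 ;; Cmd.add (2 * x) (2 * x) 1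

/-- `a[e] := f` -/
def stoC (a : ℕ) (e f : Exp) : Cmd := e.code 0 ;; f.code 1 ;; Cmd.store a 1 3

/-- `if e ≠ 0 then p else q` -/
def iteC (e : Exp) (p q : Cmd) : Cmd := e.code 0 ;; Cmd.branch 1 p q

/-- `while e ≠ 0 do p` -/
def whileC (e : Exp) (p : Cmd) : Cmd := e.code 0 ;; Cmd.loop 1 (p ;; e.code 0)

/-- `for x from e - 1 down to 0 do p` -/
def forC (x : ℕ) (e : Exp) (p : Cmd) : Cmd :=
  setC x e ;; whileC (.var x) (setC x (.sub (.var x) (.lit 1)) ;; p)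

/-- write the value of an expression -/
def writeC (e : Exp) : Cmd := e.code 0 ;; Cmd.write 1

/-! ### Rules for total correctness -/

/-- Total correctness: started in a memory with view `s`, the program `c` terminates silently
after at most `T` loop iterations, in a memory whose view satisfies `Q`. -/
def Wp (c : Cmd) (T : ℕ) (s : State) (Q : State → Prop) : Prop :=
  ∀ σ, abs σ = s → ∃ t L σ', RunIter c σ t L σ' ∧ Silent t ∧ L ≤ T ∧ Q (abs σ')

theorem Wp.mono {c : Cmd} {T T' : ℕ} {s : State} {Q Q' : State → Prop} (h : Wp c T s Q)
    (hT : T ≤ T') (hQ : ∀ s', Q s' → Q' s') : Wp c T' s Q' := by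
  intro σ hσ
  obtain ⟨t, L, σ', hr, hs, hL, hq⟩ := h σ hσ
  exact ⟨t, L, σ', hr, hs, hL.trans hT, hQ _ hq⟩

theorem Wp.seq {p q : Cmd} {T₁ T₂ : ℕ} {s : State} {Q : State → Prop}
    (h : Wp p T₁ s fun s' => Wp q T₂ s' Q) : Wp (p ;; q) (T₁ + T₂) s Q := by
  intro σ hσ
  obtain ⟨t, L, σ', hr, hs, hL, hq⟩ := h σ hσ
  obtain ⟨t', L', σ'', hr', hs', hL', hq'⟩ := hq σ' rfl
  exact ⟨_, _, σ'', hr.seq hr', hs.append hs', by omega, hq'⟩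

theorem setC_run (x : ℕ) (e : Exp) (σ : State) : ∃ t σ', RunIter (setC x e) σ t 0 σ' ∧
    Silent t ∧ abs σ' = (abs σ).setReg x (e.ev (abs σ)) := by
  obtain ⟨t, σ₁, h₁, hs₁, ha₁, hv₁, -⟩ := e.code_run 0 σ
  refine ⟨_, _, h₁.seq ((RunIter.const _ _ _).seq (.add _ _ _ _)),
    hs₁.append (silent_singleton.append silent_singleton), ?_⟩
  rw [abs_setReg_even, abs_setReg_even, ha₁]
  ext y
  · simp only [State.setReg_reg, if_true]
    split_ifs with h1
    · omega
    · rw [← hv₁]; simp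
    · rfl
  · rfl

theorem wp_set {x : ℕ} {e : Exp} {T : ℕ} {s : State} {Q : State → Prop}
    (h : Q (s.setReg x (e.ev s))) : Wp (setC x e) T s Q := by
  rintro σ rfl
  obtain ⟨t, σ', hr, hs, ha⟩ := setC_run x e σ
  exact ⟨t, 0, σ', hr, hs, Nat.zero_le _, by rwa [ha]⟩

theorem wp_sto {a : ℕ} {e f : Exp} {T : ℕ} {s : State} {Q : State → Prop}
    (h : Q (s.setArr a (e.ev s) (f.ev s))) : Wp (stoC a e f) T s Q := by
  rintro σ rfl
  obtain ⟨t, σ₁, h₁, hs₁, ha₁, hv₁, -⟩ := e.code_run 0 σ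
  obtain ⟨t', σ₂, h₂, hs₂, ha₂, hv₂, hk₂⟩ := f.code_run 1 σ₁
  refine ⟨_, _, _, h₁.seq (h₂.seq (.store _ _ _ _)), hs₁.append (hs₂.append silent_singleton),
    by omega, ?_⟩
  have h1 := hk₂ 0 (by omega)
  simp only [Nat.mul_zero, Nat.zero_add, Nat.mul_one, Nat.reduceAdd] at h1 hv₁ hv₂
  rw [abs_setArr, ha₂, ha₁, h1, hv₁, hv₂, ha₁]
  exact h

theorem wp_set_seq {x : ℕ} {e : Exp} {q : Cmd} {T : ℕ} {s : State} {Q : State → Prop}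
    (h : Wp q T (s.setReg x (e.ev s)) Q) : Wp (setC x e ;; q) T s Q :=
  (Nat.zero_add T) ▸ Wp.seq (T₁ := 0) (wp_set h)

theorem wp_sto_seq {a : ℕ} {e f : Exp} {q : Cmd} {T : ℕ} {s : State} {Q : State → Prop}
    (h : Wp q T (s.setArr a (e.ev s) (f.ev s)) Q) : Wp (stoC a e f ;; q) T s Q :=
  (Nat.zero_add T) ▸ Wp.seq (T₁ := 0) (wp_sto h)

theorem wp_skip {T : ℕ} {s : State} {Q : State → Prop} (h : Q s) : Wp .skip T s Q := by
  rintro σ rfl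
  exact ⟨_, _, σ, .skip σ, silent_singleton, by omega, h⟩

theorem wp_ite {e : Exp} {p q : Cmd} {T : ℕ} {s : State} {Q : State → Prop}
    (h : e.ev s ≠ 0 → Wp p T s Q) (h' : e.ev s = 0 → Wp q T s Q) : Wp (iteC e p q) T s Q := by
  rintro σ rfl
  obtain ⟨t, σ₁, h₁, hs₁, ha₁, hv₁, -⟩ := e.code_run 0 σ
  by_cases hz : e.ev (abs σ) = 0
  · obtain ⟨t', L, σ₂, h₂, hs₂, hL, hq⟩ := h' hz σ₁ ha₁
    exact ⟨_, _, σ₂, h₁.seq (.branch_zero (by rw [hv₁, hz]) h₂), hs₁.append hs₂.cons,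
      by omega, hq⟩
  · obtain ⟨t', L, σ₂, h₂, hs₂, hL, hq⟩ := h hz σ₁ ha₁
    exact ⟨_, _, σ₂, h₁.seq (.branch_nonzero (by rwa [hv₁]) h₂), hs₁.append hs₂.cons,
      by omega, hq⟩

theorem wp_while_zero {e : Exp} {p : Cmd} {T : ℕ} {s : State} {Q : State → Prop}
    (hz : e.ev s = 0) (h : Q s) : Wp (whileC e p) T s Q := by
  rintro σ rfl
  obtain ⟨t, σ₁, h₁, hs₁, ha₁, hv₁, -⟩ := e.code_run 0 σ
  exact ⟨_, _, σ₁, h₁.seq (.loop_zero (by rw [hv₁, hz])), hs₁.append silent_singleton,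
    by omega, by rwa [ha₁]⟩

theorem wp_while_succ {e : Exp} {p : Cmd} {T₁ T₂ : ℕ} {s : State} {Q : State → Prop}
    (hz : e.ev s ≠ 0) (h : Wp p T₁ s fun s' => Wp (whileC e p) T₂ s' Q) :
    Wp (whileC e p) (T₁ + T₂ + 1) s Q := by
  rintro σ rfl
  obtain ⟨t, σ₁, h₁, hs₁, ha₁, hv₁, -⟩ := e.code_run 0 σ
  obtain ⟨t', L, σ₂, h₂, hs₂, hL, hq⟩ := h σ₁ ha₁
  obtain ⟨t'', L', σ₃, h₃, hs₃, hL', hq'⟩ := hq σ₂ rfl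
  -- The remaining run of `whileC` begins with an evaluation of `e`; it is split off and reassigned
  -- to the end of the loop body, where `whileC` evaluates `e` again.
  cases h₃ with
  | seq h₃ h₄ =>
    refine ⟨_, _, σ₃, h₁.seq (.loop_nonzero (by rwa [hv₁]) (h₂.seq h₃) h₄),
      hs₁.append ?_, by omega, hq'⟩
    rw [List.append_assoc]
    exact (hs₂.append hs₃).cons

/-! ### Frames: what a program leaves unchanged -/

/-- The variables that a program may change. -/
def Cmd.wr : Cmd → List ℕ
  | .const x _ => if x % 2 = 0 then [x / 2] else []
  | .add x _ _ => if x % 2 = 0 then [x / 2] else []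
  | .sub x _ _ => if x % 2 = 0 then [x / 2] else []
  | .load x _ _ => if x % 2 = 0 then [x / 2] else []
  | .seq p q => p.wr ++ q.wr
  | .branch _ p q => p.wr ++ q.wr
  | .loop _ p => p.wr
  | _ => []

/-- The arrays that a program may change. -/
def Cmd.wa : Cmd → List ℕ
  | .store a _ _ => [a]
  | .seq p q => p.wa ++ q.wa
  | .branch _ p q => p.wa ++ q.wa
  | .loop _ p => p.wa
  | _ => []

/-- Equality of two memories outside of some variables and arrays. -/
structure Frame (R A : List ℕ) (s s' : State) : Prop where
  reg : ∀ x, x ∉ R → s'.reg x = s.reg x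
  arr : ∀ a, a ∉ A → s'.arr a = s.arr a

theorem Frame.refl (R A : List ℕ) (s : State) : Frame R A s s := ⟨fun _ _ => rfl, fun _ _ => rfl⟩

theorem Frame.trans {R A : List ℕ} {s s' s'' : State} (h : Frame R A s s')
    (h' : Frame R A s' s'') : Frame R A s s'' :=
  ⟨fun x hx => (h'.reg x hx).trans (h.reg x hx), fun x hx => (h'.arr x hx).trans (h.arr x hx)⟩

theorem Frame.mono {R A R' A' : List ℕ} {s s' : State} (h : Frame R A s s')
    (hR : R ⊆ R') (hA : A ⊆ A') : Frame R' A' s s' :=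
  ⟨fun x hx => h.reg x fun h' => hx (hR h'), fun x hx => h.arr x fun h' => hx (hA h')⟩

theorem frame_setReg (x v : ℕ) (s : State) : Frame (if x % 2 = 0 then [x / 2] else []) []
    (abs s) (abs (s.setReg x v)) := by
  rcases Nat.even_or_odd' x with ⟨y, rfl | rfl⟩
  · rw [abs_setReg_even]
    refine ⟨fun x hx => ?_, fun _ _ => rfl⟩
    simp at hx
    simp [hx]
  · rw [abs_setReg_odd]
    exact .refl _ _ _

/-- With this, a specification only has to describe results; that everything else is preserved is
read off from the text of the program. -/
theorem RunIter.frame {c : Cmd} {s s' : State} {t : List Action} {L : ℕ}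
    (h : RunIter c s t L s') : Frame c.wr c.wa (abs s) (abs s') := by
  induction h with
  | skip s => exact .refl _ _ _
  | const x c s => exact frame_setReg _ _ _
  | add x y z s => exact frame_setReg _ _ _
  | sub x y z s => exact frame_setReg _ _ _
  | load x a y s => exact frame_setReg _ _ _
  | store a x y s =>
    refine ⟨fun _ _ => rfl, fun b hb => ?_⟩
    simp [Cmd.wa] at hb
    simp [abs_setArr, hb]
  | write x s => exact .refl _ _ _
  | emit s => exact .refl _ _ _
  | seq _ _ h₁ h₂ =>
    exact (h₁.mono (List.subset_append_left _ _) (List.subset_append_left _ _)).trans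
      (h₂.mono (List.subset_append_right _ _) (List.subset_append_right _ _))
  | branch_nonzero hx _ h =>
    exact h.mono (List.subset_append_left _ _) (List.subset_append_left _ _)
  | branch_zero hx _ h =>
    exact h.mono (List.subset_append_right _ _) (List.subset_append_right _ _)
  | loop_zero hx => exact .refl _ _ _
  | loop_nonzero hx _ _ h₁ h₂ => exact h₁.trans h₂

theorem Wp.frame {c : Cmd} {T : ℕ} {s : State} {Q : State → Prop} (h : Wp c T s Q) :
    Wp c T s fun s' => Frame c.wr c.wa s s' ∧ Q s' := by
  rintro σ rfl
  obtain ⟨t, L, σ', hr, hs, hL, hq⟩ := h σ rfl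
  exact ⟨t, L, σ', hr, hs, hL, hr.frame, hq⟩

theorem Wp.call {c : Cmd} {T T' : ℕ} {s : State} {Q Q' : State → Prop} (h : Wp c T s Q)
    (hT : T ≤ T') (hQ : ∀ s', Frame c.wr c.wa s s' → Q s' → Q' s') : Wp c T' s Q' :=
  h.frame.mono hT fun s' hs' => hQ s' hs'.1 hs'.2

theorem Wp.call_seq {c q : Cmd} {T₁ T : ℕ} (T₂ : ℕ) {s : State} {Q Q' : State → Prop}
    (h : Wp c T₁ s Q) (hT : T₁ + T₂ ≤ T)
    (hQ : ∀ s', Frame c.wr c.wa s s' → Q s' → Wp q T₂ s' Q') : Wp (c ;; q) T s Q' :=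
  (Wp.seq (h.call le_rfl hQ)).mono hT fun _ h => h

theorem Exp.wr_code (e : Exp) (d : ℕ) : (e.code d).wr = [] ∧ (e.code d).wa = [] := by
  induction e generalizing d <;> simp_all [Exp.code, Cmd.wr, Cmd.wa, Nat.add_mod]

@[simp] theorem wr_setC (x : ℕ) (e : Exp) : (setC x e).wr = [x, x] := by
  simp [setC, Cmd.wr, e.wr_code]

@[simp] theorem wa_setC (x : ℕ) (e : Exp) : (setC x e).wa = [] := by
  simp [setC, Cmd.wa, e.wr_code]

@[simp] theorem wr_stoC (a : ℕ) (e f : Exp) : (stoC a e f).wr = [] := by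
  simp [stoC, Cmd.wr, e.wr_code, f.wr_code]

@[simp] theorem wa_stoC (a : ℕ) (e f : Exp) : (stoC a e f).wa = [a] := by
  simp [stoC, Cmd.wa, e.wr_code, f.wr_code]

@[simp] theorem wr_iteC (e : Exp) (p q : Cmd) : (iteC e p q).wr = p.wr ++ q.wr := by
  simp [iteC, Cmd.wr, e.wr_code]

@[simp] theorem wa_iteC (e : Exp) (p q : Cmd) : (iteC e p q).wa = p.wa ++ q.wa := by
  simp [iteC, Cmd.wa, e.wr_code]

@[simp] theorem wr_whileC (e : Exp) (p : Cmd) : (whileC e p).wr = p.wr := by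
  simp [whileC, Cmd.wr, e.wr_code]

@[simp] theorem wa_whileC (e : Exp) (p : Cmd) : (whileC e p).wa = p.wa := by
  simp [whileC, Cmd.wa, e.wr_code]

@[simp] theorem wr_seq (p q : Cmd) : (p ;; q).wr = p.wr ++ q.wr := rfl

@[simp] theorem wa_seq (p q : Cmd) : (p ;; q).wa = p.wa ++ q.wa := rfl

@[simp] theorem wr_skip : Cmd.skip.wr = [] := rfl

@[simp] theorem wa_skip : Cmd.skip.wa = [] := rfl

@[simp] theorem wr_forC (x : ℕ) (e : Exp) (p : Cmd) :
    (forC x e p).wr = x :: x :: x :: x :: p.wr := by simp [forC]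

@[simp] theorem wa_forC (x : ℕ) (e : Exp) (p : Cmd) : (forC x e p).wa = p.wa := by simp [forC]

/-- The counter runs downwards, so `I j` describes the memory when all values from `j` on have been
processed. The frame relative to `s₀` is carried along, which relieves `I` of repeating what the
loop does not touch. -/
theorem wp_for_aux {x : ℕ} {p : Cmd} {T : ℕ} (s₀ : State) (I : ℕ → State → Prop)
    (hx : x ∉ p.wr) : ∀ (k : ℕ), (∀ j < k, ∀ s, Frame (x :: p.wr) p.wa s₀ s → I (j + 1) s →
      Wp p T (s.setReg x j) (I j)) → ∀ s, s.reg x = k → Frame (x :: p.wr) p.wa s₀ s → I k s →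
      Wp (whileC (.var x) (setC x (.sub (.var x) (.lit 1)) ;; p)) (k * (T + 1)) s
        (fun s' => s'.reg x = 0 ∧ Frame (x :: p.wr) p.wa s₀ s' ∧ I 0 s') := by
  intro k
  induction k with
  | zero => exact fun _ s hs hf hi => wp_while_zero hs ⟨hs, hf, hi⟩
  | succ k ih =>
    intro hstep s hs hf hi
    have := hstep k (by omega) s hf hi
    rw [show (k + 1) * (T + 1) = T + k * (T + 1) + 1 by ring]
    refine wp_while_succ (by simp [hs]) (wp_set_seq ?_)
    simp only [Exp.ev, hs, Nat.add_sub_cancel]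
    refine this.call le_rfl fun s' hf' hi' => ih (fun j hj => hstep j (by omega)) s' ?_ ?_ hi'
    · rw [hf'.reg x hx]; simp
    · refine hf.trans (Frame.trans (s' := s.setReg x k) ⟨?_, fun _ _ => rfl⟩
        (hf'.mono (List.subset_cons_self _ _) (List.Subset.refl _)))
      intro y hy
      simp only [List.mem_cons, not_or] at hy
      simp [hy.1]

/-- The rule for loops; the invariant has to speak only about what the loop changes. -/
theorem wp_for {x : ℕ} {e : Exp} {p : Cmd} {T : ℕ} {s : State} {Q : State → Prop}
    (hx : x ∉ p.wr) (k : ℕ) (hk : e.ev s = k) (I : ℕ → State → Prop) (h0 : I k (s.setReg x k))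
    (hstep : ∀ j < k, ∀ s', Frame (x :: p.wr) p.wa s s' → I (j + 1) s' →
      Wp p T (s'.setReg x j) (I j))
    (hQ : ∀ s', Frame (x :: p.wr) p.wa s s' → I 0 s' → Q s') :
    Wp (forC x e p) (k * (T + 1)) s Q := by
  refine wp_set_seq ?_
  rw [hk]
  have hf : Frame (x :: p.wr) p.wa s (s.setReg x k) := by
    refine ⟨?_, fun _ _ => rfl⟩
    intro y hy
    simp only [List.mem_cons, not_or] at hy
    simp [hy.1]
  exact (wp_for_aux s I hx k hstep _ (by simp) hf h0).mono le_rfl fun s' h => hQ s' h.2.1 h.2.2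

theorem wp_for_seq {x : ℕ} {e : Exp} {p q : Cmd} {T T₂ T' : ℕ} {s : State} {Q : State → Prop}
    (hx : x ∉ p.wr) (k : ℕ) (hk : e.ev s = k) (I : ℕ → State → Prop) (h0 : I k (s.setReg x k))
    (hT : k * (T + 1) + T₂ ≤ T')
    (hstep : ∀ j < k, ∀ s', Frame (x :: p.wr) p.wa s s' → I (j + 1) s' →
      Wp p T (s'.setReg x j) (I j))
    (hQ : ∀ s', Frame (x :: p.wr) p.wa s s' → I 0 s' → Wp q T₂ s' Q) :
    Wp (forC x e p ;; q) T' s Q :=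
  (Wp.seq (wp_for hx k hk I h0 hstep hQ)).mono hT fun _ h => h

/-- The continuation `c` is verified separately after each branch, so no common intermediate
assertion is needed. -/
theorem Wp.ite_seq {e : Exp} {p q c : Cmd} {T : ℕ} {s : State} {Q : State → Prop}
    (h : e.ev s ≠ 0 → Wp (p ;; c) T s Q) (h' : e.ev s = 0 → Wp (q ;; c) T s Q) :
    Wp (iteC e p q ;; c) T s Q := by
  rintro σ rfl
  obtain ⟨t, σ₁, h₁, hs₁, ha₁, hv₁, -⟩ := e.code_run 0 σ
  by_cases hz : e.ev (abs σ) = 0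
  · obtain ⟨t', L, σ₂, h₂, hs₂, hL, hq⟩ := h' hz σ₁ ha₁
    cases h₂ with
    | seq h₂ h₃ =>
      refine ⟨_, _, σ₂, (h₁.seq (.branch_zero (by rw [hv₁, hz]) h₂)).seq h₃, ?_, by omega, hq⟩
      simpa using hs₁.append hs₂.cons
  · obtain ⟨t', L, σ₂, h₂, hs₂, hL, hq⟩ := h hz σ₁ ha₁
    cases h₂ with
    | seq h₂ h₃ =>
      refine ⟨_, _, σ₂, (h₁.seq (.branch_nonzero (by rwa [hv₁]) h₂)).seq h₃, ?_, by omega, hq⟩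
      simpa using hs₁.append hs₂.cons

theorem Wp.skip_seq {c : Cmd} {T : ℕ} {s : State} {Q : State → Prop} (h : Wp c T s Q) :
    Wp (.skip ;; c) T s Q :=
  (Nat.zero_add T) ▸ Wp.seq (T₁ := 0) (wp_skip h)

/-! ### Sets of vertices as numbers -/

/-- A set of vertices as a bit mask. -/
def code {n : ℕ} (S : Finset (Fin n)) : ℕ := ∑ v ∈ S, 2 ^ (v : ℕ)

@[simp] theorem code_empty {n : ℕ} : code (∅ : Finset (Fin n)) = 0 := rfl

@[simp] theorem code_singleton {n : ℕ} (v : Fin n) : code {v} = 2 ^ (v : ℕ) := by simp [code]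

theorem code_insert {n : ℕ} {v : Fin n} {S : Finset (Fin n)} (h : v ∉ S) :
    code (insert v S) = code S + 2 ^ (v : ℕ) := by
  rw [code, Finset.sum_insert h, add_comm, code]

theorem code_erase {n : ℕ} {v : Fin n} {S : Finset (Fin n)} (h : v ∈ S) :
    code (S.erase v) = code S - 2 ^ (v : ℕ) := by
  have := code_insert (Finset.notMem_erase v S)
  rw [Finset.insert_erase h] at this
  omega

theorem code_injective {n : ℕ} : Function.Injective (code (n := n)) := by
  intro S T h
  have key (S : Finset (Fin n)) : code S = ∑ i ∈ S.map Fin.valEmbedding, 2 ^ i := by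
    simp [code]
  rw [key, key] at h
  exact Finset.map_injective _ (Finset.geomSum_injective le_rfl h)

theorem code_inj {n : ℕ} {S T : Finset (Fin n)} : code S = code T ↔ S = T :=
  code_injective.eq_iff

theorem code_univ (n : ℕ) : code (Finset.univ : Finset (Fin n)) = 2 ^ n - 1 := by
  rw [code, Fin.sum_univ_eq_sum_range (fun i => 2 ^ i), Nat.geomSum_eq le_rfl]
  simp

theorem code_compl {n : ℕ} (S : Finset (Fin n)) : code Sᶜ = 2 ^ n - 1 - code S := by
  have : code S + code Sᶜ = code (Finset.univ : Finset (Fin n)) :=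
    Finset.sum_add_sum_compl S _
  rw [code_univ] at this
  omega

/-- The part of a set below a bound. -/
def low {n : ℕ} (j : ℕ) (S : Finset (Fin n)) : Finset (Fin n) := S.filter fun v => (v : ℕ) < j

theorem mem_low {n : ℕ} {j : ℕ} {S : Finset (Fin n)} {v : Fin n} :
    v ∈ low j S ↔ v ∈ S ∧ (v : ℕ) < j := by simp [low]

@[simp] theorem low_self {n : ℕ} (S : Finset (Fin n)) : low n S = S := by
  ext v; simp [mem_low]

theorem code_low_lt {n : ℕ} (j : ℕ) (S : Finset (Fin n)) : code (low j S) < 2 ^ j := by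
  have h : code (low j S) ≤ ∑ i ∈ Finset.range j, 2 ^ i := by
    have := Finset.sum_map (low j S) Fin.valEmbedding (fun i => 2 ^ i)
    simp only [Fin.valEmbedding_apply] at this
    rw [code, ← this]
    refine Finset.sum_le_sum_of_subset fun i hi => ?_
    simp only [Finset.mem_map, mem_low] at hi
    obtain ⟨v, hv, rfl⟩ := hi
    simpa using hv.2
  rw [Nat.geomSum_eq le_rfl] at h
  have : 0 < 2 ^ j := by positivity
  omega

theorem code_low_succ {n : ℕ} {j : ℕ} (hj : j < n) (S : Finset (Fin n)) :
    code (low (j + 1) S) = code (low j S) + if (⟨j, hj⟩ : Fin n) ∈ S then 2 ^ j else 0 := by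
  split_ifs with h
  · rw [show low (j + 1) S = insert ⟨j, hj⟩ (low j S) from ?_, code_insert (by simp [mem_low])]
    ext v
    simp only [mem_low, Finset.mem_insert, Fin.ext_iff]
    constructor
    · intro h; have := h.2; grind
    · rintro (h' | h')
      · rw [show v = ⟨j, hj⟩ from Fin.ext h']; exact ⟨h, by simp⟩
      · exact ⟨h'.1, by omega⟩
  · rw [show low (j + 1) S = low j S from ?_]; · rfl
    ext v
    simp only [mem_low]
    constructor
    · intro h'
      refine ⟨h'.1, ?_⟩
      have : (v : ℕ) ≠ j := by
        rintro rfl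
        exact h h'.1
      omega
    · exact fun h' => ⟨h'.1, by omega⟩

/-- The bits below `j` sum to less than `2 ^ j`, so a single comparison reveals the top bit. The
machine has no division or shift; sets are therefore taken apart by removing bits from the top. -/
theorem pow_le_code_low {n : ℕ} {j : ℕ} (hj : j < n) (S : Finset (Fin n)) :
    2 ^ j ≤ code (low (j + 1) S) ↔ (⟨j, hj⟩ : Fin n) ∈ S := by
  rw [code_low_succ hj]
  have := code_low_lt j S
  split_ifs with h <;> simp [h]
  omega

/-! ### Subroutines for sets and lists of sets -/

/-- Register `0` holds `n`, register `7` the code of the full vertex set, and array `1` the powers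
of two. -/
structure Env (n : ℕ) (s : State) : Prop where
  size : s.reg 0 = n
  full : s.reg 7 = 2 ^ n - 1
  pow : ∀ v < n, s.arr 1 v = 2 ^ v

theorem Env.frame {n : ℕ} {R A : List ℕ} {s s' : State} (h : Env n s) (hf : Frame R A s s')
    (h0 : 0 ∉ R) (h7 : 7 ∉ R) (h1 : 1 ∉ A) : Env n s' := by
  refine ⟨?_, ?_, ?_⟩
  · rw [hf.reg 0 h0, h.size]
  · rw [hf.reg 7 h7, h.full]
  · rw [hf.arr 1 h1]; exact h.pow

theorem Env.setReg {n : ℕ} {s : State} (h : Env n s) (x v : ℕ) (h0 : x ≠ 0) (h7 : x ≠ 7) :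
    Env n (s.setReg x v) :=
  ⟨by simp [h0.symm, h.size], by simp [h7.symm, h.full], h.pow⟩

theorem Env.setArr {n : ℕ} {s : State} (h : Env n s) (a i v : ℕ) (h1 : a ≠ 1) :
    Env n (s.setArr a i v) :=
  ⟨h.size, h.full, by simp [h1.symm]; exact h.pow⟩

/-- Array `a` lists the codes of the sets in `L`, and register `c` holds their number. -/
structure HasList {n : ℕ} (s : State) (a c : ℕ) (L : List (Finset (Fin n))) : Prop where
  len : s.reg c = L.length
  get : ∀ (j : ℕ) (h : j < L.length), s.arr a j = code L[j]

theorem HasList.frame {n : ℕ} {R A : List ℕ} {s s' : State} {a c : ℕ}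
    {L : List (Finset (Fin n))} (h : HasList s a c L) (hf : Frame R A s s')
    (h0 : c ∉ R) (h1 : a ∉ A) : HasList s' a c L := by
  refine ⟨?_, ?_⟩
  · rw [hf.reg c h0, h.len]
  · rw [hf.arr a h1]; exact h.get

theorem HasList.setReg {n : ℕ} {s : State} {a c : ℕ} {L : List (Finset (Fin n))}
    (h : HasList s a c L) (x v : ℕ) (h0 : x ≠ c) : HasList (s.setReg x v) a c L :=
  ⟨by simp [h0.symm, h.len], h.get⟩

theorem HasList.setArr {n : ℕ} {s : State} {a c : ℕ} {L : List (Finset (Fin n))}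
    (h : HasList s a c L) (b i v : ℕ) (h0 : b ≠ a) : HasList (s.setArr b i v) a c L :=
  ⟨h.len, by simp [h0.symm]; exact h.get⟩

theorem HasList.nil {n : ℕ} {s : State} {a c : ℕ} (h : s.reg c = 0) :
    HasList (n := n) s a c [] := ⟨h, by simp⟩

theorem HasList.push {n : ℕ} {s s' : State} {a c : ℕ} {L : List (Finset (Fin n))}
    {S : Finset (Fin n)} (h : HasList s a c L) (hc : s'.reg c = s.reg c + 1)
    (ha : s'.arr a = Function.update (s.arr a) (s.reg c) (code S)) :
    HasList s' a c (L ++ [S]) := by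
  refine ⟨by simp [hc, h.len], fun j hj => ?_⟩
  rw [ha, h.len, Function.update_apply]
  simp at hj
  split_ifs with h'
  · subst h'; simp
  · rw [List.getElem_append_left (by omega)]
    exact h.get j (by omega)

/-- Register `25` gets `1` if the set coded by `ex` is a subset of that coded by `ey`, else `0`. -/
def subC (ex ey : Exp) : Cmd :=
  setC 20 ex ;; setC 21 ey ;; setC 25 (.lit 1) ;;
  forC 22 (.var 0)
    (setC 23 (.sub (.lit 1) (.sub (.get 1 (.var 22)) (.var 20))) ;;
     setC 24 (.sub (.lit 1) (.sub (.get 1 (.var 22)) (.var 21))) ;;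
     setC 20 (.sub (.var 20) (.cond (.var 23) (.get 1 (.var 22)) (.lit 0))) ;;
     setC 21 (.sub (.var 21) (.cond (.var 24) (.get 1 (.var 22)) (.lit 0))) ;;
     setC 25 (.cond (.var 23) (.cond (.var 24) (.var 25) (.lit 0)) (.var 25)))

@[simp] theorem mem_wr_subC (ex ey : Exp) (x : ℕ) :
    x ∈ (subC ex ey).wr ↔ x ∈ [20, 21, 22, 23, 24, 25] := by
  simp [subC]; tauto

@[simp] theorem wa_subC (ex ey : Exp) : (subC ex ey).wa = [] := by simp [subC]

theorem one_sub_sub_eq (a b : ℕ) : 1 - (a - b) = if a ≤ b then 1 else 0 := by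
  split_ifs <;> omega

/-- The bits of both masks are removed from the top, and the flag drops at a bit of `S` that is
missing in `T`. The expression `ey` is evaluated when register `20` has already been overwritten,
which explains the form of `hy`. -/
theorem subC_spec {n : ℕ} {s : State} {ex ey : Exp} (hE : Env n s) (S T : Finset (Fin n))
    (hx : ex.ev s = code S) (hy : ey.ev (s.setReg 20 (code S)) = code T) :
    Wp (subC ex ey) n s fun s' => s'.reg 25 = if S ⊆ T then 1 else 0 := by
  refine wp_set_seq (wp_set_seq (wp_set_seq ?_))
  rw [hx, hy]
  refine (wp_for (T := 0) (by simp) n (by simp [hE.size]) (fun j s' =>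
    s'.reg 20 = code (low j S) ∧ s'.reg 21 = code (low j T) ∧
    s'.reg 25 = if ∀ v ∈ S, j ≤ (v : ℕ) → v ∈ T then 1 else 0) ?_ ?_ ?_).mono (by simp)
    fun _ h => h
  · simp
  · rintro j hj s' hf ⟨h1, h2, h3⟩
    have hp : s'.arr 1 j = 2 ^ j := by rw [hf.arr 1 (by simp)]; exact hE.pow j hj
    refine wp_set_seq (wp_set_seq (wp_set_seq (wp_set_seq (wp_set ?_))))
    simp only [Exp.ev, State.setReg_reg, State.setReg_arr, Nat.reduceEqDiff, if_true, if_false]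
    simp only [hp, h1, h2, one_sub_sub_eq, pow_le_code_low hj, h3]
    have hS := code_low_succ hj S
    have hT := code_low_succ hj T
    have key : (∀ v ∈ S, j ≤ (v : ℕ) → v ∈ T) ↔
        ((⟨j, hj⟩ : Fin n) ∈ S → (⟨j, hj⟩ : Fin n) ∈ T) ∧
          ∀ v ∈ S, j + 1 ≤ (v : ℕ) → v ∈ T := by
      constructor
      · exact fun h => ⟨fun h' => h _ h' le_rfl, fun v hv h' => h v hv (by omega)⟩
      · rintro ⟨h, h'⟩ v hv hjv
        rcases hjv.eq_or_lt with h0 | h0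
        · subst h0; exact h hv
        · exact h' v hv h0
    rw [if_congr key rfl rfl, hS, hT]
    by_cases hjS : (⟨j, hj⟩ : Fin n) ∈ S <;> by_cases hjT : (⟨j, hj⟩ : Fin n) ∈ T <;>
      simp [hjS, hjT]
  · rintro s' - ⟨-, -, h⟩
    simpa [Finset.subset_iff] using h

/-- Register `27` gets `1` if some set in the list in array `a` contains (if `sw` is false) or is
contained in (if `sw` is true) the set coded by `e`, and `0` otherwise. -/
def anyC (sw : Bool) (a c : ℕ) (e : Exp) : Cmd :=
  setC 26 e ;; setC 27 (.lit 0) ;;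
  forC 28 (.var c)
    (subC (bif sw then .get a (.var 28) else .var 26) (bif sw then .var 26 else .get a (.var 28)) ;;
     setC 27 (.cond (.var 25) (.lit 1) (.var 27)))

@[simp] theorem mem_wr_anyC (sw : Bool) (a c : ℕ) (e : Exp) (x : ℕ) :
    x ∈ (anyC sw a c e).wr ↔ x ∈ [20, 21, 22, 23, 24, 25, 26, 27, 28] := by
  simp [anyC]; tauto

@[simp] theorem wa_anyC (sw : Bool) (a c : ℕ) (e : Exp) : (anyC sw a c e).wa = [] := by
  simp [anyC]

theorem anyC_spec {n : ℕ} {s : State} {e : Exp} (hE : Env n s) (sw : Bool) {a c : ℕ}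
    {L : List (Finset (Fin n))} (hL : HasList s a c L) (hc : c < 20) (S : Finset (Fin n))
    (hx : e.ev s = code S) :
    Wp (anyC sw a c e) (L.length * (n + 1)) s fun s' =>
      s'.reg 27 ≠ 0 ↔ ∃ T ∈ L, if sw then T ⊆ S else S ⊆ T := by
  refine wp_set_seq (wp_set_seq ?_)
  refine wp_for (by simp) L.length ?_ (fun j s' =>
    s'.reg 27 ≠ 0 ↔ ∃ (i : ℕ) (h : i < L.length), j ≤ i ∧
      (if sw then L[i] ⊆ S else S ⊆ L[i])) ?_ ?_ ?_
  · simp only [← hL.len, Exp.ev, State.setReg_reg]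
    rw [if_neg (by omega), if_neg (by omega)]
  · simp
    intro x hx h; omega
  · rintro j hj s' hf hI
    have ha : s'.arr a j = code L[j] := by rw [hf.arr a (by simp)]; exact hL.get j hj
    have h26 : s'.reg 26 = code S := by rw [hf.reg 26 (by simp)]; simp [hx]
    have hE' : Env n (s'.setReg 28 j) := Env.setReg (Env.frame ((hE.setReg 26 _ (by simp)
      (by simp)).setReg 27 _ (by simp) (by simp)) hf (by simp) (by simp) (by simp)) _ _ (by simp)
      (by simp)
    have : Wp (subC (bif sw then .get a (.var 28) else .var 26)
        (bif sw then .var 26 else .get a (.var 28))) n (s'.setReg 28 j) fun s'' =>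
        s''.reg 25 = if (if sw then L[j] ⊆ S else S ⊆ L[j]) then 1 else 0 := by
      cases sw
      · exact subC_spec hE' _ _ (by simp [h26]) (by simp [ha])
      · exact subC_spec hE' _ _ (by simp [ha]) (by simp [h26])
    refine this.call_seq 0 (by simp) fun s'' hf' h25 => wp_set ?_
    have h27 : s''.reg 27 = s'.reg 27 := by rw [hf'.reg 27 (by simp)]; simp
    have key : (∃ (i : ℕ) (h : i < L.length), j ≤ i ∧
        (if sw then L[i] ⊆ S else S ⊆ L[i])) ↔ ((if sw then L[j] ⊆ S else S ⊆ L[j]) ∨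
        (∃ (i : ℕ) (h : i < L.length), j + 1 ≤ i ∧
        (if sw then L[i] ⊆ S else S ⊆ L[i]))) := by
      constructor
      · rintro ⟨i, hi, hji, h⟩
        rcases hji.eq_or_lt with rfl | h0
        · exact .inl h
        · exact .inr ⟨i, hi, h0, h⟩
      · rintro (h | ⟨i, hi, hji, h⟩)
        · exact ⟨j, hj, le_rfl, h⟩
        · exact ⟨i, hi, by omega, h⟩
    rw [key, ← hI, ← h27]
    simp only [Exp.ev, h25, State.setReg_reg, if_true]
    split_ifs <;> simp_all
  · intro s' _ h
    rw [h]
    simp only [Nat.zero_le, true_and, List.mem_iff_getElem]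
    constructor
    · rintro ⟨i, hi, h⟩; exact ⟨_, ⟨i, hi, rfl⟩, h⟩
    · rintro ⟨_, ⟨i, hi, rfl⟩, h⟩; exact ⟨i, hi, h⟩

/-- Fill array `1` with the powers of two and put the code of the full set into register `7`. -/
def powC : Cmd :=
  setC 7 (.lit 1) ;; setC 29 (.lit 0) ;;
  forC 30 (.var 0)
    (stoC 1 (.var 29) (.var 7) ;; setC 7 (.add (.var 7) (.var 7)) ;;
     setC 29 (.add (.var 29) (.lit 1))) ;;
  setC 7 (.sub (.var 7) (.lit 1))

@[simp] theorem mem_wr_powC (x : ℕ) : x ∈ powC.wr ↔ x ∈ [7, 29, 30] := by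
  simp [powC]; tauto

@[simp] theorem wa_powC : powC.wa = [1] := by simp [powC]

theorem powC_spec {n : ℕ} {s : State} (h : s.reg 0 = n) : Wp powC n s (Env n) := by
  refine wp_set_seq (wp_set_seq ?_)
  refine wp_for_seq (T := 0) (T₂ := 0) (by simp) n (by simp [h]) (fun j s' =>
    s'.reg 29 + j = n ∧ s'.reg 7 = 2 ^ s'.reg 29 ∧ ∀ v < s'.reg 29, s'.arr 1 v = 2 ^ v)
    (by simp) (by simp) ?_ ?_
  · rintro j hj s' - ⟨h1, h2, h3⟩
    refine wp_sto_seq (wp_set_seq (wp_set ?_))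
    simp only [Exp.ev, State.setReg_reg, State.setReg_arr, State.setArr_reg, State.setArr_arr,
      Nat.reduceEqDiff, if_true, if_false]
    refine ⟨by omega, by rw [h2, pow_succ]; omega, fun v hv => ?_⟩
    rw [Function.update_apply, h2]
    split_ifs with h
    · rw [h]
    · exact h3 v (by omega)
  · rintro s' hf ⟨h1, h2, h3⟩
    refine wp_set ⟨?_, ?_, ?_⟩
    · simp [hf.reg 0, h]
    · simp [h2, show s'.reg 29 = n by omega]
    · intro v hv; simp; exact h3 v (by omega)

/-! ### Running a given algorithm as a subroutine -/

/-- Translate a program so that it uses the registers from `100` and the arrays from `20`, with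
array indices shifted by register `3`. Register `4` is a bound for the indices in use. Outputs are
replaced by the handlers `W` (which finds the written value in register `6`) and `E`. The program is
aborted as soon as a handler puts a nonzero value into register `5`. -/
def embC (W E : Cmd) : Cmd → Cmd
  | .skip => .skip
  | .const x c => setC (x + 100) (.lit c)
  | .add x y z => setC (x + 100) (.add (.var (y + 100)) (.var (z + 100)))
  | .sub x y z => setC (x + 100) (.sub (.var (y + 100)) (.var (z + 100)))
  | .load x a y => setC (x + 100) (.get (a + 20) (.add (.var 3) (.var (y + 100))))
  | .store a x y =>
      stoC (a + 20) (.add (.var 3) (.var (x + 100))) (.var (y + 100)) ;;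
      setC 4 (.add (.var 4)
        (.sub (.add (.add (.var 3) (.var (x + 100))) (.lit 1)) (.var 4)))
  | .write x => setC 6 (.var (x + 100)) ;; W
  | .emit => E
  | .seq p q => embC W E p ;; iteC (.var 5) .skip (embC W E q)
  | .branch x p q => iteC (.var (x + 100)) (embC W E p) (embC W E q)
  | .loop x p => whileC (.cond (.var 5) (.lit 0) (.var (x + 100))) (embC W E p)

/-- The memory `σ` contains the memory `s` of an embedded program. -/
structure Sim (σ s : State) : Prop where
  reg : ∀ x, σ.reg (x + 100) = s.reg x
  arr : ∀ a i, σ.arr (a + 20) (σ.reg 3 + i) = s.arr a i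
  top : ∀ a i, σ.reg 4 ≤ i → σ.arr (a + 20) i = 0

theorem Sim.setReg {σ s : State} (h : Sim σ s) (x v : ℕ) :
    Sim (σ.setReg (x + 100) v) (s.setReg x v) := by
  refine ⟨fun y => ?_, fun a i => ?_, fun a i hi => ?_⟩
  · simp [h.reg]
  · simp [h.arr]
  · simp at hi; simpa using h.top a i hi

theorem Sim.frame {σ σ' s : State} {R A : List ℕ} (h : Sim σ s) (hf : Frame R A σ σ')
    (hR : ∀ x ∈ R, x < 100 ∧ x ≠ 3 ∧ x ≠ 4) (hA : ∀ a ∈ A, a < 20) : Sim σ' s := by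
  have hr (x : ℕ) (hx : x ≥ 100 ∨ x = 3 ∨ x = 4) : σ'.reg x = σ.reg x :=
    hf.reg x fun h => by have := hR x h; omega
  have ha (a : ℕ) : σ'.arr (a + 20) = σ.arr (a + 20) :=
    hf.arr _ fun h => by have := hA _ h; omega
  refine ⟨fun y => ?_, fun a i => ?_, fun a i hi => ?_⟩
  · rw [hr _ (by omega), h.reg]
  · rw [hr _ (by omega), ha, h.arr]
  · rw [hr _ (by omega)] at hi; rw [ha, h.top a i hi]

/-- Adding a truncated difference computes a maximum: register `4` is raised past the written index
if necessary, so all entries from that bound on remain `0`. -/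
theorem Sim.store {σ s : State} (h : Sim σ s) (a x y : ℕ) :
    Sim ((σ.setArr (a + 20) (σ.reg 3 + σ.reg (x + 100)) (σ.reg (y + 100))).setReg 4
      (σ.reg 4 + (σ.reg 3 + σ.reg (x + 100) + 1 - σ.reg 4)))
      (s.setArr a (s.reg x) (s.reg y)) := by
  refine ⟨fun y => by simp [h.reg], fun b i => ?_, fun b i hi => ?_⟩
  · simp only [State.setReg_reg, State.setReg_arr, State.setArr_reg, State.setArr_arr, h.reg,
      Nat.add_right_cancel_iff]
    by_cases hb : b = a
    · subst hb
      simp [Function.update_apply, h.arr]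
    · simp [hb, h.arr]
  · simp only [State.setReg_reg, State.setReg_arr, State.setArr_reg, State.setArr_arr, h.reg,
      Nat.add_right_cancel_iff, if_true] at hi ⊢
    split_ifs with hb
    · subst hb
      rw [Function.update_of_ne (by omega)]
      exact h.top b i (by omega)
    · exact h.top b i (by omega)

/-- Induction on the simulated run. Here `full` is the whole trace, `u` the part executed before,
and `M u` an invariant kept by the handlers that does not depend on the simulated memory. Either the
part `t` is simulated to its end, or a handler aborts after a prefix `t'` and leaves `B`. Which of
the two happens depends only on the trace and not on `σ`, as `hE` requires of the handler. Each
simulated step costs at most `K` iterations. -/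
theorem embC_sim {W E A : Cmd} {s s' : State} {t full : List Action} {K : ℕ}
    {M B : List Action → State → Prop}
    (hWr : ∀ x ∈ W.wr, x < 100 ∧ x ≠ 3 ∧ x ≠ 4) (hWa : ∀ a ∈ W.wa, a < 20) (hW5 : 5 ∉ W.wr)
    (hEr : ∀ x ∈ E.wr, x < 100 ∧ x ≠ 3 ∧ x ≠ 4) (hEa : ∀ a ∈ E.wa, a < 20)
    (hM : ∀ u σ σ', (∀ x < 100, x ≠ 4 → x ≠ 6 → σ'.reg x = σ.reg x) →
      (∀ a < 20, σ'.arr a = σ.arr a) → M u σ → M u σ')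
    (hK : 1 ≤ K)
    (hsil : ∀ u σ, M u σ → M (u ++ [Action.silent]) σ)
    (hW : ∀ u v σ, M u σ → σ.reg 6 = v → u ++ [Action.write v] <+: full →
      Wp W K σ (M (u ++ [Action.write v])))
    (hE : ∀ u, u ++ [Action.emit] <+: full →
      (∀ σ, M u σ → σ.reg 5 = 0 →
        Wp E K σ (fun σ' => σ'.reg 5 = 0 ∧ M (u ++ [Action.emit]) σ')) ∨
      (∀ σ, M u σ → σ.reg 5 = 0 →
        Wp E K σ (fun σ' => σ'.reg 5 ≠ 0 ∧ B (u ++ [Action.emit]) σ')))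
    (h : Run A s t s') : ∀ u, u ++ t <+: full →
    (∀ σ, Sim σ s → σ.reg 5 = 0 → M u σ → Wp (embC W E A) (K * t.length) σ
      (fun σ' => Sim σ' s' ∧ σ'.reg 5 = 0 ∧ M (u ++ t) σ')) ∨
    ∃ t', t' <+: t ∧ ∀ σ, Sim σ s → σ.reg 5 = 0 → M u σ → Wp (embC W E A) (K * t'.length) σ
      (fun σ' => σ'.reg 5 ≠ 0 ∧ B (u ++ t') σ') := by
  have hset (u : List Action) (σ : State) (x v : ℕ) (h : M u σ) :
      M (u ++ [Action.silent]) (σ.setReg (x + 100) v) :=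
    hM _ σ _ (fun y hy _ _ => by simp; omega) (fun _ _ => rfl) (hsil _ _ h)
  induction h with
  | skip s => exact fun u _ => .inl fun σ hs h5 hm => wp_skip ⟨hs, h5, hsil _ _ hm⟩
  | const x c s =>
    exact fun u _ => .inl fun σ hs h5 hm =>
      wp_set ⟨hs.setReg _ _, by simpa using h5, hset _ _ _ _ hm⟩
  | add x y z s =>
    refine fun u _ => .inl fun σ hs h5 hm => wp_set ⟨?_, by simpa using h5, hset _ _ _ _ hm⟩
    simpa [hs.reg] using hs.setReg x _
  | sub x y z s =>
    refine fun u _ => .inl fun σ hs h5 hm => wp_set ⟨?_, by simpa using h5, hset _ _ _ _ hm⟩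
    simpa [hs.reg] using hs.setReg x _
  | load x a y s =>
    refine fun u _ => .inl fun σ hs h5 hm => wp_set ⟨?_, by simpa using h5, hset _ _ _ _ hm⟩
    simpa [hs.reg, hs.arr] using hs.setReg x _
  | store a x y s =>
    refine fun u _ => .inl fun σ hs h5 hm =>
      wp_sto_seq (wp_set ⟨hs.store a x y, by simpa using h5, ?_⟩)
    refine hM _ σ _ (fun y hy h4 _ => by simp [h4]) (fun b hb => ?_) (hsil _ _ hm)
    simp
    omega
  | write x s =>
    intro u hu
    refine .inl fun σ hs h5 hm => wp_set_seq ?_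
    have hs' : Sim (σ.setReg 6 (σ.reg (x + 100))) s := by
      refine ⟨fun y => by simp [hs.reg], fun a i => by simp [hs.arr], fun a i hi => ?_⟩
      simp at hi; simpa using hs.top a i hi
    have hm' : M u (σ.setReg 6 (σ.reg (x + 100))) :=
      hM _ σ _ (fun y hy _ h6 => by simp [h6]) (fun _ _ => rfl) hm
    refine (hW u (s.reg x) _ hm' (by simp [hs.reg]) hu).call (by simp)
      fun σ' hf hm' => ⟨?_, ?_, hm'⟩
    · exact hs'.frame hf hWr hWa
    · rw [hf.reg 5 hW5]; simpa using h5
  | emit s =>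
    intro u hu
    rcases hE u hu with h | h
    · exact .inl fun σ hs h5 hm =>
        (h σ hm h5).call (by simp) fun σ' hf hm' => ⟨hs.frame hf hEr hEa, hm'⟩
    · exact .inr ⟨_, List.prefix_rfl, fun σ hs h5 hm => (h σ hm h5).mono (by simp) fun _ h => h⟩
  | @seq p q s s₁ s₂ t t' _ _ ih₁ ih₂ =>
    intro u hu
    rw [← List.append_assoc] at hu
    rcases ih₁ u ((List.prefix_append _ _).trans hu) with h | ⟨t₁, ht, h⟩
    · rcases ih₂ (u ++ t) hu with h' | ⟨t₁, ht, h'⟩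
      · refine .inl fun σ hs h5 hm => (h σ hs h5 hm).call_seq (K * t'.length)
          (by simp [Nat.mul_add]) fun σ' _ hq => wp_ite (fun h0 => absurd hq.2.1 h0) fun h0 => ?_
        rw [← List.append_assoc]
        exact h' σ' hq.1 h0 hq.2.2
      · refine .inr ⟨t ++ t₁, (List.prefix_append_right_inj t).2 ht, fun σ hs h5 hm =>
          (h σ hs h5 hm).call_seq (K * t₁.length)
          (by simp [Nat.mul_add]) fun σ' _ hq => wp_ite (fun h0 => absurd hq.2.1 h0) fun h0 => ?_⟩
        rw [← List.append_assoc]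
        exact h' σ' hq.1 h0 hq.2.2
    · refine .inr ⟨t₁, ht.trans (List.prefix_append _ _), fun σ hs h5 hm =>
        (h σ hs h5 hm).call_seq 0 (by simp) fun σ' _ hq => wp_ite (fun _ => wp_skip hq)
        fun h0 => absurd h0 hq.1⟩
  | @branch_nonzero x p q s s' t hx _ ih =>
    intro u hu
    rw [List.append_cons] at hu
    rcases ih (u ++ [.silent]) hu with h | ⟨t₁, ht, h⟩
    · refine .inl fun σ hs h5 hm => wp_ite (fun h0 => ?_) fun h0 => absurd h0 (by simp [hs.reg, hx])
      rw [List.append_cons]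
      exact (h σ hs h5 (hsil _ _ hm)).mono (by gcongr; simp) fun _ h => h
    · refine .inr ⟨.silent :: t₁, by simpa using ht, fun σ hs h5 hm =>
        wp_ite (fun h0 => ?_) fun h0 => absurd h0 (by simp [hs.reg, hx])⟩
      rw [List.append_cons]
      exact (h σ hs h5 (hsil _ _ hm)).mono (by gcongr; simp) fun _ h => h
  | @branch_zero x p q s s' t hx _ ih =>
    intro u hu
    rw [List.append_cons] at hu
    rcases ih (u ++ [.silent]) hu with h | ⟨t₁, ht, h⟩
    · refine .inl fun σ hs h5 hm => wp_ite (fun h0 => absurd hx (by simpa [hs.reg] using h0))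
        fun h0 => ?_
      rw [List.append_cons]
      exact (h σ hs h5 (hsil _ _ hm)).mono (by gcongr; simp) fun _ h => h
    · refine .inr ⟨.silent :: t₁, by simpa using ht, fun σ hs h5 hm =>
        wp_ite (fun h0 => absurd hx (by simpa [hs.reg] using h0)) fun h0 => ?_⟩
      rw [List.append_cons]
      exact (h σ hs h5 (hsil _ _ hm)).mono (by gcongr; simp) fun _ h => h
  | loop_zero hx =>
    exact fun u _ => .inl fun σ hs h5 hm =>
      wp_while_zero (by simp [h5, hs.reg, hx]) ⟨hs, h5, hsil _ _ hm⟩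
  | @loop_nonzero x p s s₁ s₂ t t' hx _ _ ih₁ ih₂ =>
    intro u hu
    rw [List.append_cons, ← List.append_assoc] at hu
    rcases ih₁ _ ((List.prefix_append _ _).trans hu) with h | ⟨t₁, ht, h⟩
    · rcases ih₂ _ hu with h' | ⟨t₁, ht, h'⟩
      · refine .inl fun σ hs h5 hm => (wp_while_succ (T₂ := K * t'.length) (by simp [h5, hs.reg, hx])
          ((h σ hs h5 (hsil _ _ hm)).mono le_rfl
          fun σ' hq => h' σ' hq.1 hq.2.1 hq.2.2)).mono ?_ ?_
        · simp; nlinarith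
        · intro σ' hq
          rw [List.append_cons, ← List.append_assoc]
          exact hq
      · refine .inr ⟨.silent :: (t ++ t₁), ?_, fun σ hs h5 hm =>
          (wp_while_succ (T₂ := K * t₁.length) (by simp [h5, hs.reg, hx])
          ((h σ hs h5 (hsil _ _ hm)).mono le_rfl
          fun σ' hq => h' σ' hq.1 hq.2.1 hq.2.2)).mono ?_ ?_⟩
        · simpa [List.prefix_append_right_inj] using ht
        · simp; nlinarith
        · intro σ' hq
          rw [List.append_cons, ← List.append_assoc]
          exact hq
    -- After an abort in the body the guarded loop condition evaluates to `0`, so the loop is left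
    -- at once.
    · refine .inr ⟨.silent :: t₁, by simpa using ht.trans (List.prefix_append _ _),
        fun σ hs h5 hm => (wp_while_succ (T₂ := 0) (by simp [h5, hs.reg, hx])
          ((h σ hs h5 (hsil _ _ hm)).mono le_rfl
          fun σ' hq => wp_while_zero (by simp [hq.1]) hq)).mono ?_ ?_⟩
      · simp; nlinarith
      · intro σ' hq
        rw [List.append_cons]
        exact hq

/-- The registers that a program may change. -/
def Cmd.dest : Cmd → List ℕ
  | .const x _ => [x]
  | .add x _ _ => [x]
  | .sub x _ _ => [x]
  | .load x _ _ => [x]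
  | .seq p q => p.dest ++ q.dest
  | .branch _ p q => p.dest ++ q.dest
  | .loop _ p => p.dest
  | _ => []

/-- Only the finitely many registers in `c.dest` can be left dirty by a run, so resetting these
prepares the next one. -/
theorem Run.reg_eq {c : Cmd} {s s' : State} {t : List Action} (h : Run c s t s') (x : ℕ)
    (hx : x ∉ c.dest) : s'.reg x = s.reg x := by
  induction h with
  | loop_nonzero _ _ _ h₁ h₂ => rw [h₂ hx, h₁ hx]
  | _ => simp_all [Cmd.dest]

/-- Reset the variables `x + 100` for the registers `x` in a list. -/
def clearC (l : List ℕ) : Cmd := l.foldr (fun x p => setC (x + 100) (.lit 0) ;; p) .skip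

theorem wa_clearC (l : List ℕ) : (clearC l).wa = [] := by
  induction l with
  | nil => rfl
  | cons x l ih => simpa [clearC] using ih

theorem wr_clearC (l : List ℕ) (x : ℕ) : x ∈ (clearC l).wr → 100 ≤ x := by
  induction l with
  | nil => simp [clearC]
  | cons x l ih =>
    simp only [clearC, List.foldr_cons, wr_seq, wr_setC] at ih ⊢
    simp
    grind

theorem clearC_spec (l : List ℕ) (s : State) : Wp (clearC l) 0 s fun s' =>
    (∀ x, s'.reg (x + 100) = if x ∈ l then 0 else s.reg (x + 100)) := by
  induction l generalizing s with
  | nil => exact wp_skip (by simp)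
  | cons x l ih =>
    refine wp_set_seq ((ih _).mono le_rfl fun s' h y => ?_)
    rw [h]
    by_cases h1 : y ∈ l <;> by_cases h2 : y = x <;> simp [h1, h2]

theorem encode_arr_lt {n : ℕ} (l : List (Finset (Fin n))) (k : ℕ) {j v : ℕ} (hj : j < l.length)
    (hv : v < n) :
    (encode l k).arr 0 (j * n + v) = if (⟨v, hv⟩ : Fin n) ∈ l[j] then 1 else 0 := by
  have h1 : (j * n + v) / n = j := by
    rw [mul_comm, Nat.mul_add_div (by omega), Nat.div_eq_of_lt hv, add_zero]
  have h2 : (j * n + v) % n = v := by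
    rw [mul_comm, Nat.mul_add_mod, Nat.mod_eq_of_lt hv]
  simp only [encode, h1, h2, true_and, List.getElem?_eq_getElem hj]
  refine if_congr ?_ rfl rfl
  simp only [Option.mem_def, Option.some.injEq, exists_eq_left']
  constructor
  · rintro ⟨w, hw, h⟩
    rwa [show (⟨v, hv⟩ : Fin n) = w from Fin.ext h.symm]
  · exact fun h => ⟨_, h, rfl⟩

theorem encode_arr_ge {n : ℕ} (l : List (Finset (Fin n))) (k : ℕ) {i : ℕ}
    (hi : l.length * n ≤ i) : (encode l k).arr 0 i = 0 := by
  simp only [encode, true_and]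
  rw [if_neg]
  rintro ⟨E, hE, v, hv, -⟩
  have hn : 0 < n := v.pos
  have : l.length ≤ i / n := (Nat.le_div_iff_mul_le hn).2 hi
  rw [List.getElem?_eq_none this] at hE
  simp at hE

theorem encode_arr_ne {n : ℕ} (l : List (Finset (Fin n))) (k : ℕ) {a : ℕ} (ha : a ≠ 0) (i : ℕ) :
    (encode l k).arr a i = 0 := by
  simp [encode, ha]

/-- The memory is ready for a new run of the embedded program `A`. -/
structure Fresh (A : Cmd) (σ : State) : Prop where
  reg : ∀ x, x ∉ A.dest → 3 ≤ x → σ.reg (x + 100) = 0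
  top : ∀ a i, σ.reg 4 ≤ i → σ.arr (a + 20) i = 0
  flag : σ.reg 5 = 0

theorem Fresh.frame {A : Cmd} {R B : List ℕ} {σ σ' : State} (h : Fresh A σ) (hf : Frame R B σ σ')
    (hR : ∀ x ∈ R, x < 100 ∧ x ≠ 4 ∧ x ≠ 5) (hB : ∀ a ∈ B, a < 20) : Fresh A σ' := by
  have hr (x : ℕ) (hx : x ≥ 100 ∨ x = 4 ∨ x = 5) : σ'.reg x = σ.reg x :=
    hf.reg x fun h => by have := hR x h; omega
  have ha (a : ℕ) : σ'.arr (a + 20) = σ.arr (a + 20) :=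
    hf.arr _ fun h => by have := hB _ h; omega
  refine ⟨fun x hx h3 => ?_, fun a i hi => ?_, ?_⟩
  · rw [hr _ (by omega), h.reg x hx h3]
  · rw [hr _ (by omega)] at hi; rw [ha, h.top a i hi]
  · rw [hr _ (by omega), h.flag]

theorem Fresh.setReg {A : Cmd} {σ : State} (h : Fresh A σ) (x v : ℕ) (hx : x < 100) (h4 : x ≠ 4)
    (h5 : x ≠ 5) : Fresh A (σ.setReg x v) := by
  refine h.frame (R := [x]) (B := []) ⟨fun y hy => ?_, fun _ _ => rfl⟩ (by simp [*]) (by simp)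
  simp at hy
  simp [hy]

theorem Fresh.setArr {A : Cmd} {σ : State} (h : Fresh A σ) (a i v : ℕ) (ha : a < 20) :
    Fresh A (σ.setArr a i v) := by
  refine h.frame (R := []) (B := [a]) ⟨fun _ _ => rfl, fun y hy => ?_⟩ (by simp) (by simp [*])
  simp at hy
  simp [hy]

/-- Prepare a run of the embedded program `A` on the list of sets in array `a` and the parameter
`e`. -/
def feedC (A : Cmd) (a c : ℕ) (e : Exp) : Cmd :=
  setC 35 e ;; setC 3 (.var 4) ;; clearC A.dest ;;
  setC 100 (.var 0) ;; setC 101 (.var c) ;; setC 102 (.var 35) ;; setC 31 (.lit 0) ;;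
  forC 32 (.var c) (setC 31 (.add (.var 31) (.var 0))) ;;
  setC 4 (.add (.var 3) (.var 31)) ;;
  forC 32 (.var c)
    (setC 33 (.get a (.var 32)) ;;
     forC 34 (.var 0)
      (setC 31 (.sub (.var 31) (.lit 1)) ;;
       subC (.get 1 (.var 34)) (.var 33) ;;
       stoC 20 (.add (.var 3) (.var 31)) (.var 25)))

/-- The variables below `100` that `feedC` uses. -/
abbrev feedRegs : List ℕ := [3, 4, 20, 21, 22, 23, 24, 25, 31, 32, 33, 34, 35]

theorem wr_feedC (A : Cmd) (a c : ℕ) (e : Exp) (x : ℕ) (hx : x < 100) :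
    x ∈ (feedC A a c e).wr → x ∈ feedRegs := by
  have h : x ∉ (clearC A.dest).wr := fun h => by have := wr_clearC _ _ h; omega
  simp only [feedC, wr_seq, wr_setC, wr_forC, List.mem_append, List.mem_cons, List.not_mem_nil,
    mem_wr_subC, wr_stoC, feedRegs, h, false_or]
  grind

theorem wa_feedC (A : Cmd) (a c : ℕ) (e : Exp) : (feedC A a c e).wa = [20] := by
  simp [feedC, wa_clearC]

/-- A bound for the number of loop iterations of `feedC`. -/
def feedT (n m : ℕ) : ℕ := m + m * (n * (n + 1) + 1)

/-- The arrays left over from earlier runs are not erased. Instead the origin of the new arrays is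
moved to the old bound in register `4`, beyond which everything is `0`; only registers are cleared,
and the incidence matrix is written from its last entry backwards. -/
theorem feedC_spec {n : ℕ} {s : State} (A : Cmd) {a c : ℕ} {e : Exp}
    {l : List (Finset (Fin n))} (hE : Env n s) (hl : HasList s a c l) (hF : Fresh A s)
    (hc : c < 20) (hc3 : c ≠ 3) (hc4 : c ≠ 4) (ha : a < 20) :
    Wp (feedC A a c e) (feedT n l.length) s fun s' =>
      Sim s' (encode l (e.ev s)) ∧ s'.reg 5 = 0 := by
  refine wp_set_seq (wp_set_seq ?_)
  generalize hk : e.ev s = k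
  refine (clearC_spec A.dest _).call_seq (feedT n l.length) (by simp) fun s₁ hf₁ h₁ => ?_
  have hr₁ (x : ℕ) (hx : x < 100) (h3 : x ≠ 3) (h35 : x ≠ 35) : s₁.reg x = s.reg x := by
    rw [hf₁.reg x fun h => by have := wr_clearC _ _ h; omega]
    simp [h3, h35]
  have ha₁ : s₁.arr = s.arr := by
    ext1 b
    rw [hf₁.arr b (by simp [wa_clearC])]
    rfl
  have h3₁ : s₁.reg 3 = s.reg 4 := by
    rw [hf₁.reg 3 fun h => by have := wr_clearC _ _ h; omega]
    simp
  have h35₁ : s₁.reg 35 = k := by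
    rw [hf₁.reg 35 fun h => by have := wr_clearC _ _ h; omega]
    simp
  have hA₁ (x : ℕ) (h3 : 3 ≤ x) : s₁.reg (x + 100) = 0 := by
    rw [h₁ x]
    split_ifs with h
    · rfl
    · simp [hF.reg x h h3]
  clear h₁ hf₁
  refine wp_set_seq (wp_set_seq (wp_set_seq (wp_set_seq ?_)))
  have hr3 : ∀ x, x ∈ [0, 3, 4, 5, 7, c] → x ≠ 100 ∧ x ≠ 101 ∧ x ≠ 102 ∧ x ≠ 31 ∧ x ≠ 32 ∧ x < 100 := by
    simp; omega
  have hc₁ : s₁.reg c = l.length := by rw [hr₁ c (by omega) hc3 (by omega), hl.len]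
  refine wp_for_seq (T := 0) (T₂ := l.length * (n * (n + 1) + 1)) (by simp) l.length ?_
    (fun j s' => s'.reg 31 + j * n = l.length * n) ?_ (by simp [feedT]) ?_ ?_
  · have := hr3 c (by simp)
    simp [*]
  · simp
  · intro j hj s' hf hI
    refine wp_set ?_
    have : s'.reg 0 = n := by rw [hf.reg 0 (by simp)]; simp [hr₁, hE.size]
    simp [this]
    rw [← hI]
    ring
  intro s₂ hf₂ h31
  have hr₂ (x : ℕ) (hx : x < 100) (h31 : x ≠ 31) (h32 : x ≠ 32) : s₂.reg x = s₁.reg x := by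
    rw [hf₂.reg x (by simp [h31, h32])]
    simp [show x ≠ 100 by omega, show x ≠ 101 by omega, show x ≠ 102 by omega, h31]
  have ha₂ : s₂.arr = s.arr := by
    ext1 b
    rw [hf₂.arr b (by simp)]
    simp [ha₁]
  have hA₂ (x : ℕ) : s₂.reg (x + 100) = (encode l k).reg x := by
    rw [hf₂.reg _ (by simp)]
    simp only [encode, State.setReg_reg, Exp.ev, Nat.add_eq_right, Nat.reduceEqDiff,
      if_false]
    have := hr3 c (by simp)
    rcases x with _ | _ | _ | x
    · simp [hr₁, hE.size]
    · simp [*]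
    · simp [h35₁]
    · simpa using hA₁ (x + 3) (by omega)
  refine wp_set_seq ?_
  have h3₂ : s₂.reg 3 = s.reg 4 := by rw [hr₂ 3 (by simp) (by simp) (by simp), h3₁]
  simp only [Exp.ev, h3₂, show s₂.reg 31 = l.length * n by omega]
  -- Beyond the matrix both sides are `0`; this is the invariant before any row has been written.
  have hbig : ∀ i, l.length * n ≤ i → s.arr 20 (s.reg 4 + i) = (encode l k).arr 0 i := fun i hi => by
    rw [encode_arr_ge l k hi]
    exact hF.top 0 _ (by omega)
  have hE₂ : Env n (s₂.setReg 4 (s.reg 4 + l.length * n)) := by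
    refine ⟨?_, ?_, ?_⟩
    · simp [hr₂, hr₁, hE.size]
    · simp [hr₂, hr₁, hE.full]
    · simpa [ha₂] using hE.pow
  refine wp_for (T := n * (n + 1)) (by simp) l.length ?_
    (fun j s' => s'.reg 31 = j * n ∧ 
      ∀ i, j * n ≤ i → s'.arr 20 (s.reg 4 + i) = (encode l k).arr 0 i) ?_ ?_ ?_
  · have := hr3 c (by simp)
    simp [hc4, hr₂ c (by omega), hc₁, this]
  · simpa [show s₂.reg 31 = l.length * n by omega, ha₂] using hbig
  · rintro j hj s₃ hf₃ ⟨hI₁, hI₂⟩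
    refine wp_set_seq ?_
    have h33 : s₃.arr a j = code l[j] := by
      rw [hf₃.arr a (by simp; omega)]; simpa [ha₂] using hl.get j hj
    have h3₃ : s₃.reg 3 = s.reg 4 := by
      rw [hf₃.reg 3 (by simp)]; simp [h3₂]
    have hE₃ : Env n s₃ := hE₂.frame hf₃ (by simp) (by simp) (by simp)
    simp only [Exp.ev, State.setReg_reg, State.setReg_arr, if_true, h33]
    refine wp_for (T := n) (by simp) n ?_ (fun v s' => s'.reg 31 = j * n + v ∧ 
      ∀ i, j * n + v ≤ i → s'.arr 20 (s.reg 4 + i) = (encode l k).arr 0 i) ?_ ?_ ?_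
    · simp [hE₃.size]
    · simp [hI₁, Nat.add_mul] 
      simpa [Nat.add_mul] using hI₂
    · rintro v hv s₄ hf₄ ⟨hJ₁, hJ₂⟩
      have h33₄ : s₄.reg 33 = code l[j] := by rw [hf₄.reg 33 (by simp)]; simp
      have h3₄ : s₄.reg 3 = s.reg 4 := by rw [hf₄.reg 3 (by simp)]; simp [h3₃]
      have hE₄ : Env n s₄ := Env.frame ((hE₃.setReg 32 _ (by simp) (by simp)).setReg 33 _ (by simp)
        (by simp)) hf₄ (by simp) (by simp) (by simp)
      refine wp_set_seq ?_
      refine (subC_spec ((hE₄.setReg _ _ (by simp) (by simp)).setReg _ _ (by simp) (by simp))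
        {⟨v, hv⟩} l[j] (by simp [hE₄.pow v hv]) (by simp [h33₄])).call_seq 0 (by simp)
        fun s₅ hf₅ h25 => wp_sto ?_
      have h31₅ : s₅.reg 31 = j * n + v := by
        rw [hf₅.reg 31 (by simp)]; simp [hJ₁]
      have h3₅ : s₅.reg 3 = s.reg 4 := by rw [hf₅.reg 3 (by simp)]; simp [h3₄]
      have ha₅ : s₅.arr 20 = s₄.arr 20 := by rw [hf₅.arr 20 (by simp)]; simp
      refine ⟨by simpa using h31₅, fun i hi => ?_⟩
      simp only [Exp.ev, State.setArr_arr, if_true, h3₅, h31₅, Function.update_apply,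
        Nat.add_left_cancel_iff, h25, ha₅]
      split_ifs with h0 h1
      · rw [h0, encode_arr_lt l k hj hv, if_pos (by simpa using h1)]
      · rw [h0, encode_arr_lt l k hj hv, if_neg (by simpa using h1)]
      · exact hJ₂ i (by omega)
    · exact fun s' _ h => by simpa using h
  · rintro s' hf ⟨-, h⟩
    have h3 : s'.reg 3 = s.reg 4 := by rw [hf.reg 3 (by simp)]; simp [h3₂]
    have h4 : s'.reg 4 = s.reg 4 + l.length * n := by rw [hf.reg 4 (by simp)]; simp
    have har (b : ℕ) (hb : b ≠ 0) : s'.arr (b + 20) = s.arr (b + 20) := by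
      rw [hf.arr _ (by simp [hb])]; simp [ha₂]
    refine ⟨⟨fun x => ?_, fun b i => ?_, fun b i hi => ?_⟩, ?_⟩
    · rw [hf.reg _ (by simp), ← hA₂]; simp
    · rw [h3]
      rcases eq_or_ne b 0 with rfl | hb
      · exact h i (by omega)
      · rw [har b hb, hF.top b _ (by omega), encode_arr_ne l k hb]
    · rw [h4] at hi
      rcases eq_or_ne b 0 with rfl | hb
      · have := h (i - s.reg 4) (by omega)
        rw [Nat.add_sub_of_le (by omega)] at this
        rw [this, encode_arr_ge l k (by omega)]
      · rw [har b hb, hF.top b _ (by omega)]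
    · rw [hf.reg _ (by simp)]
      simp [hr₂, hr₁, hF.flag]

/-- Run the program `A`, without its outputs, on the list of sets in array `a` and the parameter
`e`. The result is in register `100`. -/
def callC (A : Cmd) (a c : ℕ) (e : Exp) : Cmd := feedC A a c e ;; embC .skip .skip A

theorem wr_embC (W E A : Cmd) (x : ℕ) (h : x ∈ (embC W E A).wr) :
    100 ≤ x ∨ x = 4 ∨ x = 6 ∨ x ∈ W.wr ∨ x ∈ E.wr := by
  induction A <;> simp [embC] at h <;> first | omega | grind

theorem wa_embC (W E A : Cmd) (a : ℕ) (h : a ∈ (embC W E A).wa) :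
    20 ≤ a ∨ a ∈ W.wa ∨ a ∈ E.wa := by
  induction A <;> simp [embC] at h <;> first | omega | grind

theorem callC_spec {n : ℕ} {s : State} {A : Cmd} {a c : ℕ} {e : Exp}
    {l : List (Finset (Fin n))} (hE : Env n s) (hl : HasList s a c l) (hF : Fresh A s)
    (hc : c < 20) (hc3 : c ≠ 3) (hc4 : c ≠ 4) (ha : a < 20) {t : List Action} {r : State}
    (hA : Run A (encode l (e.ev s)) t r) :
    Wp (callC A a c e) (feedT n l.length + t.length) s fun s' => s'.reg 100 = r.reg 0 ∧
      Fresh A s' ∧ (∀ x < 100, x ∉ 6 :: feedRegs → s'.reg x = s.reg x) ∧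
      ∀ a < 20, s'.arr a = s.arr a := by
  refine (feedC_spec A hE hl hF hc hc3 hc4 ha).call_seq t.length le_rfl fun s₁ hf₁ h₁ => ?_
  have hsim := embC_sim (W := .skip) (E := .skip) (K := 1) (full := t)
    (M := fun _ _ => True) (B := fun _ _ => True)
    (by simp) (by simp) (by simp) (by simp) (by simp) (by simp) le_rfl (by simp)
    (fun _ _ _ _ _ _ => wp_skip trivial)
    (fun _ _ => .inl fun σ _ h => wp_skip ⟨h, trivial⟩) hA [] (by simp)
  have key : Wp (embC .skip .skip A) (1 * t.length) s₁ (fun s' => Sim s' r ∧ s'.reg 5 = 0) := by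
    rcases hsim with h | ⟨t', ht, h⟩
    · exact (h s₁ h₁.1 h₁.2 trivial).mono le_rfl fun _ h => ⟨h.1, h.2.1⟩
    -- No handler touches register `5`, so an abort is impossible; the contradiction is read off
    -- from one concrete memory with view `s₁`.
    · exfalso
      obtain ⟨_, _, σ', hr, -, -, h5, -⟩ := h s₁ h₁.1 h₁.2 trivial
        ⟨fun x => if x % 2 = 0 then s₁.reg (x / 2) else 0, s₁.arr⟩ (by ext <;> simp [abs])
      refine h5 ?_
      rw [hr.frame.reg 5 fun h => by simpa using wr_embC _ _ _ _ h]
      simpa [abs] using h₁.2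
  refine key.call (by simp) fun s₂ hf₂ h₂ => ⟨?_, ⟨fun x hx h3 => ?_, h₂.1.top, h₂.2⟩, ?_, ?_⟩
  · rw [← h₂.1.reg 0]
  · rw [h₂.1.reg, hA.reg_eq x hx]
    simp [encode, show x ≠ 0 by omega, show x ≠ 1 by omega, show x ≠ 2 by omega]
  · intro x hx hx'
    simp only [List.mem_cons, not_or, List.not_mem_nil] at hx'
    rw [hf₂.reg x fun h => by have := wr_embC _ _ _ _ h; simp at this; omega, hf₁.reg x]
    intro h
    have := wr_feedC _ _ _ _ _ hx h
    simp at this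
    omega
  · intro b hb
    rw [hf₂.arr b fun h => by have := wa_embC _ _ _ _ h; simp at this; omega, hf₁.arr b]
    simp [wa_feedC]
    omega

theorem wr_callC (A : Cmd) (a c : ℕ) (e : Exp) (x : ℕ) (h : x ∈ (callC A a c e).wr) :
    100 ≤ x ∨ x ∈ 6 :: feedRegs := by
  simp only [callC, wr_seq, List.mem_append] at h
  rcases h with h | h
  · by_cases hx : x < 100
    · exact .inr (List.mem_cons_of_mem _ (wr_feedC _ _ _ _ _ hx h))
    · exact .inl (by omega)
  · have := wr_embC _ _ _ _ h
    simp at this ⊢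
    omega

/-! ### Calculus of time bounds -/

/-- `f ≤ poly(x) * N ^ (e + O(1))` -/
def PBound {ι : Type*} (x N e f : ι → ℕ) : Prop :=
  ∃ (p : Polynomial ℕ) (c : ℕ), ∀ i, f i ≤ p.eval (x i) * N i ^ (e i + c)

theorem eval_mono (p : Polynomial ℕ) {a b : ℕ} (h : a ≤ b) : p.eval a ≤ p.eval b := by
  rw [Polynomial.eval_eq_sum_range, Polynomial.eval_eq_sum_range]
  gcongr

section PBound

variable {ι : Type*} {x N e f g : ι → ℕ}

theorem PBound.of_le (h : PBound x N e g) (hfg : ∀ i, f i ≤ g i) : PBound x N e f := by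
  obtain ⟨p, c, hp⟩ := h
  exact ⟨p, c, fun i => (hfg i).trans (hp i)⟩

theorem PBound.weaken {e' : ι → ℕ} (h : PBound x N e f) (hN : ∀ i, 2 ≤ N i)
    (he : ∃ d, ∀ i, e i ≤ e' i + d) : PBound x N e' f := by
  obtain ⟨p, c, hp⟩ := h
  obtain ⟨d, he⟩ := he
  refine ⟨p, d + c, fun i => (hp i).trans ?_⟩
  have h2 := hN i
  refine Nat.mul_le_mul_left _ (Nat.pow_le_pow_right (by omega) ?_)
  have := he i
  omega

theorem PBound.const (c : ℕ) : PBound x N 0 (fun _ => c) :=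
  ⟨.C c, 0, fun i => by simp⟩

theorem PBound.var : PBound x N 0 x := ⟨.X, 0, fun i => by simp⟩

theorem PBound.base : PBound x N 0 N := ⟨1, 1, fun i => by simp⟩

theorem PBound.pow : PBound x N e (fun i => N i ^ e i) := ⟨1, 0, fun i => by simp⟩

theorem PBound.add (hN : ∀ i, 2 ≤ N i) (hf : PBound x N e f) (hg : PBound x N e g) :
    PBound x N e (fun i => f i + g i) := by
  obtain ⟨p, c, hp⟩ := hf
  obtain ⟨q, d, hq⟩ := hg
  refine ⟨p + q, c + d, fun i => ?_⟩
  rw [Polynomial.eval_add, add_mul]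
  have := hN i
  refine add_le_add ((hp i).trans ?_) ((hq i).trans ?_)
  · gcongr
    · omega
    · omega
  · gcongr
    · omega
    · omega

theorem PBound.mul {e' : ι → ℕ} (hf : PBound x N e f) (hg : PBound x N e' g) :
    PBound x N (e + e') (fun i => f i * g i) := by
  obtain ⟨p, c, hp⟩ := hf
  obtain ⟨q, d, hq⟩ := hg
  refine ⟨p * q, c + d, fun i => (Nat.mul_le_mul (hp i) (hq i)).trans (le_of_eq ?_)⟩
  rw [Polynomial.eval_mul, Pi.add_apply]
  ring

/-- Exponents add up in a product, so only one factor may grow like `N ^ e`; the other has to be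
polynomial in `x` and `N`. -/
theorem PBound.zmul (hf : PBound x N 0 f) (hg : PBound x N e g) :
    PBound x N e (fun i => f i * g i) := by
  simpa using hf.mul hg

theorem PBound.mulz (hf : PBound x N e f) (hg : PBound x N 0 g) :
    PBound x N e (fun i => f i * g i) := by
  simpa using hf.mul hg

theorem PBound.up (hN : ∀ i, 2 ≤ N i) (hf : PBound x N 0 f) : PBound x N e f :=
  hf.weaken hN ⟨0, fun i => by simp⟩

end PBound

/-! ### Reading the input -/

/-- Copy the input to the variables. -/
def startC : Cmd := .add 4 2 5 ;; .add 2 1 5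

/-- Variables occupy the even registers, so the inputs in registers `1` and `2` move to `2` and `4`,
the latter first to save its value. Register `5` is still `0` and turns addition into copying. -/
theorem startC_run {n : ℕ} (l : List (Finset (Fin n))) (k : ℕ) :
    ∃ σ, RunIter startC (encode l k) [.silent, .silent] 0 σ ∧ abs σ = encode l k := by
  refine ⟨_, .seq (.add _ _ _ _) (.add _ _ _ _), ?_⟩
  ext x
  · rcases x with _ | _ | _ | x
    · simp [abs, encode]
    · simp [abs, encode]
    · simp [abs, encode]
    · simp [abs, encode, show 2 * (x + 1 + 1 + 1) ≠ 4 by omega]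
  · rfl

theorem decidableInTime_of_wp {P : (n : ℕ) → FinHypergraph n → ℕ → Prop} (c : Cmd)
    (T : ℕ × ℕ × ℕ → ℕ)
    (hT : PBound (fun i : ℕ × ℕ × ℕ => i.2.1) (fun i => max i.1 2) (fun i => i.2.2)
      T)
    (h : ∀ (n : ℕ) (l : List (Finset (Fin n))) (k : ℕ), l.Nodup →
      Wp c (T (n, l.length, k)) (encode l k) fun s => s.reg 0 ≠ 0 ↔ P n l.toFinset k) :
    DecidableInTime P := by
  have hN : ∀ i : ℕ × ℕ × ℕ, 2 ≤ max i.1 2 := fun i => le_max_right _ _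
  obtain ⟨p, d, hp⟩ := (PBound.const (c.size + 2)).zmul (hT.add hN ((PBound.const 1).up hN))
  refine ⟨startC ;; c, p, d, fun n l k hl => ?_⟩
  obtain ⟨σ, hσ, ha⟩ := startC_run l k
  obtain ⟨t, L, σ', hr, -, hL, hq⟩ := h n l k hl σ ha
  have h1 := hσ.seq hr
  refine ⟨_, _, h1.run, hq, (h1.length_le).trans (le_trans ?_ (hp (n, l.length, k)))⟩
  have : (startC ;; c).size = c.size + 2 := by simp [startC, Cmd.size]; omega
  rw [this]
  exact Nat.mul_le_mul_left _ (by omega)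

theorem code_high_succ {n : ℕ} {j : ℕ} (hj : j < n) (S : Finset (Fin n)) :
    code (S.filter fun v : Fin n => j ≤ (v : ℕ)) = code (S.filter fun v : Fin n => j + 1 ≤ (v : ℕ)) +
      if (⟨j, hj⟩ : Fin n) ∈ S then 2 ^ j else 0 := by
  split_ifs with h
  · rw [show S.filter (fun v : Fin n => j ≤ (v : ℕ)) =
      insert ⟨j, hj⟩ (S.filter fun v : Fin n => j + 1 ≤ (v : ℕ)) from ?_, code_insert (by simp)]
    ext v
    simp only [Finset.mem_filter, Finset.mem_insert, Fin.ext_iff]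
    constructor
    · intro h; have := h.2; grind
    · rintro (h' | h')
      · rw [show v = ⟨j, hj⟩ from Fin.ext h']; exact ⟨h, by simp⟩
      · exact ⟨h'.1, by omega⟩
  · rw [add_zero]
    congr 1
    ext v
    simp only [Finset.mem_filter]
    constructor
    · intro h'
      refine ⟨h'.1, ?_⟩
      have : (v : ℕ) ≠ j := by
        rintro rfl
        exact h h'.1
      omega
    · exact fun h' => ⟨h'.1, by omega⟩

theorem high_self {n : ℕ} (S : Finset (Fin n)) : (S.filter fun v : Fin n => n ≤ (v : ℕ)) = ∅ := by
  ext v; simp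

theorem high_zero {n : ℕ} (S : Finset (Fin n)) : (S.filter fun v : Fin n => 0 ≤ (v : ℕ)) = S := by
  ext v; simp

/-- Fill array `2` with the codes of the edges. -/
def readC : Cmd :=
  setC 31 (.lit 0) ;;
  forC 32 (.var 1) (setC 31 (.add (.var 31) (.var 0))) ;;
  forC 32 (.var 1)
    (setC 33 (.lit 0) ;;
     forC 34 (.var 0)
      (setC 31 (.sub (.var 31) (.lit 1)) ;;
       setC 33 (.add (.var 33) (.cond (.get 0 (.var 31)) (.get 1 (.var 34)) (.lit 0)))) ;;
     stoC 2 (.var 32) (.var 33))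

@[simp] theorem mem_wr_readC (x : ℕ) : x ∈ readC.wr ↔ x ∈ [31, 32, 33, 34] := by
  simp [readC]; tauto

@[simp] theorem wa_readC : readC.wa = [2] := by simp [readC]

theorem readC_spec {n : ℕ} {s : State} (hE : Env n s) {l : List (Finset (Fin n))} {k : ℕ}
    (h1 : s.reg 1 = l.length) (h0 : s.arr 0 = (encode l k).arr 0) :
    Wp readC (l.length + l.length * (n + 1)) s fun s' => HasList s' 2 1 l := by
  refine wp_set_seq ?_
  refine wp_for_seq (T := 0) (T₂ := l.length * (n + 1)) (by simp) l.length (by simp [h1])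
    (fun j s' => s'.reg 31 + j * n = l.length * n) (by simp) (by simp) ?_ ?_
  · intro j hj s' hf hI
    refine wp_set ?_
    have : s'.reg 0 = n := by rw [hf.reg 0 (by simp)]; simp [hE.size]
    simp [this]
    rw [← hI]
    ring
  intro s₁ hf₁ h31
  have hE₁ : Env n s₁ :=
    (hE.setReg _ _ (by simp) (by simp)).frame hf₁ (by simp) (by simp) (by simp)
  have h1₁ : s₁.reg 1 = l.length := by rw [hf₁.reg 1 (by simp)]; simp [h1]
  have h0₁ : s₁.arr 0 = (encode l k).arr 0 := by rw [hf₁.arr 0 (by simp)]; simp [h0]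
  refine wp_for (by simp) l.length (by simp [h1₁]) (fun j s' => s'.reg 31 = j * n ∧
    ∀ i (hi : i < l.length), j ≤ i → s'.arr 2 i = code l[i]) ?_ ?_ ?_
  · refine ⟨by simpa using h31, fun i hi hi' => by omega⟩
  · rintro j hj s₂ hf₂ ⟨hI₁, hI₂⟩
    have hE₂ : Env n s₂ := hE₁.frame hf₂ (by simp) (by simp) (by simp)
    have h0₂ : s₂.arr 0 = (encode l k).arr 0 := by rw [hf₂.arr 0 (by simp), h0₁]
    refine wp_set_seq ?_
    refine wp_for_seq (T := 0) (T₂ := 0) (by simp) n (by simp [hE₂.size]) (fun v s' =>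
      s'.reg 31 = j * n + v ∧ s'.reg 33 = code (l[j].filter fun u : Fin n => v ≤ (u : ℕ))) ?_ (by simp) ?_ ?_
    · rw [high_self]
      simp [hI₁, Nat.add_mul]
    · rintro v hv s₃ hf₃ ⟨hJ₁, hJ₂⟩
      refine wp_set_seq (wp_set ?_)
      have h0₃ : s₃.arr 0 (j * n + v) = if (⟨v, hv⟩ : Fin n) ∈ l[j] then 1 else 0 := by
        rw [hf₃.arr 0 (by simp), ← encode_arr_lt l k hj hv]
        simp [h0₂]
      have h1₃ : s₃.arr 1 v = 2 ^ v := by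
        rw [hf₃.arr 1 (by simp)]
        simpa using hE₂.pow v hv
      simp only [Exp.ev, State.setReg_reg, State.setReg_arr, Nat.reduceEqDiff, if_true, if_false,
        hJ₁, hJ₂]
      simp only [← add_assoc, Nat.add_sub_cancel, true_and]
      rw [h0₃, h1₃, code_high_succ hv]
      split_ifs <;> simp_all
    · rintro s₃ hf₃ ⟨hJ₁, hJ₂⟩
      refine wp_sto ⟨by simpa using hJ₁, fun i hi hji => ?_⟩
      have h2 : s₃.arr 2 = s₂.arr 2 := by rw [hf₃.arr 2 (by simp)]; simp
      have h32 : s₃.reg 32 = j := by rw [hf₃.reg 32 (by simp)]; simp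
      simp only [Exp.ev, State.setArr_arr, if_true, h32, Function.update_apply, h2]
      split_ifs with h
      · subst h
        rw [hJ₂, high_zero]
      · exact hI₂ i hi (by omega)
  · rintro s₂ hf₂ ⟨-, h⟩
    refine ⟨?_, fun j hj => h j hj (by omega)⟩
    rw [hf₂.reg 1 (by simp), h1₁]

/-! ### Transversal rank and conformality -/

/-- Run the program `A` on the hypergraph of the complements of the edges with parameter `e`, and
put the value of `ans` into register `0`. -/
def dualC (A : Cmd) (e ans : Exp) : Cmd :=
  powC ;; readC ;; forC 32 (.var 1) (stoC 8 (.var 32) (.sub (.var 7) (.get 2 (.var 32)))) ;;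
  callC A 8 1 e ;; setC 0 ans

theorem Fresh.encode {A : Cmd} {n : ℕ} (l : List (Finset (Fin n))) (k : ℕ) :
    Fresh A (encode l k) :=
  ⟨fun x _ _ => by simp [HG.encode], fun a i _ => by simp [HG.encode], by simp [HG.encode]⟩

/-- A bound for the number of loop iterations of `powC` followed by `readC`. -/
def inputT (n m : ℕ) : ℕ := n + (m + m * (n + 1))

theorem dualC_spec {A : Cmd} {n : ℕ} {l : List (Finset (Fin n))} {k k' b : ℕ} {e ans : Exp}
    {t : List Action} {r : State} (hA : Run A (encode (l.map (·ᶜ)) k') t r)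
    (he : ∀ s, s.reg 2 = k → e.ev s = k')
    (hans : ∀ s, s.reg 1 = l.length → s.reg 2 = k → s.reg 100 = r.reg 0 → ans.ev s = b) :
    Wp (dualC A e ans) (inputT n l.length + (l.length + (feedT n l.length + t.length)))
      (encode l k) fun s => s.reg 0 = b := by
  refine (powC_spec (n := n) (by simp [encode])).call_seq
    (l.length + l.length * (n + 1) + (l.length + (feedT n l.length + t.length)))
    (by simp [inputT]; omega) fun s₁ hf₁ hE₁ => ?_
  have h1₁ : s₁.reg 1 = l.length := by rw [hf₁.reg 1 (by simp)]; simp [encode]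
  have h0₁ : s₁.arr 0 = (encode l k).arr 0 := by rw [hf₁.arr 0 (by simp)]
  refine (readC_spec hE₁ h1₁ h0₁).call_seq _ le_rfl fun s₂ hf₂ hL₂ => ?_
  have hE₂ : Env n s₂ := hE₁.frame hf₂ (by simp) (by simp) (by simp)
  refine wp_for_seq (T := 0) (T₂ := feedT n l.length + t.length) (by simp) l.length
    (by simp [hL₂.len]) (fun j s' => ∀ i (hi : i < l.length), j ≤ i → s'.arr 8 i = code l[i]ᶜ)
    ?_ (by simp) ?_ ?_
  · intro i hi hi'; omega
  · intro j hj s₃ hf₃ hI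
    refine wp_sto fun i hi hji => ?_
    have h7 : s₃.reg 7 = 2 ^ n - 1 := by rw [hf₃.reg 7 (by simp)]; exact hE₂.full
    have h2 : s₃.arr 2 j = code l[j] := by rw [hf₃.arr 2 (by simp)]; exact hL₂.get j hj
    simp only [Exp.ev, State.setArr_arr, State.setReg_reg, State.setReg_arr, Nat.reduceEqDiff,
      if_true, if_false, h7, Function.update_apply, h2]
    split_ifs with h
    · subst h; rw [code_compl]
    · exact hI i hi (by omega)
  · intro s₃ hf₃ h8
    have h2₃ : s₃.reg 2 = k := by
      rw [hf₃.reg 2 (by simp), hf₂.reg 2 (by simp), hf₁.reg 2 (by simp)]; simp [encode]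
    have hL₃ : HasList s₃ 8 1 (l.map (·ᶜ)) := by
      refine ⟨by rw [hf₃.reg 1 (by simp), hL₂.len]; simp, fun j hj => ?_⟩
      simp at hj
      simp [h8 j hj]
    have hE₃ : Env n s₃ := hE₂.frame hf₃ (by simp) (by simp) (by simp)
    have hF₃ : Fresh A s₃ :=
      (((Fresh.encode l k).frame hf₁ (by simp) (by simp)).frame hf₂ (by simp) (by simp)).frame hf₃
        (by simp) (by simp)
    have := callC_spec (a := 8) (c := 1) (e := e) hE₃ hL₃ hF₃ (by simp) (by simp) (by simp)
      (by simp) (by rw [he s₃ h2₃]; exact hA)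
    rw [List.length_map] at this
    refine this.call_seq 0 (by simp) fun s₄ _ ⟨h100, _, hr, _⟩ => wp_set ?_
    rw [hans s₄ ?_ ?_ h100]
    · simp
    · rw [hr 1 (by simp) (by simp), hL₃.len]; simp
    · rw [hr 2 (by simp) (by simp), h2₃]

/-- The set `S` is contained in an edge. -/
def Covered {n : ℕ} (H : FinHypergraph n) (S : Finset (Fin n)) : Prop := ∃ E ∈ H, S ⊆ E

theorem Covered.mono {n : ℕ} {H : FinHypergraph n} {S S' : Finset (Fin n)} (h : Covered H S)
    (hS : S' ⊆ S) : Covered H S' := by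
  obtain ⟨E, hE, h⟩ := h
  exact ⟨E, hE, hS.trans h⟩

/-- The set `S` witnesses that the hypergraph is not `k`-conformal. -/
def Violates {n : ℕ} (H : FinHypergraph n) (k : ℕ) (S : Finset (Fin n)) : Prop :=
  ¬ Covered H S ∧ ∀ S' ⊆ S, S'.card ≤ k → Covered H S'

theorem isConformal_iff {n : ℕ} {H : FinHypergraph n} {k : ℕ} :
    IsConformal H k ↔ ¬ ∃ S, Violates H k S := by
  constructor
  · rintro h ⟨S, h1, h2⟩
    exact h1 ((h S).2 h2)
  · intro h S
    refine ⟨fun h S' hS' _ => Covered.mono h hS', fun h' => ?_⟩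
    by_contra hc
    exact h ⟨S, hc, h'⟩

theorem isHittingSet_compl {n : ℕ} {H : FinHypergraph n} {T : Finset (Fin n)} :
    IsHittingSet (H.image (·ᶜ)) T ↔ ¬ Covered H T := by
  simp only [IsHittingSet, Finset.mem_image, forall_exists_index, and_imp,
    forall_apply_eq_imp_iff₂, Covered, not_exists, not_and]
  refine forall₂_congr fun E _ => ?_
  rw [Finset.not_subset]
  simp only [Finset.Nonempty, Finset.mem_inter, Finset.mem_compl]
  exact ⟨fun ⟨x, h⟩ => ⟨x, h.2, h.1⟩, fun ⟨x, h⟩ => ⟨x, h.2, h.1⟩⟩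

/-- Hitting sets of the complements are the uncovered sets. A violating set contains a minimal
uncovered one, which cannot have at most `k` elements since those subsets are covered. Conversely, a
minimal uncovered set with more than `k` elements is violating, because its subsets with at most `k`
elements are proper. -/
theorem isConformal_iff_transversalRank {n : ℕ} {H : FinHypergraph n} {k : ℕ} :
    IsConformal H k ↔ ¬ TransversalRankGE (H.image (·ᶜ)) (k + 1) := by
  rw [isConformal_iff, not_iff_not]
  constructor
  · rintro ⟨S, h1, h2⟩
    obtain ⟨T, hTS, hT⟩ := exists_minimal_le_of_wellFoundedLT
      (IsHittingSet (H.image (·ᶜ))) S (isHittingSet_compl.2 h1)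
    refine ⟨T, hT, ?_⟩
    by_contra hc
    exact isHittingSet_compl.1 hT.prop (h2 T hTS (by omega))
  · rintro ⟨T, hT, hk⟩
    refine ⟨T, isHittingSet_compl.1 hT.prop, fun S hS hSk => ?_⟩
    by_contra hc
    have := hT.le_of_le (isHittingSet_compl.2 hc) hS
    have := Finset.card_le_card this
    omega

theorem image_compl_compl {n : ℕ} (H : FinHypergraph n) : (H.image (·ᶜ)).image (·ᶜ) = H := by
  ext; simp

theorem transversalRankGE_succ_iff {n : ℕ} {H : FinHypergraph n} {k : ℕ} :
    TransversalRankGE H (k + 1) ↔ ¬ IsConformal (H.image (·ᶜ)) k := by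
  rw [isConformal_iff_transversalRank, image_compl_compl, not_not]

/-- The correspondence with conformality shifts the parameter by one and misses the value `0`. That
case reduces to `1`, since a hitting set is nonempty as soon as there is an edge. -/
theorem transversalRankGE_zero_iff {n : ℕ} {H : FinHypergraph n} :
    TransversalRankGE H 0 ↔ H = ∅ ∨ TransversalRankGE H 1 := by
  constructor
  · rintro ⟨T, hT, -⟩
    rcases H.eq_empty_or_nonempty with h | ⟨E, hE⟩
    · exact .inl h
    · refine .inr ⟨T, hT, ?_⟩
      obtain ⟨v, hv⟩ := hT.prop E hE
      exact Finset.card_pos.2 ⟨v, (Finset.mem_inter.1 hv).2⟩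
  · rintro (rfl | ⟨T, hT, -⟩)
    · exact ⟨∅, ⟨by simp [IsHittingSet], fun _ _ _ => by simp⟩, by simp⟩
    · exact ⟨T, hT, by simp⟩

theorem nodup_map_compl {n : ℕ} {l : List (Finset (Fin n))} (h : l.Nodup) :
    (l.map (·ᶜ)).Nodup := h.map compl_injective

theorem toFinset_map_compl {n : ℕ} (l : List (Finset (Fin n))) :
    (l.map (·ᶜ)).toFinset = l.toFinset.image (·ᶜ) := by ext; simp

theorem PBound.dual (p : Polynomial ℕ) (c d : ℕ) :
    PBound (fun i : ℕ × ℕ × ℕ => i.2.1) (fun i => max i.1 2) (fun i => i.2.2)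
      (fun i => inputT i.1 i.2.1 + (i.2.1 + (feedT i.1 i.2.1 +
        p.eval i.2.1 * max i.1 2 ^ (i.2.2 + d + c)))) := by
  have hN : ∀ i : ℕ × ℕ × ℕ, 2 ≤ max i.1 2 := fun i => le_max_right _ _
  have n : PBound (fun i : ℕ × ℕ × ℕ => i.2.1) (fun i => max i.1 2) 0 (fun i => i.1) :=
    PBound.base.of_le fun i => le_max_left _ _
  have m : PBound (fun i : ℕ × ℕ × ℕ => i.2.1) (fun i => max i.1 2) 0 (fun i => i.2.1) :=
    PBound.var
  have one := PBound.const (x := fun i : ℕ × ℕ × ℕ => i.2.1) (N := fun i => max i.1 2) 1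
  refine PBound.add hN (.up hN ?_) (.add hN (.up hN m) (.add hN (.up hN ?_) ⟨p, d + c, ?_⟩))
  · exact n.add hN (m.add hN (m.zmul (n.add hN one)))
  · exact m.add hN (m.zmul ((n.zmul (n.add hN one)).add hN one))
  · intro i; simp [add_assoc]

theorem conformal_of_transversalRank
    (h : DecidableInTime (fun _ H k => TransversalRankGE H k)) :
    DecidableInTime (fun _ H k => IsConformal H k) := by
  obtain ⟨A, p, c, hA⟩ := h
  refine decidableInTime_of_wp
    (dualC A (.add (.var 2) (.lit 1)) (.cond (.var 100) (.lit 0) (.lit 1))) _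
    (PBound.dual p c 1) fun n l k hl => ?_
  obtain ⟨t, r, hr, hq, ht⟩ := hA n (l.map (·ᶜ)) (k + 1) (nodup_map_compl hl)
  rw [List.length_map] at ht
  refine (dualC_spec hr (b := if r.reg 0 = 0 then 1 else 0) (fun s hs => by simp [hs])
    fun s _ _ h => by simp [h]).mono (by simp only []; omega) fun s hs => ?_
  beta_reduce at hq
  rw [hs, isConformal_iff_transversalRank, ← toFinset_map_compl, ← hq]
  simp

theorem transversalRank_of_conformal (h : DecidableInTime (fun _ H k => IsConformal H k)) :
    DecidableInTime (fun _ H k => TransversalRankGE H k) := by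
  obtain ⟨A, p, c, hA⟩ := h
  refine decidableInTime_of_wp (dualC A (.sub (.var 2) (.lit 1))
    (.cond (.var 2) (.cond (.var 100) (.lit 0) (.lit 1))
      (.cond (.var 1) (.cond (.var 100) (.lit 0) (.lit 1)) (.lit 1)))) _
    (PBound.dual p c 0) fun n l k hl => ?_
  obtain ⟨t, r, hr, hq, ht⟩ := hA n (l.map (·ᶜ)) (k - 1) (nodup_map_compl hl)
  rw [List.length_map] at ht
  have ht' : t.length ≤ p.eval l.length * max n 2 ^ (k + 0 + c) := by
    refine ht.trans ?_
    have : 2 ≤ max n 2 := le_max_right _ _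
    gcongr <;> omega
  -- For `k = 0` the truncated `k - 1` is `0` as well, and `0`-conformality decides rank at least
  -- `1`; the edgeless hypergraph is the one exception to be added.
  refine (dualC_spec hr (b := if r.reg 0 = 0 ∨ (k = 0 ∧ l.length = 0) then 1 else 0)
    (fun s hs => by simp [hs])
    fun s h1 h2 h => ?_).mono (by simp only []; omega) fun s hs => ?_
  · simp only [Exp.ev, h1, h2, h]
    split_ifs <;> simp_all
  · beta_reduce at hq
    rw [hs]
    rw [toFinset_map_compl] at hq
    rcases k with _ | k
    · rw [transversalRankGE_zero_iff, transversalRankGE_succ_iff, ← hq]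
      simp
      tauto
    · rw [transversalRankGE_succ_iff, show IsConformal (l.toFinset.image (·ᶜ)) k ↔ _ from hq.symm]
      simp

/-! ### Listing all small sets -/

/-- List the codes of all sets with at most `k` vertices in array `3`, their sizes in array `4`, and
their number in register `8`. -/
def subsetsC : Cmd :=
  setC 8 (.lit 1) ;; stoC 3 (.lit 0) (.lit 0) ;; stoC 4 (.lit 0) (.lit 0) ;;
  forC 36 (.var 0)
    (forC 38 (.var 8)
      (iteC (.sub (.var 2) (.get 4 (.var 38)))
        (stoC 3 (.var 8) (.add (.get 3 (.var 38)) (.get 1 (.var 36))) ;;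
         stoC 4 (.var 8) (.add (.get 4 (.var 38)) (.lit 1)) ;;
         setC 8 (.add (.var 8) (.lit 1)))
        .skip))

@[simp] theorem mem_wr_subsetsC (x : ℕ) : x ∈ subsetsC.wr ↔ x ∈ [8, 36, 38] := by
  simp [subsetsC]; tauto

@[simp] theorem mem_wa_subsetsC (a : ℕ) : a ∈ subsetsC.wa ↔ a ∈ [3, 4] := by
  simp [subsetsC]; tauto

/-- The sets with at most `k` vertices. -/
def smallSets (n k : ℕ) : Finset (Finset (Fin n)) := Finset.univ.filter fun S => S.card ≤ k

/-- The geometric sum of the powers `N ^ j` with `j ≤ k` is at most `2 * N ^ k` because `N ≥ 2`;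
this is where `max n 2` replaces `n`. -/
theorem card_smallSets_le (n k : ℕ) : (smallSets n k).card ≤ 2 * max n 2 ^ k := by
  have h1 : smallSets n k ⊆
      (Finset.range (k + 1)).biUnion fun j => Finset.powersetCard j Finset.univ := by
    intro S hS
    simp only [smallSets, Finset.mem_filter, Finset.mem_univ, true_and] at hS
    simp [Finset.mem_powersetCard]
    omega
  have h2 : (smallSets n k).card ≤ ∑ j ∈ Finset.range (k + 1), max n 2 ^ j := by
    refine (Finset.card_le_card h1).trans (Finset.card_biUnion_le.trans ?_)
    refine Finset.sum_le_sum fun j _ => ?_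
    rw [Finset.card_powersetCard, Finset.card_univ, Fintype.card_fin]
    exact (Nat.choose_le_pow n j).trans (Nat.pow_le_pow_left (le_max_left _ _) j)
  refine h2.trans ?_
  generalize hN : max n 2 = N
  have h3 : 2 ≤ N := hN ▸ le_max_right _ _
  clear h1 h2
  induction k with
  | zero => simp
  | succ k ih =>
    rw [Finset.sum_range_succ, pow_succ]
    have := Nat.mul_le_mul_left (N ^ k) h3
    omega

/-- The list in array `3` together with the sizes in array `4`. -/
structure HasSets {n : ℕ} (s : State) (L : List (Finset (Fin n))) : Prop where
  list : HasList s 3 8 L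
  size : ∀ (j : ℕ) (h : j < L.length), s.arr 4 j = L[j].card

theorem length_le_of_card {n k : ℕ} {L : List (Finset (Fin n))} (hL : L.Nodup)
    (h : ∀ S ∈ L, S.card ≤ k) : L.length ≤ 2 * max n 2 ^ k := by
  rw [← List.toFinset_card_of_nodup hL]
  refine (Finset.card_le_card fun S hS => ?_).trans (card_smallSets_le n k)
  simpa [smallSets] using h S (List.mem_toFinset.1 hS)

/-- The sets in `L` have only vertices above `v`, so appending their unions with `{v}` creates no
repetition. The loop bound is fixed beforehand, hence appended sets are not processed again. Sets
that already have `k` elements are skipped, so the list never outgrows the number of small sets. -/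
theorem subsetsC_step {n k : ℕ} {s : State} (hE : Env n s) (hk : s.reg 2 = k) {v : ℕ} (hv : v < n)
    (h36 : s.reg 36 = v)
    {L : List (Finset (Fin n))} (hL : HasSets s L) (hLn : L.Nodup)
    (hmem : ∀ S, S ∈ L ↔ S.card ≤ k ∧ ∀ u ∈ S, v + 1 ≤ (u : ℕ)) :
    Wp (forC 38 (.var 8)
      (iteC (.sub (.var 2) (.get 4 (.var 38)))
        (stoC 3 (.var 8) (.add (.get 3 (.var 38)) (.get 1 (.var 36))) ;;
         stoC 4 (.var 8) (.add (.get 4 (.var 38)) (.lit 1)) ;;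
         setC 8 (.add (.var 8) (.lit 1)))
        .skip)) L.length s fun s' => ∃ L' : List (Finset (Fin n)), HasSets s' L' ∧ L'.Nodup ∧
        ∀ S, S ∈ L' ↔ S.card ≤ k ∧ ∀ u ∈ S, v ≤ (u : ℕ) := by
  have hnot : ∀ S ∈ L, (⟨v, hv⟩ : Fin n) ∉ S := by
    intro S hS hvS
    have := ((hmem S).1 hS).2 _ hvS
    simp at this
  refine (wp_for (T := 0) (by simp) L.length (by simp [hL.list.len]) (fun j s' =>
    ∃ X : List (Finset (Fin n)), HasSets s' (L ++ X) ∧ X.Nodup ∧ ∀ S, S ∈ X ↔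
      ∃ (i : ℕ) (hi : i < L.length), j ≤ i ∧ L[i].card < k ∧ S = insert ⟨v, hv⟩ L[i])
    ⟨[], ?_, by simp, ?_⟩ ?_ ?_).mono (by simp) fun _ h => h
  · simpa using ⟨hL.list.setReg _ _ (by simp), hL.size⟩
  · intro S
    simp
    intro i hi hi'
    omega
  · rintro j hj s₁ hf₁ ⟨X, hX, hXn, hXm⟩
    have h2 : s₁.reg 2 = k := by rw [hf₁.reg 2 (by simp), hk]
    have h36₁ : s₁.reg 36 = v := by rw [hf₁.reg 36 (by simp), h36]
    have h1 : s₁.arr 1 v = 2 ^ v := by rw [hf₁.arr 1 (by simp), hE.pow v hv]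
    have h3 : s₁.arr 3 j = code L[j] := by
      rw [hX.list.get j (by simp; omega), List.getElem_append_left hj]
    have h4 : s₁.arr 4 j = L[j].card := by
      rw [hX.size j (by simp; omega), List.getElem_append_left hj]
    have hjv : (⟨v, hv⟩ : Fin n) ∉ L[j] := hnot _ (List.getElem_mem _)
    refine wp_ite (fun h => ?_) (fun h => ?_)
    · have hlt : L[j].card < k := by simp [h4, h2] at h; omega
      refine wp_sto_seq (wp_sto_seq (wp_set ⟨X ++ [insert ⟨v, hv⟩ L[j]], ?_, ?_, ?_⟩))
      · rw [← List.append_assoc]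
        refine ⟨hX.list.push (by simp) ?_, fun i hi => ?_⟩
        · simp [h3, h1, h36₁, code_insert hjv]
        · have hlen := hX.list.len
          simp only [Exp.ev, State.setReg_reg, State.setReg_arr, State.setArr_reg,
            State.setArr_arr, Nat.reduceEqDiff, if_true, if_false, Function.update_apply, h4]
          rw [hlen]
          split_ifs with hi'
          · subst hi'
            rw [List.getElem_append_right le_rfl]
            simp [Finset.card_insert_of_notMem hjv]
          · have hi2 : i < (L ++ X).length := by simp at hi hi' ⊢; omega
            rw [hX.size i hi2, List.getElem_append_left hi2]
      · rw [List.nodup_append]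
        refine ⟨hXn, by simp, ?_⟩
        rintro S hS T hT rfl
        simp only [List.mem_singleton] at hT
        obtain ⟨i, hi, hji, -, hS⟩ := (hXm S).1 hS
        rw [hT] at hS
        -- Erasing `v` recovers the original sets, and `L` has no repetition.
        have h' := congrArg (fun S => Finset.erase S ⟨v, hv⟩) hS
        simp only [Finset.erase_insert hjv,
          Finset.erase_insert (hnot _ (List.getElem_mem hi))] at h'
        have := (hLn.getElem_inj_iff).1 h'
        omega
      · intro S
        rw [List.mem_append, hXm, List.mem_singleton]
        constructor
        · rintro (⟨i, hi, hji, h⟩ | h)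
          · exact ⟨i, hi, by omega, h⟩
          · exact ⟨j, hj, le_rfl, hlt, h⟩
        · rintro ⟨i, hi, hji, h⟩
          rcases hji.eq_or_lt with rfl | hlt
          · exact .inr h.2
          · exact .inl ⟨i, hi, hlt, h⟩
    · have hge : ¬ L[j].card < k := by simp [h4, h2] at h; omega
      refine wp_skip ⟨X, ⟨hX.list.setReg _ _ (by simp), hX.size⟩, hXn, fun S => ?_⟩
      rw [hXm]
      constructor
      · rintro ⟨i, hi, hji, h⟩
        exact ⟨i, hi, by omega, h⟩
      · rintro ⟨i, hi, hji, h⟩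
        rcases hji.eq_or_lt with rfl | hlt
        · exact absurd h.1 hge
        · exact ⟨i, hi, hlt, h⟩
  · rintro s₁ hf₁ ⟨X, hX, hXn, hXm⟩
    refine ⟨L ++ X, hX, ?_, fun S => ?_⟩
    · rw [List.nodup_append]
      refine ⟨hLn, hXn, ?_⟩
      rintro S hS T hT rfl
      obtain ⟨i, hi, -, -, rfl⟩ := (hXm S).1 hT
      exact hnot _ hS (Finset.mem_insert_self _ _)
    · rw [List.mem_append, hmem, hXm]
      constructor
      · rintro (⟨h, h'⟩ | ⟨i, hi, -, hlt, rfl⟩)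
        · exact ⟨h, fun u hu => by have := h' u hu; omega⟩
        · have := (hmem L[i]).1 (List.getElem_mem hi)
          rw [Finset.card_insert_of_notMem (hnot _ (List.getElem_mem hi))]
          refine ⟨hlt, fun u hu => ?_⟩
          rcases Finset.mem_insert.1 hu with rfl | hu
          · exact le_rfl
          · have := this.2 u hu; omega
      · rintro ⟨h, h'⟩
        by_cases hvS : (⟨v, hv⟩ : Fin n) ∈ S
        · right
          have hS' : S.erase ⟨v, hv⟩ ∈ L := by
            rw [hmem]
            refine ⟨(Finset.card_erase_le).trans h, fun u hu => ?_⟩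
            have h1 := h' u (Finset.mem_of_mem_erase hu)
            have h2 : (u : ℕ) ≠ v := fun h => (Finset.ne_of_mem_erase hu) (Fin.ext h)
            omega
          obtain ⟨i, hi, hi'⟩ := List.mem_iff_getElem.1 hS'
          refine ⟨i, hi, by omega, ?_, ?_⟩
          · rw [hi', Finset.card_erase_of_mem hvS]
            have : 0 < S.card := Finset.card_pos.2 ⟨_, hvS⟩
            omega
          · rw [hi', Finset.insert_erase hvS]
        · left
          refine ⟨h, fun u hu => ?_⟩
          have h1 := h' u hu
          have h2 : (u : ℕ) ≠ v := by
            rintro rfl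
            exact hvS hu
          omega

theorem subsetsC_spec {n k : ℕ} {s : State} (hE : Env n s) (hk : s.reg 2 = k) :
    Wp subsetsC (n * (2 * max n 2 ^ k + 1)) s fun s' => ∃ L : List (Finset (Fin n)),
      HasSets s' L ∧ L.Nodup ∧ ∀ S, S ∈ L ↔ S.card ≤ k := by
  refine wp_set_seq (wp_sto_seq (wp_sto_seq ?_))
  refine wp_for (by simp) n (by simp [hE.size]) (fun v s' => ∃ L : List (Finset (Fin n)),
    HasSets s' L ∧ L.Nodup ∧ ∀ S, S ∈ L ↔ S.card ≤ k ∧ ∀ u ∈ S, v ≤ (u : ℕ)) ?_ ?_ ?_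
  · refine ⟨[∅], ⟨⟨by simp, ?_⟩, ?_⟩, by simp, fun S => ?_⟩
    · simp
    · simp
    · simp only [List.mem_singleton]
      constructor
      · rintro rfl; simp
      · rintro ⟨-, h⟩
        refine Finset.eq_empty_of_forall_notMem fun u hu => ?_
        have := h u hu
        omega
  · rintro v hv s₁ hf₁ ⟨L, hL, hLn, hmem⟩
    refine (subsetsC_step (k := k) ?_ ?_ hv (by simp) ⟨hL.list.setReg _ _ (by simp), hL.size⟩ hLn
      hmem).mono (length_le_of_card hLn fun S hS => ((hmem S).1 hS).1) fun _ h => h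
    · refine Env.setReg (Env.frame ?_ hf₁ (by simp) (by simp) (by simp)) _ _ (by simp) (by simp)
      exact ((hE.setReg _ _ (by simp) (by simp)).setArr _ _ _ (by simp)).setArr _ _ _ (by simp)
    · simp [hf₁.reg 2, hk]
  · rintro s₁ hf₁ ⟨L, hL, hLn, hmem⟩
    exact ⟨L, hL, hLn, fun S => by simp [hmem]⟩

/-! ### Outputs and delays along a run -/

/-- Process one step of a run: the outputs so far, and the numbers written since the last one. -/
def scanStep (x : List (Finset ℕ) × List ℕ) : Action → List (Finset ℕ) × List ℕ
  | .silent => x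
  | .write v => (x.1, x.2 ++ [v])
  | .emit => (x.1 ++ [x.2.toFinset], [])

/-- The outputs of a run, and the numbers written after the last one. -/
def scan (t : List Action) : List (Finset ℕ) × List ℕ := t.foldl scanStep ([], [])

theorem scan_append_singleton (t : List Action) (a : Action) :
    scan (t ++ [a]) = scanStep (scan t) a := by simp [scan]

theorem blocks_cons (a : Action) (t : List Action) : blocks (a :: t) =
    if a.isEmit then [] :: blocks t else (blocks t).modifyHead (a :: ·) := by
  simp only [blocks]
  rw [List.splitOnP_cons_eq_if_modifyHead]

theorem blocks_ne_nil (t : List Action) : blocks t ≠ [] := List.splitOnP_ne_nil _ _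

theorem foldl_scanStep (t : List Action) : ∀ o p b bs, blocks t = b :: bs →
    (t.foldl scanStep (o, p)).1 = o ++ (((p ++ b.filterMap Action.written?) ::
      bs.map (List.filterMap Action.written?)).dropLast.map List.toFinset) := by
  induction t with
  | nil =>
    intro o p b bs h
    simp [blocks] at h
    simp [h]
  | cons a t ih =>
    intro o p b bs h
    obtain ⟨b', bs', hb⟩ := List.exists_cons_of_ne_nil (blocks_ne_nil t)
    rw [blocks_cons, hb] at h
    cases a with
    | silent =>
      simp [Action.isEmit] at h
      obtain ⟨rfl, rfl⟩ := h
      simpa [scanStep, Action.written?, List.filterMap_cons] using ih o p _ _ hb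
    | write v =>
      simp [Action.isEmit] at h
      obtain ⟨rfl, rfl⟩ := h
      simpa [scanStep, Action.written?] using ih o (p ++ [v]) _ _ hb
    | emit =>
      simp [Action.isEmit] at h
      obtain ⟨rfl, rfl⟩ := h
      simpa [scanStep, Action.written?] using ih (o ++ [p.toFinset]) [] _ _ hb

/-- A monitor sees the trace step by step, whereas `outputs` cuts the finished trace into blocks;
the fold makes the outputs of every prefix accessible. -/
theorem outputs_eq_scan (t : List Action) : outputs t = (scan t).1 := by
  obtain ⟨b, bs, hb⟩ := List.exists_cons_of_ne_nil (blocks_ne_nil t)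
  rw [scan, foldl_scanStep t [] [] b bs hb, outputs, hb, List.nil_append, List.nil_append,
    ← List.map_cons, ← List.map_dropLast, List.map_map]
  rfl

theorem prefix_foldl_scanStep (t : List Action) (x : List (Finset ℕ) × List ℕ) :
    x.1 <+: (t.foldl scanStep x).1 := by
  induction t generalizing x with
  | nil => exact List.prefix_rfl
  | cons a t ih =>
    refine List.IsPrefix.trans ?_ (ih (scanStep x a))
    cases a <;> simp [scanStep]

theorem scan_prefix {u t : List Action} (h : u <+: t) : (scan u).1 <+: (scan t).1 := by
  obtain ⟨v, rfl⟩ := h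
  rw [scan, scan, List.foldl_append]
  exact prefix_foldl_scanStep _ _

theorem length_foldl_scanStep (t : List Action) (x : List (Finset ℕ) × List ℕ) :
    (t.foldl scanStep x).1.length = x.1.length + t.countP Action.isEmit := by
  induction t generalizing x with
  | nil => simp
  | cons a t ih =>
    rw [List.foldl_cons, ih, List.countP_cons]
    cases a <;> simp [scanStep, Action.isEmit]
    omega

theorem length_scan (t : List Action) : (scan t).1.length = t.countP Action.isEmit := by
  simp [scan, length_foldl_scanStep]

/-- A prefix with `c` outputs ends inside block number `c`, and each block is followed by at most
one separating step. -/
theorem length_prefix_le (t : List Action) : ∀ u, u <+: t →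
    u.length + 1 ≤ ∑ i ∈ Finset.range (u.countP Action.isEmit + 1),
      (((blocks t).getD i []).length + 1) := by
  induction t with
  | nil =>
    intro u hu
    rw [List.prefix_nil.1 hu]
    simp
  | cons a t ih =>
    intro u hu
    rcases u with _ | ⟨a', u⟩
    · simp
    · obtain ⟨rfl, hu'⟩ := List.cons_prefix_cons.1 hu
      have := ih u hu'
      obtain ⟨b, bs, hb⟩ := List.exists_cons_of_ne_nil (blocks_ne_nil t)
      rw [blocks_cons]
      by_cases h : a'.isEmit = true
      · rw [if_pos h, List.countP_cons_of_pos h, Finset.sum_range_succ']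
        simp at this ⊢
        omega
      · rw [if_neg h, List.countP_cons_of_neg h]
        rw [hb, Finset.sum_range_succ'] at this ⊢
        simp at this ⊢
        omega

theorem length_prefix_le_of_delay {t u : List Action} (hu : u <+: t) {g : ℕ → ℕ} (hg : Monotone g)
    (h : ∀ i b, (blocks t)[i]? = some b → b.length + 1 ≤ g i) {N : ℕ}
    (hN : u.countP Action.isEmit ≤ N) : u.length ≤ (N + 1) * g N := by
  -- There always is a block `0`. By monotonicity `g` is positive everywhere, which covers the
  -- default value of `getD` beyond the last block.
  have h0 : 1 ≤ g 0 := by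
    obtain ⟨b, bs, hb⟩ := List.exists_cons_of_ne_nil (blocks_ne_nil t)
    have := h 0 b (by simp [hb])
    omega
  have h1 : ∀ i, ((blocks t).getD i []).length + 1 ≤ g i := by
    intro i
    rw [List.getD_eq_getElem?_getD]
    cases hb : (blocks t)[i]? with
    | none => simpa using h0.trans (hg (Nat.zero_le i))
    | some b => exact h i b hb
  have := length_prefix_le t u hu
  calc u.length ≤ u.length + 1 := by omega
    _ ≤ _ := this
    _ ≤ ∑ i ∈ Finset.range (u.countP Action.isEmit + 1), g N := by
        refine Finset.sum_le_sum fun i hi => (h1 i).trans (hg ?_)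
        simp at hi; omega
    _ = (u.countP Action.isEmit + 1) * g N := by simp
    _ ≤ (N + 1) * g N := Nat.mul_le_mul_right _ (by omega)

/-- Every view comes from a memory, for instance one whose odd registers are `0`. So facts in a
postcondition that do not involve the final memory can be extracted in advance. -/
theorem Wp.exists {c : Cmd} {T : ℕ} {s : State} {Q : State → Prop} (h : Wp c T s Q) :
    ∃ s', Frame c.wr c.wa s s' ∧ Q s' := by
  obtain ⟨_, _, σ', -, -, -, hq⟩ := h.frame
    ⟨fun x => if x % 2 = 0 then s.reg (x / 2) else 0, s.arr⟩ (by ext <;> simp [abs])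
  exact ⟨_, hq⟩

/-! ### Deciding conformality by monitoring an enumeration -/

/-- Collect those sets of the list in array `3` for which the test `f` succeeds in array `5`; the
test finds in register `27` whether the set is contained in one of those in array `2`. Register `40`
gets the maximum size. -/
def filterC (f : Exp) : Cmd :=
  setC 9 (.lit 0) ;; setC 40 (.lit 0) ;;
  forC 41 (.var 8)
    (anyC false 2 1 (.get 3 (.var 41)) ;;
     iteC f
      (stoC 5 (.var 9) (.get 3 (.var 41)) ;;
       setC 9 (.add (.var 9) (.lit 1)) ;;
       setC 40 (.add (.var 40) (.sub (.get 4 (.var 41)) (.var 40))))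
      .skip)

@[simp] theorem mem_wr_filterC (f : Exp) (x : ℕ) :
    x ∈ (filterC f).wr ↔ x ∈ [9, 20, 21, 22, 23, 24, 25, 26, 27, 28, 40, 41] := by
  simp [filterC]; tauto

@[simp] theorem wa_filterC (f : Exp) : (filterC f).wa = [5] := by simp [filterC]

theorem filterC_spec {n k : ℕ} {s : State} {f : Exp} {l L : List (Finset (Fin n))} (hE : Env n s)
    (hl : HasList s 2 1 l) (hL : HasSets s L) (hLn : L.Nodup) (hk : s.reg 2 = k)
    {keep : Finset (Fin n) → Prop}
    (hf : ∀ s' S, (s'.reg 27 ≠ 0 ↔ Covered l.toFinset S) → s'.reg 2 = k →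
      s'.arr 4 (s'.reg 41) = S.card → (f.ev s' ≠ 0 ↔ keep S)) :
    Wp (filterC f) (L.length * (l.length * (n + 1) + 1)) s fun s' =>
      ∃ F : List (Finset (Fin n)), HasList s' 5 9 F ∧ F.Nodup ∧ (∀ S, S ∈ F ↔ S ∈ L ∧ keep S) ∧
        s'.reg 40 = rank F.toFinset := by
  refine wp_set_seq (wp_set_seq ?_)
  refine wp_for (by simp) L.length (by simp [hL.list.len]) (fun j s' =>
    ∃ F : List (Finset (Fin n)), HasList s' 5 9 F ∧ F.Nodup ∧
      (∀ S, S ∈ F ↔ ∃ (i : ℕ) (hi : i < L.length), j ≤ i ∧ L[i] = S ∧ keep S) ∧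
      s'.reg 40 = rank F.toFinset) ?_ ?_ ?_
  · refine ⟨[], .nil (by simp), by simp, fun S => ?_, by simp [rank]⟩
    simp
    intro i hi hi'; omega
  · rintro j hj s₁ hf₁ ⟨F, hF, hFn, hFm, h40⟩
    have hE₁ : Env n s₁ := Env.frame ((hE.setReg _ _ (by simp) (by simp)).setReg _ _ (by simp)
      (by simp)) hf₁ (by simp) (by simp) (by simp)
    have hl₁ : HasList s₁ 2 1 l := HasList.frame ((hl.setReg _ _ (by simp)).setReg _ _ (by simp))
      hf₁ (by simp) (by simp)
    have h3₁ : s₁.arr 3 j = code L[j] := by rw [hf₁.arr 3 (by simp)]; exact hL.list.get j hj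
    have h4₁ : s₁.arr 4 j = L[j].card := by rw [hf₁.arr 4 (by simp)]; exact hL.size j hj
    have h2₁ : s₁.reg 2 = k := by rw [hf₁.reg 2 (by simp)]; simp [hk]
    refine (anyC_spec (hE₁.setReg 41 j (by simp) (by simp)) false (hl₁.setReg 41 j (by simp))
      (by simp) L[j] (by simp [h3₁])).call_seq 0 (by simp) fun s₂ hf₂ h27 => ?_
    have h41₂ : s₂.reg 41 = j := by rw [hf₂.reg 41 (by simp)]; simp
    have h3₂ : s₂.arr 3 j = code L[j] := by rw [hf₂.arr 3 (by simp)]; exact h3₁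
    have h4₂ : s₂.arr 4 j = L[j].card := by rw [hf₂.arr 4 (by simp)]; exact h4₁
    have hkeep := hf s₂ L[j] (by rw [h27]; simp [Covered])
      (by rw [hf₂.reg 2 (by simp)]; simpa using h2₁) (by rw [h41₂, h4₂])
    have hF₂ : HasList s₂ 5 9 F := (hF.setReg 41 j (by simp)).frame hf₂ (by simp) (by simp)
    have h40₂ : s₂.reg 40 = rank F.toFinset := by rw [hf₂.reg 40 (by simp)]; simpa using h40
    refine wp_ite (fun h => ?_) fun h => ?_
    · refine wp_sto_seq (wp_set_seq (wp_set ⟨F ++ [L[j]], ?_, ?_, ?_, ?_⟩))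
      · exact hF₂.push (by simp) (by simp [h41₂, h3₂])
      · rw [List.nodup_append]
        refine ⟨hFn, by simp, ?_⟩
        rintro S hS T hT rfl
        obtain ⟨i, hi, hji, hS, -⟩ := (hFm S).1 hS
        rw [List.mem_singleton.1 hT] at hS
        have := hLn.getElem_inj_iff.1 hS
        omega
      · intro S
        rw [List.mem_append, hFm, List.mem_singleton]
        constructor
        · rintro (⟨i, hi, hji, h⟩ | rfl)
          · exact ⟨i, hi, by omega, h⟩
          · exact ⟨j, hj, le_rfl, rfl, hkeep.1 h⟩
        · rintro ⟨i, hi, hji, h⟩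
          rcases hji.eq_or_lt with rfl | hlt
          · exact .inr h.1.symm
          · exact .inl ⟨i, hi, hlt, h⟩
      -- Adding the truncated difference computes the maximum of the old rank and the new size.
      · simp [rank, h40₂, h41₂, h4₂]
        omega
    · refine wp_skip ⟨F, hF₂, hFn, fun S => ?_, h40₂⟩
      rw [hFm]
      constructor
      · rintro ⟨i, hi, hji, h⟩
        exact ⟨i, hi, by omega, h⟩
      · rintro ⟨i, hi, hji, h'⟩
        rcases hji.eq_or_lt with rfl | hlt
        · rw [← h'.1] at h'
          exact absurd h (hkeep.2 h'.2)
        · exact ⟨i, hi, hlt, h'⟩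
  · rintro s₁ hf₁ ⟨F, hF, hFn, hFm, h40⟩
    refine ⟨F, hF, hFn, fun S => ?_, h40⟩
    rw [hFm, List.mem_iff_getElem]
    constructor
    · rintro ⟨i, hi, -, h, h'⟩; exact ⟨⟨i, hi, h⟩, h'⟩
    · rintro ⟨⟨i, hi, h⟩, h'⟩; exact ⟨i, hi, by omega, h, h'⟩

/-- Check whether the set marked in array `11`, transformed by `e`, is contained in one of the
sets in array `2`, abort if it is not, and unmark it. -/
def checkC (e : Exp) : Cmd :=
  setC 42 (.lit 0) ;;
  forC 43 (.var 0)
    (setC 42 (.add (.var 42) (.cond (.get 11 (.var 43)) (.get 1 (.var 43)) (.lit 0))) ;;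
     stoC 11 (.var 43) (.lit 0)) ;;
  anyC false 2 1 e ;;
  setC 5 (.cond (.var 27) (.lit 0) (.lit 1))

@[simp] theorem mem_wr_checkC (e : Exp) (x : ℕ) :
    x ∈ (checkC e).wr ↔ x ∈ [5, 20, 21, 22, 23, 24, 25, 26, 27, 28, 42, 43] := by
  simp [checkC]; tauto

@[simp] theorem wa_checkC (e : Exp) : (checkC e).wa = [11] := by simp [checkC]

theorem checkC_spec {n : ℕ} {s : State} {e : Exp} {l : List (Finset (Fin n))} (hE : Env n s)
    (hl : HasList s 2 1 l) {S S' : Finset (Fin n)}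
    (he : ∀ s', Env n s' → s'.reg 42 = code S → e.ev s' = code S')
    (hS : ∀ v, s.arr 11 v ≠ 0 ↔ v ∈ S.map Fin.valEmbedding) :
    Wp (checkC e) (n + l.length * (n + 1)) s fun s' =>
      (s'.reg 5 = 0 ↔ Covered l.toFinset S') ∧ Env n s' ∧ HasList s' 2 1 l ∧
        ∀ v, s'.arr 11 v = 0 := by
  refine wp_set_seq ?_
  refine wp_for_seq (T := 0) (T₂ := l.length * (n + 1)) (by simp) n (by simp [hE.size])
    (fun v s' => s'.reg 42 = code (S.filter fun u : Fin n => v ≤ (u : ℕ)) ∧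
      ∀ i, s'.arr 11 i ≠ 0 ↔ i < v ∧ i ∈ S.map Fin.valEmbedding) ?_ (by simp) ?_ ?_
  · rw [high_self]
    refine ⟨by simp, fun i => ?_⟩
    simp only [State.setReg_arr, hS]
    constructor
    · intro h
      refine ⟨?_, h⟩
      obtain ⟨u, -, rfl⟩ := Finset.mem_map.1 h
      exact u.2
    · exact fun h => h.2
  · rintro v hv s₁ hf₁ ⟨h42, h11⟩
    refine wp_set_seq (wp_sto ?_)
    have h1 : s₁.arr 1 v = 2 ^ v := by rw [hf₁.arr 1 (by simp)]; exact hE.pow v hv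
    have hv11 : s₁.arr 11 v ≠ 0 ↔ (⟨v, hv⟩ : Fin n) ∈ S := by
      rw [h11]
      simp only [Finset.mem_map, Fin.valEmbedding_apply]
      constructor
      · rintro ⟨-, u, hu, rfl⟩; exact hu
      · exact fun h => ⟨by omega, _, h, rfl⟩
    constructor
    · simp only [Exp.ev, State.setReg_reg, State.setArr_reg, State.setReg_arr, h42, if_true,
        Nat.reduceEqDiff, if_false, h1, code_high_succ hv]
      by_cases h : (⟨v, hv⟩ : Fin n) ∈ S
      · simp [h, hv11.2 h]
      · have : s₁.arr 11 v = 0 := by by_contra h'; exact h (hv11.1 h')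
        simp [h, this]
    · intro i
      simp only [Exp.ev, State.setReg_reg, State.setArr_arr, State.setReg_arr, if_true,
        Function.update_apply]
      simp only [Nat.reduceEqDiff, if_false]
      split_ifs with h
      · simp [h]
      · rw [h11]
        refine and_congr_left fun _ => ?_
        omega
  · rintro s₁ hf₁ ⟨h42, h11⟩
    rw [high_zero] at h42
    have hE₁ : Env n s₁ := (hE.setReg 42 _ (by simp) (by simp)).frame hf₁ (by simp) (by simp)
      (by simp)
    have hl₁ : HasList s₁ 2 1 l := (hl.setReg 42 _ (by simp)).frame hf₁ (by simp) (by simp)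
    refine (anyC_spec hE₁ false hl₁ (by simp) S' (he s₁ hE₁ h42)).call_seq 0 (by simp)
      fun s₂ hf₂ h27 => wp_set ⟨?_, ?_, ?_, ?_⟩
    · have : s₂.reg 27 ≠ 0 ↔ Covered l.toFinset S' := by rw [h27]; simp [Covered]
      rw [← this]
      by_cases h : s₂.reg 27 = 0 <;> simp [h]
    · exact (hE₁.frame hf₂ (by simp) (by simp) (by simp)).setReg _ _ (by simp) (by simp)
    · exact (hl₁.frame hf₂ (by simp) (by simp)).setReg _ _ (by simp)
    · intro v
      simp only [State.setReg_arr]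
      rw [hf₂.arr 11 (by simp)]
      by_contra h
      have := (h11 v).1 h
      omega

/-- What is known of the memory while an enumeration algorithm is monitored: the input is at hand,
array `11` marks the numbers written since the last output, and the outputs so far satisfy `G`. -/
structure Monitor {n : ℕ} (l : List (Finset (Fin n))) (G : Finset ℕ → Prop) (u : List Action)
    (σ : State) : Prop where
  env : Env n σ
  list : HasList σ 2 1 l
  mark : ∀ v, σ.arr 11 v ≠ 0 ↔ v ∈ (scan u).2
  good : ∀ D ∈ (scan u).1, G D

/-- As long as all outputs are covered, `co` maps them to distinct edges, so there are at most `m`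
of them. The run thus ends, or reveals an uncovered set, within `m + 1` outputs, and its length is
bounded by the first `m + 2` delays. -/
theorem monitor_run {n : ℕ} {l : List (Finset (Fin n))} {A : Cmd} {r r' : State} {t : List Action}
    {e : Exp} {co : Finset (Fin n) → Finset (Fin n)} (hA : Run A r t r')
    (he : ∀ s' S, Env n s' → s'.reg 42 = code S → e.ev s' = code (co S))
    {sols : List (Finset (Fin n))} (hco : Function.Injective co)
    (hout : outputs t = sols.map fun C => C.map Fin.valEmbedding) (hsn : sols.Nodup)
    (hsol : ∀ S ∈ sols, Covered l.toFinset (co S) → co S ∈ l.toFinset)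
    {g : ℕ → ℕ} (hg : Monotone g) (hd : ∀ i b, (blocks t)[i]? = some b → b.length + 1 ≤ g i)
    {σ : State} (hE : Env n σ) (hl : HasList σ 2 1 l) (h11 : ∀ v, σ.arr 11 v = 0)
    (hs : Sim σ r) (h5 : σ.reg 5 = 0) :
    Wp (embC (stoC 11 (.var 6) (.lit 1)) (checkC e) A)
      ((n + l.length * (n + 1) + 1) * ((l.length + 2) * g (l.length + 1))) σ
      fun σ' => σ'.reg 5 = 0 ↔ ∀ S ∈ sols, Covered l.toFinset (co S) := by
  set G : Finset ℕ → Prop := fun D => ∀ S : Finset (Fin n), D = S.map Fin.valEmbedding →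
    Covered l.toFinset (co S) with hG
  rw [outputs_eq_scan] at hout
  have hval : Function.Injective (fun C : Finset (Fin n) => C.map Fin.valEmbedding) :=
    Finset.map_injective _
  have hpre (u : List Action) (hu : u <+: t) : ∃ ss, ss <+: sols ∧
      (scan u).1 = ss.map fun C => C.map Fin.valEmbedding := by
    have := scan_prefix hu
    rw [hout] at this
    obtain ⟨ss, h, h'⟩ := List.prefix_map_iff.1 this
    exact ⟨ss, h, h'⟩
  -- The injectivity of `co` and `hsol` turn covered outputs into distinct members of `l`.
  have hcount (u : List Action) (hu : u <+: t) (h : ∀ D ∈ (scan u).1, G D) :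
      u.countP Action.isEmit ≤ l.length := by
    obtain ⟨ss, hss, hs⟩ := hpre u hu
    rw [← length_scan, hs, List.length_map, ← List.length_map (f := co),
      ← List.toFinset_card_of_nodup ((hss.sublist.nodup hsn).map hco)]
    refine (Finset.card_le_card ?_).trans (List.toFinset_card_le l)
    intro E hE
    simp only [List.mem_toFinset, List.mem_map] at hE
    obtain ⟨S, hS, rfl⟩ := hE
    refine hsol S (hss.subset hS) (h _ ?_ S rfl)
    rw [hs]
    exact List.mem_map_of_mem hS
  have hlast (u : List Action) (hu : u ++ [Action.emit] <+: t) :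
      ∃ S ∈ sols, (scan u).2.toFinset = S.map Fin.valEmbedding := by
    obtain ⟨ss, hss, hs⟩ := hpre _ hu
    rw [scan_append_singleton] at hs
    have : (scan u).2.toFinset ∈ ss.map fun C => C.map Fin.valEmbedding := by
      rw [← hs]; simp [scanStep]
    obtain ⟨S, hS, h⟩ := List.mem_map.1 this
    exact ⟨S, hss.subset hS, h.symm⟩
  have hsim := embC_sim (W := stoC 11 (.var 6) (.lit 1)) (E := checkC e)
    -- The assertion after an abort ignores the memory and records that the last output was the
    -- first bad one; this bounds the number of outputs of the aborted prefix.
    (K := n + l.length * (n + 1) + 1) (full := t) (M := Monitor l G)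
    (B := fun u _ => ∃ u₀, u = u₀ ++ [Action.emit] ∧ (∀ D ∈ (scan u₀).1, G D) ∧
      ∃ S ∈ sols, ¬ Covered l.toFinset (co S))
    (by simp) (by simp) (by simp) (by simp) (by simp) ?_ (by omega) ?_ ?_ ?_ hA [] (by simp)
  · have hM : Monitor l G [] σ := ⟨hE, hl, by simp [scan, h11], by simp [scan]⟩
    rcases hsim with h | ⟨t', ht, h⟩
    · have hh := h σ hs h5 hM
      -- That all outputs are covered is a property of the trace. It is needed for the time bound,
      -- hence extracted before the run is considered.
      obtain ⟨s', -, -, -, hm⟩ := hh.exists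
      have hgood := hm.good
      rw [List.nil_append, hout] at hgood
      refine hh.mono (Nat.mul_le_mul_left _ ?_) fun s'' hq => ?_
      · exact length_prefix_le_of_delay List.prefix_rfl hg hd
          ((hcount t List.prefix_rfl (by simpa using hm.good)).trans (by omega))
      · exact iff_of_true hq.2.1 fun S hS => hgood _ (List.mem_map_of_mem hS) S rfl
    · have hh := h σ hs h5 hM
      obtain ⟨s', -, -, u₀, hu₀, hgood, S, hS, hSc⟩ := hh.exists
      rw [List.nil_append] at hu₀
      refine hh.mono (Nat.mul_le_mul_left _ ?_) fun s'' hq => ?_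
      · refine length_prefix_le_of_delay ht hg hd ?_
        rw [hu₀] at ht ⊢
        have := hcount u₀ ((List.prefix_append _ _).trans ht) hgood
        simp [Action.isEmit]
        exact this
      · exact iff_of_false hq.1 fun h => hSc (h S hS)
  · intro u σ₁ σ₂ hr ha hm
    refine ⟨⟨?_, ?_, ?_⟩, ⟨?_, ?_⟩, ?_, hm.good⟩
    · rw [hr _ (by simp) (by simp) (by simp), hm.env.size]
    · rw [hr _ (by simp) (by simp) (by simp), hm.env.full]
    · rw [ha _ (by simp)]; exact hm.env.pow
    · rw [hr _ (by simp) (by simp) (by simp), hm.list.len]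
    · rw [ha _ (by simp)]; exact hm.list.get
    · rw [ha _ (by simp)]; exact hm.mark
  · intro u σ₁ hm
    refine ⟨hm.env, hm.list, ?_, ?_⟩
    · rw [scan_append_singleton]; exact hm.mark
    · rw [scan_append_singleton]; exact hm.good
  · intro u v σ₁ hm h6 _
    refine wp_sto ⟨hm.env.setArr _ _ _ (by simp), hm.list.setArr _ _ _ (by simp), ?_, ?_⟩
    · intro w
      rw [scan_append_singleton]
      simp only [Exp.ev, State.setArr_arr, if_true, h6, Function.update_apply, scanStep,
        List.mem_append, List.mem_singleton]
      split_ifs with h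
      · simp [h]
      · simp [h, hm.mark]
    · rw [scan_append_singleton]; exact hm.good
  · intro u hu
    obtain ⟨S, hS, hSu⟩ := hlast u hu
    have key (σ₁ : State) (hm : Monitor l G u σ₁) := checkC_spec (e := e) (S := S) (S' := co S)
      hm.env hm.list (fun s' => he s' S) (fun v => by rw [hm.mark, ← hSu, List.mem_toFinset])
    by_cases hc : Covered l.toFinset (co S)
    · refine .inl fun σ₁ hm h5 => (key σ₁ hm).mono (by omega) fun σ₂ h => ⟨h.1.2 hc, h.2.1, h.2.2.1,
        ?_, ?_⟩
      · simp [scan_append_singleton, scanStep, h.2.2.2]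
      · intro D hD
        simp only [scan_append_singleton, scanStep, List.mem_append, List.mem_singleton] at hD
        rcases hD with hD | rfl
        · exact hm.good D hD
        · intro S' hS'
          rw [hSu] at hS'
          rwa [← hval hS']
    · exact .inr fun σ₁ hm h5 => (key σ₁ hm).mono (by omega) fun σ₂ h =>
        ⟨fun h0 => hc (h.1.1 h0), u, rfl, hm.good, S, hS, hc⟩

/-- Decide conformality by means of the enumeration algorithm `A`. -/
def hookC (A : Cmd) (f p e : Exp) : Cmd :=
  powC ;; readC ;; subsetsC ;; filterC f ;; feedC A 5 9 p ;;
  embC (stoC 11 (.var 6) (.lit 1)) (checkC e) A ;; setC 0 (.cond (.var 5) (.lit 0) (.lit 1))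

theorem PBound.hook (p : Polynomial ℕ) (c : ℕ) :
    PBound (fun i : ℕ × ℕ × ℕ => i.2.1) (fun i => max i.1 2) (fun i => i.2.2)
      (fun i => inputT i.1 i.2.1 + (i.1 * (2 * max i.1 2 ^ i.2.2 + 1) +
        (2 * max i.1 2 ^ i.2.2 * (i.2.1 * (i.1 + 1) + 1) +
        (feedT i.1 (2 * max i.1 2 ^ i.2.2) + (i.1 + i.2.1 * (i.1 + 1) + 1) * ((i.2.1 + 2) *
          (p.eval (i.2.1 + 1) * max i.1 2 ^ (i.2.2 + c))))))) := by
  have hN : ∀ i : ℕ × ℕ × ℕ, 2 ≤ max i.1 2 := fun i => le_max_right _ _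
  have n : PBound (fun i : ℕ × ℕ × ℕ => i.2.1) (fun i => max i.1 2) 0 (fun i => i.1) :=
    PBound.base.of_le fun i => le_max_left _ _
  have m : PBound (fun i : ℕ × ℕ × ℕ => i.2.1) (fun i => max i.1 2) 0 (fun i => i.2.1) :=
    PBound.var
  have one := PBound.const (x := fun i : ℕ × ℕ × ℕ => i.2.1) (N := fun i => max i.1 2) 1
  have two := PBound.const (x := fun i : ℕ × ℕ × ℕ => i.2.1) (N := fun i => max i.1 2) 2
  have q : PBound (fun i : ℕ × ℕ × ℕ => i.2.1) (fun i => max i.1 2) (fun i => i.2.2)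
    (fun i => 2 * max i.1 2 ^ i.2.2) := two.zmul PBound.pow
  refine PBound.add hN (.up hN ?_) (.add hN ?_ (.add hN ?_ (.add hN ?_ ?_)))
  · exact n.add hN (m.add hN (m.zmul (n.add hN one)))
  · exact n.zmul (q.add hN (one.up hN))
  · exact q.mulz ((m.zmul (n.add hN one)).add hN one)
  · exact q.add hN (q.mulz ((n.zmul (n.add hN one)).add hN one))
  -- The delay polynomial is evaluated at `m + 1` outputs, hence the shift of its variable.
  · refine ((n.add hN (m.zmul (n.add hN one))).add hN one).zmul ((m.add hN two).zmul
      ⟨p.comp (.X + 1), c, fun i => by simp⟩)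

/-- Common frame of three reductions: `keep` selects the small sets that form `F`, `par` is the
parameter passed to the enumeration, and `co` turns a solution into a set whose coverage is checked.
The combinatorics is confined to `key`. Since `F` has at most `2 * n ^ k` edges and the parameter is
at most `k` by `hpar`, the cost stays within `n ^ (k + O(1))`. -/
theorem conformal_of_enumerable {Inst : (n : ℕ) → FinHypergraph n → ℕ → Prop}
    {Sol : (n : ℕ) → FinHypergraph n → ℕ → Finset (Fin n) → Prop}
    (h : EnumerableWithDelay Inst Sol) (f p e : Exp)
    (keep : (n : ℕ) → FinHypergraph n → ℕ → Finset (Fin n) → Prop)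
    (co : (n : ℕ) → Finset (Fin n) → Finset (Fin n)) (par : ℕ → ℕ → ℕ)
    (hf : ∀ n H k s S, (s.reg 27 ≠ 0 ↔ Covered H S) → s.reg 2 = k →
      s.arr 4 (s.reg 41) = S.card → (f.ev s ≠ 0 ↔ keep n H k S))
    (hp : ∀ s, p.ev s = par (s.reg 2) (s.reg 40))
    (hpar : ∀ k m, m ≤ k → par k m ≤ k)
    (he : ∀ n s S, Env n s → s.reg 42 = code S → e.ev s = code (co n S))
    (hco : ∀ n, Function.Injective (co n))
    (key : ∀ n (H F : FinHypergraph n) k, (∀ S, S ∈ F ↔ S.card ≤ k ∧ keep n H k S) →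
      Inst n F (par k (rank F)) ∧
      (∀ S, Sol n F (par k (rank F)) S → Covered H (co n S) → co n S ∈ H) ∧
      (IsConformal H k ↔ ∀ S, Sol n F (par k (rank F)) S → Covered H (co n S))) :
    DecidableInTime (fun _ H k => IsConformal H k) := by
  obtain ⟨A, q, c, hA⟩ := h
  refine decidableInTime_of_wp (hookC A f p e) _ (PBound.hook q c) fun n l k hl => ?_
  dsimp only
  set N := max n 2
  have hN : 2 ≤ N := le_max_right _ _
  set T₄ := (n + l.length * (n + 1) + 1) * ((l.length + 2) *
          (q.eval (l.length + 1) * N ^ (k + c))) with hT₄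
  set T₃ := feedT n (2 * N ^ k) + T₄ with hT₃
  set T₂ := 2 * N ^ k * (l.length * (n + 1) + 1) + T₃ with hT₂
  refine (powC_spec (n := n) (by simp [encode])).call_seq
    (l.length + l.length * (n + 1) + (n * (2 * N ^ k + 1) + T₂))
    (by simp [inputT]; omega) fun s₁ hf₁ hE₁ => ?_
  have h1₁ : s₁.reg 1 = l.length := by rw [hf₁.reg 1 (by simp)]; simp [encode]
  have h0₁ : s₁.arr 0 = (encode l k).arr 0 := by rw [hf₁.arr 0 (by simp)]
  have h2₁ : s₁.reg 2 = k := by rw [hf₁.reg 2 (by simp)]; simp [encode]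
  have h11₁ : ∀ v, s₁.arr 11 v = 0 := fun v => by rw [hf₁.arr 11 (by simp)]; simp [encode]
  have hF₁ : Fresh A s₁ := (Fresh.encode l k).frame hf₁ (by simp) (by simp)
  refine (readC_spec hE₁ h1₁ h0₁).call_seq _ le_rfl fun s₂ hf₂ hl₂ => ?_
  have hE₂ : Env n s₂ := hE₁.frame hf₂ (by simp) (by simp) (by simp)
  have h2₂ : s₂.reg 2 = k := by rw [hf₂.reg 2 (by simp), h2₁]
  have h11₂ : ∀ v, s₂.arr 11 v = 0 := fun v => by rw [hf₂.arr 11 (by simp), h11₁]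
  have hF₂ : Fresh A s₂ := hF₁.frame hf₂ (by simp) (by simp)
  refine (subsetsC_spec hE₂ h2₂).call_seq T₂ le_rfl fun s₃ hf₃ ⟨L, hL, hLn, hLm⟩ => ?_
  have hLlen : L.length ≤ 2 * N ^ k := length_le_of_card hLn fun S hS => (hLm S).1 hS
  have hE₃ : Env n s₃ := hE₂.frame hf₃ (by simp) (by simp) (by simp)
  have hl₃ : HasList s₃ 2 1 l := hl₂.frame hf₃ (by simp) (by simp)
  have h2₃ : s₃.reg 2 = k := by rw [hf₃.reg 2 (by simp), h2₂]
  have h11₃ : ∀ v, s₃.arr 11 v = 0 := fun v => by rw [hf₃.arr 11 (by simp), h11₂]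
  have hF₃ : Fresh A s₃ := hF₂.frame hf₃ (by simp) (by simp)
  refine (filterC_spec hE₃ hl₃ hL hLn h2₃ (keep := keep n l.toFinset k)
    (fun s' S => hf n l.toFinset k s' S)).call_seq T₃ ?_ fun s₄ hf₄ ⟨F, hF, hFn, hFm, h40⟩ => ?_
  · exact Nat.add_le_add_right (Nat.mul_le_mul_right _ hLlen) _
  have hE₄ : Env n s₄ := hE₃.frame hf₄ (by simp) (by simp) (by simp)
  have hl₄ : HasList s₄ 2 1 l := hl₃.frame hf₄ (by simp) (by simp)
  have h2₄ : s₄.reg 2 = k := by rw [hf₄.reg 2 (by simp), h2₃]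
  have h11₄ : ∀ v, s₄.arr 11 v = 0 := fun v => by rw [hf₄.arr 11 (by simp), h11₃]
  have hF₄ : Fresh A s₄ := hF₃.frame hf₄ (by simp) (by simp)
  have hFlen : F.length ≤ 2 * N ^ k :=
    length_le_of_card hFn fun S hS => (hLm S).1 ((hFm S).1 hS).1
  have hrank : rank F.toFinset ≤ k := Finset.sup_le fun S hS =>
    (hLm S).1 ((hFm S).1 (List.mem_toFinset.1 hS)).1
  obtain ⟨hinst, hsol, hconf⟩ := key n l.toFinset F.toFinset k
    (fun S => by rw [List.mem_toFinset, hFm, hLm])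
  set m := par k (rank F.toFinset) with hm
  have hmk : m ≤ k := hpar _ _ hrank
  obtain ⟨t, r, hr, ⟨sols, hsn, hsm, hout⟩, hd⟩ := hA n F m hFn hinst
  have hev : p.ev s₄ = m := by rw [hp, h2₄, h40]
  refine (feedC_spec A (e := p) hE₄ hF hF₄ (by simp) (by simp) (by simp)
    (by simp)).call_seq T₄ ?_ fun s₅ hf₅ ⟨hs₅, h5₅⟩ => ?_
  · rw [hT₃]
    refine Nat.add_le_add_right ?_ _
    unfold feedT
    gcongr
  rw [hev] at hs₅
  have hreg (x : ℕ) (hx : x < 100) (hx' : x ∉ feedRegs) : s₅.reg x = s₄.reg x :=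
    hf₅.reg x fun h => hx' (wr_feedC _ _ _ _ _ hx h)
  have harr (a : ℕ) (ha : a < 20) : s₅.arr a = s₄.arr a :=
    hf₅.arr a (by rw [wa_feedC]; simp; omega)
  have hE₅ : Env n s₅ := by
    refine ⟨?_, ?_, ?_⟩
    · rw [hreg _ (by simp) (by simp), hE₄.size]
    · rw [hreg _ (by simp) (by simp), hE₄.full]
    · rw [harr _ (by simp)]; exact hE₄.pow
  have hl₅ : HasList s₅ 2 1 l := by
    refine ⟨?_, ?_⟩
    · rw [hreg _ (by simp) (by simp), hl₄.len]
    · rw [harr _ (by simp)]; exact hl₄.get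
  have h11₅ : ∀ v, s₅.arr 11 v = 0 := fun v => by rw [harr _ (by simp), h11₄]
  refine (monitor_run (g := fun i => q.eval i * N ^ (k + c)) hr (he n) (hco n) hout hsn
    (fun S hS => hsol S ((hsm S).1 hS)) (fun a b hab => ?_) ?_ hE₅ hl₅ h11₅ hs₅ h5₅).call_seq 0
    le_rfl fun s₆ hf₆ h5 => wp_set ?_
  · exact Nat.mul_le_mul_right _ (eval_mono q hab)
  · intro i b hb
    refine (hd i b hb).trans (Nat.mul_le_mul_left _ (Nat.pow_le_pow_right (by omega) (by omega)))
  · rw [hconf]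
    have : (∀ S, Sol n F.toFinset m S → Covered l.toFinset (co n S)) ↔ s₆.reg 5 = 0 := by
      rw [h5]
      exact forall_congr' fun S => by rw [hsm]
    rw [this]
    by_cases h : s₆.reg 5 = 0 <;> simp [h]

/-! ### From the three enumeration problems to conformality -/

theorem isHittingSet_iff_compl {n : ℕ} {H : FinHypergraph n} {T : Finset (Fin n)} :
    IsHittingSet H T ↔ ∀ E ∈ H, ¬ E ⊆ Tᶜ := by
  refine forall₂_congr fun E _ => ?_
  rw [Finset.not_subset]
  simp only [Finset.Nonempty, Finset.mem_inter, Finset.mem_compl, not_not]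

theorem eqExp_ne_zero {a b : ℕ} : (a - b + (b - a) = 0) ↔ a = b := by omega

/-- Let `F` consist of the uncovered sets with at most `k` vertices. A set hits `F` iff all small
subsets of its complement are covered, so complements of minimal hitting sets are maximal with this
property. Edges have the property too, whence a covered complement is an edge. The rank of `F` may
be smaller than `k` and is computed along the way. -/
theorem conformal_of_minimalHittingSets
    (h : EnumerableWithDelay (fun _ H r => rank H = r)
      (fun _ H _ T => Minimal (IsHittingSet H) T)) :
    DecidableInTime (fun _ H k => IsConformal H k) := by
  refine conformal_of_enumerable h (.cond (.var 27) (.lit 0) (.lit 1)) (.var 40)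
    (.sub (.var 7) (.var 42)) (fun _ H _ S => ¬ Covered H S) (fun _ S => Sᶜ) (fun _ m => m)
    ?_ ?_ ?_ ?_ ?_ ?_
  · intro n H k s S h _ _
    rw [← h]
    by_cases h0 : s.reg 27 = 0 <;> simp [h0]
  · simp
  · simp
  · intro n s S hE h
    simp [hE.full, h, code_compl]
  · exact fun n => compl_injective
  · intro n H F k hF
    have hhit (D : Finset (Fin n)) : IsHittingSet F Dᶜ ↔ ∀ S ⊆ D, S.card ≤ k → Covered H S := by
      rw [isHittingSet_iff_compl, compl_compl]
      constructor
      · intro h S hS hk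
        by_contra hc
        exact h S ((hF S).2 ⟨hk, hc⟩) hS
      · intro h S hS hSD
        exact ((hF S).1 hS).2 (h S hSD ((hF S).1 hS).1)
    refine ⟨rfl, ?_, ?_⟩
    · rintro T hT ⟨E, hE, hTE⟩
      have h1 : IsHittingSet F Eᶜ := (hhit E).2 fun S hS _ => ⟨E, hE, hS⟩
      have h2 : Eᶜ ⊆ T := compl_le_iff_compl_le.1 hTE
      have h3 : Eᶜ = T := hT.eq_of_le h1 h2
      rw [← h3, compl_compl]
      exact hE
    · rw [isConformal_iff]
      constructor
      · intro h T hT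
        by_contra hc
        refine h ⟨Tᶜ, hc, (hhit _).1 ?_⟩
        rw [compl_compl]
        exact hT.prop
      · rintro h ⟨S, hS, hS'⟩
        obtain ⟨T, hTS, hT⟩ := exists_minimal_le_of_wellFoundedLT
          (IsHittingSet F) Sᶜ ((hhit S).2 hS')
        refine hS ((h T hT).mono ?_)
        exact le_compl_iff_le_compl.1 hTS

/-- The sets with at least `k` vertices all of whose `k`-subsets are covered. -/
def LocallyCovered {n : ℕ} (H : FinHypergraph n) (k : ℕ) (D : Finset (Fin n)) : Prop :=
  k ≤ D.card ∧ ∀ S ⊆ D, S.card = k → Covered H S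

/-- An edge containing `D` is itself locally covered, so maximality makes it equal to `D`. -/
theorem mem_of_maximal_locallyCovered {n : ℕ} {H : FinHypergraph n} {k : ℕ} {D : Finset (Fin n)}
    (hD : Maximal (LocallyCovered H k) D) (h : Covered H D) : D ∈ H := by
  obtain ⟨E, hE, hDE⟩ := h
  rw [hD.eq_of_le (y := E) ⟨hD.prop.1.trans (Finset.card_le_card hDE), fun S hS _ => ⟨E, hE, hS⟩⟩
    hDE]
  exact hE

/-- For a set with at least `k` vertices it suffices to look at `k`-subsets, as smaller ones extend
to them. A violating set has at least `k` vertices, for otherwise it would be one of its own small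
subsets, and it lies in a maximal locally covered set. -/
theorem isConformal_iff_locallyCovered {n : ℕ} {H : FinHypergraph n} {k : ℕ} :
    IsConformal H k ↔ ∀ D, Maximal (LocallyCovered H k) D → Covered H D := by
  rw [isConformal_iff]
  constructor
  · intro h D hD
    by_contra hc
    refine h ⟨D, hc, fun S hS hk => ?_⟩
    obtain ⟨S', h1, h2, h3⟩ := Finset.exists_subsuperset_card_eq hS hk hD.prop.1
    exact (hD.prop.2 S' h2 h3).mono h1
  · rintro h ⟨S, hS, hS'⟩
    have hk : k ≤ S.card := by
      by_contra hc
      exact hS (hS' S subset_rfl (by omega))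
    obtain ⟨D, hSD, hD⟩ := exists_maximal_ge_of_wellFoundedGT (LocallyCovered H k) S
      ⟨hk, fun S' h h' => hS' S' h h'.le⟩
    exact hS ((h D hD).mono hSD)

/-- With the uncovered `k`-sets as edges, independent means locally covered. The parameter is `k`
and not the rank, which would be `0` if no set is uncovered. -/
theorem conformal_of_maximalIndependentSets
    (h : EnumerableWithDelay (fun _ H r => IsUniform H r)
      (fun _ H r C => Maximal (IsIndependent H r) C)) :
    DecidableInTime (fun _ H k => IsConformal H k) := by
  refine conformal_of_enumerable h (.cond (.var 27) (.lit 0)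
      (.cond (.add (.sub (.get 4 (.var 41)) (.var 2)) (.sub (.var 2) (.get 4 (.var 41))))
        (.lit 0) (.lit 1))) (.var 2)
    (.var 42) (fun _ H k S => S.card = k ∧ ¬ Covered H S) (fun _ S => S) (fun k _ => k)
    ?_ ?_ ?_ ?_ ?_ ?_
  · intro n H k s S h h2 h4
    rw [← h, ← h2, ← h4]
    simp only [Exp.ev, eqExp_ne_zero]
    by_cases h0 : s.reg 27 = 0 <;> simp [h0]
  · simp
  · simp
  · intro n s S hE h
    simp [h]
  · exact fun n => Function.injective_id
  · intro n H F k hF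
    have hind : IsIndependent F k = LocallyCovered H k := by
      ext D
      refine and_congr_right fun _ => ?_
      constructor
      · intro h S hS hk
        by_contra hc
        exact h S ((hF S).2 ⟨hk.le, hk, hc⟩) hS
      · intro h S hS hSD
        exact ((hF S).1 hS).2.2 (h S hSD ((hF S).1 hS).2.1)
    rw [hind]
    exact ⟨fun S hS => ((hF S).1 hS).2.1, fun S => mem_of_maximal_locallyCovered,
      isConformal_iff_locallyCovered⟩

/-- With the covered `k`-sets as edges, the hypercliques are exactly the locally covered sets. -/
theorem conformal_of_maximalHypercliques
    (h : EnumerableWithDelay (fun _ H r => IsUniform H r)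
      (fun _ H r C => Maximal (IsHyperclique H r) C)) :
    DecidableInTime (fun _ H k => IsConformal H k) := by
  refine conformal_of_enumerable h (.cond (.var 27)
      (.cond (.add (.sub (.get 4 (.var 41)) (.var 2)) (.sub (.var 2) (.get 4 (.var 41))))
        (.lit 0) (.lit 1)) (.lit 0)) (.var 2)
    (.var 42) (fun _ H k S => S.card = k ∧ Covered H S) (fun _ S => S) (fun k _ => k)
    ?_ ?_ ?_ ?_ ?_ ?_
  · intro n H k s S h h2 h4
    rw [← h, ← h2, ← h4]
    simp only [Exp.ev, eqExp_ne_zero]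
    by_cases h0 : s.reg 27 = 0 <;> simp [h0]
  · simp
  · simp
  · intro n s S hE h
    simp [h]
  · exact fun n => Function.injective_id
  · intro n H F k hF
    have hcl : IsHyperclique F k = LocallyCovered H k := by
      ext D
      refine and_congr_right fun _ => forall₃_congr fun S _ hk => ?_
      rw [hF]
      exact ⟨fun h => h.2.2, fun h => ⟨hk.le, hk, h⟩⟩
    rw [hcl]
    exact ⟨fun S hS => ((hF S).1 hS).2.1, fun S => mem_of_maximal_locallyCovered,
      isConformal_iff_locallyCovered⟩

/-! ### Enumeration: forbidden and allowed small sets -/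

/-- Split the sets in array `3` with at least `e` vertices: those that belong to the input (or, if
`fl` is false, those that do not) go to array `5`, the others to array `6`. -/
def splitC (fl : Bool) (e : Exp) : Cmd :=
  setC 14 e ;; forC 40 (.var 1) (stoC 10 (.get 2 (.var 40)) (.lit 1)) ;;
  setC 9 (.lit 0) ;; setC 10 (.lit 0) ;;
  forC 41 (.var 8)
    (iteC (.sub (.var 14) (.get 4 (.var 41))) .skip
      (iteC (.cond (.get 10 (.get 3 (.var 41))) (.lit fl.toNat) (.lit (!fl).toNat))
        (stoC 5 (.var 9) (.get 3 (.var 41)) ;; setC 9 (.add (.var 9) (.lit 1)))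
        (stoC 6 (.var 10) (.get 3 (.var 41)) ;; setC 10 (.add (.var 10) (.lit 1)))))

@[simp] theorem mem_wr_splitC (fl : Bool) (e : Exp) (x : ℕ) :
    x ∈ (splitC fl e).wr ↔ x ∈ [9, 10, 14, 40, 41] := by
  simp [splitC]; tauto

@[simp] theorem mem_wa_splitC (fl : Bool) (e : Exp) (a : ℕ) :
    a ∈ (splitC fl e).wa ↔ a ∈ [5, 6, 10] := by
  simp [splitC]; tauto

/-- Array `10` is indexed by codes of sets, so membership in the input is a single lookup. Both
lists can have about `n ^ r` members, and comparing them pairwise would exceed the time bound. -/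
theorem splitC_spec {n q : ℕ} {s : State} {fl : Bool} {e : Exp} {l L : List (Finset (Fin n))}
    (hl : HasList s 2 1 l) (hL : HasSets s L) (hq : e.ev s = q)
    (h10 : ∀ x, s.arr 10 x = 0) :
    Wp (splitC fl e) (l.length + L.length) s fun s' =>
      ∃ F G : List (Finset (Fin n)), HasList s' 5 9 F ∧ HasList s' 6 10 G ∧
        F.length + G.length ≤ L.length ∧ s'.reg 14 = q ∧
        (∀ S, S ∈ F ↔ S ∈ L ∧ q ≤ S.card ∧ (S ∈ l ↔ fl = true)) ∧
        ∀ S, S ∈ G ↔ S ∈ L ∧ q ≤ S.card ∧ ¬ (S ∈ l ↔ fl = true) := by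
  refine wp_set_seq ?_
  refine wp_for_seq (T := 0) (T₂ := L.length) (by simp) l.length (by simp [hl.len])
    (fun j s' => ∀ x, s'.arr 10 x ≠ 0 ↔ ∃ (i : ℕ) (hi : i < l.length), j ≤ i ∧ code l[i] = x)
    ?_ (by simp) ?_ ?_
  · intro x
    simp [h10]
    intro i hi hi'; omega
  · intro j hj s₁ hf₁ hI
    refine wp_sto fun x => ?_
    have h2 : s₁.arr 2 j = code l[j] := by rw [hf₁.arr 2 (by simp)]; exact hl.get j hj
    simp only [Exp.ev, State.setArr_arr, State.setReg_arr, State.setReg_reg, if_true, h2,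
      Function.update_apply]
    split_ifs with h
    · subst h
      simp only [ne_eq, one_ne_zero, not_false_eq_true, true_iff]
      exact ⟨j, hj, le_rfl, rfl⟩
    · rw [hI]
      constructor
      · rintro ⟨i, hi, hji, h'⟩
        exact ⟨i, hi, by omega, h'⟩
      · rintro ⟨i, hi, hji, h'⟩
        rcases hji.eq_or_lt with rfl | hlt
        · exact absurd h'.symm h
        · exact ⟨i, hi, hlt, h'⟩
  intro s₁ hf₁ h10₁
  have hmem (S : Finset (Fin n)) : s₁.arr 10 (code S) ≠ 0 ↔ S ∈ l := by
    rw [h10₁, List.mem_iff_getElem]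
    constructor
    · rintro ⟨i, hi, -, h⟩; exact ⟨i, hi, code_injective h⟩
    · rintro ⟨i, hi, rfl⟩; exact ⟨i, hi, by omega, rfl⟩
  have hL₁ : HasSets s₁ L := by
    refine ⟨(hL.list.setReg _ _ (by simp)).frame hf₁ (by simp) (by simp), ?_⟩
    rw [hf₁.arr 4 (by simp)]
    exact hL.size
  have h14 : s₁.reg 14 = q := by rw [hf₁.reg 14 (by simp)]; simp [hq]
  refine wp_set_seq (wp_set_seq ?_)
  refine (wp_for (T := 0) (by simp) L.length (by simp [hL₁.list.len]) (fun j s' =>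
    ∃ F G : List (Finset (Fin n)), HasList s' 5 9 F ∧ HasList s' 6 10 G ∧
        F.length + G.length + j ≤ L.length ∧
        (∀ S, S ∈ F ↔ ∃ (i : ℕ) (hi : i < L.length), j ≤ i ∧ L[i] = S ∧ q ≤ S.card ∧
          (S ∈ l ↔ fl = true)) ∧
        ∀ S, S ∈ G ↔ ∃ (i : ℕ) (hi : i < L.length), j ≤ i ∧ L[i] = S ∧ q ≤ S.card ∧
          ¬ (S ∈ l ↔ fl = true)) ?_ ?_ ?_).mono (by simp) fun _ h => h
  · refine ⟨[], [], .nil (by simp), .nil (by simp), by simp, fun S => ?_, fun S => ?_⟩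
    · simp
      intro i hi hi'; omega
    · simp
      intro i hi hi'; omega
  · rintro j hj s₂ hf₂ ⟨F, G, hF, hG, hlen, hFm, hGm⟩
    have h3 : s₂.arr 3 j = code L[j] := by rw [hf₂.arr 3 (by simp)]; exact hL₁.list.get j hj
    have h4 : s₂.arr 4 j = L[j].card := by rw [hf₂.arr 4 (by simp)]; exact hL₁.size j hj
    have h10₂ : s₂.arr 10 (code L[j]) ≠ 0 ↔ L[j] ∈ l := by
      rw [hf₂.arr 10 (by simp)]; exact hmem _
    have h14₂ : s₂.reg 14 = q := by rw [hf₂.reg 14 (by simp)]; simpa using h14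
    have step (P : Finset (Fin n) → Prop) (X : List (Finset (Fin n)))
        (hX : ∀ S, S ∈ X ↔ ∃ (i : ℕ) (hi : i < L.length), j + 1 ≤ i ∧ L[i] = S ∧ P S) :
        (P L[j] → ∀ S, S ∈ X ++ [L[j]] ↔ ∃ (i : ℕ) (hi : i < L.length), j ≤ i ∧ L[i] = S ∧ P S) ∧
        (¬ P L[j] → ∀ S, S ∈ X ↔ ∃ (i : ℕ) (hi : i < L.length), j ≤ i ∧ L[i] = S ∧ P S) := by
      have aux (S : Finset (Fin n)) : (∃ (i : ℕ) (hi : i < L.length), j ≤ i ∧ L[i] = S ∧ P S) ↔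
          S ∈ X ∨ (S = L[j] ∧ P S) := by
        rw [hX]
        constructor
        · rintro ⟨i, hi, hji, h, h'⟩
          rcases hji.eq_or_lt with rfl | hlt
          · exact .inr ⟨h.symm, h'⟩
          · exact .inl ⟨i, hi, hlt, h, h'⟩
        · rintro (⟨i, hi, hji, h⟩ | ⟨rfl, h⟩)
          · exact ⟨i, hi, by omega, h⟩
          · exact ⟨j, hj, le_rfl, rfl, h⟩
      refine ⟨fun hP S => ?_, fun hP S => ?_⟩
      · rw [aux, List.mem_append, List.mem_singleton]
        exact or_congr_right ⟨fun h => ⟨h, h ▸ hP⟩, fun h => h.1⟩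
      · rw [aux]
        exact ⟨.inl, fun h => h.resolve_right fun h' => hP (h'.1 ▸ h'.2)⟩
    have hF' := step _ F hFm
    have hG' := step _ G hGm
    have hcond : Exp.ev (s₂.setReg 41 j)
        (.cond (.get 10 (.get 3 (.var 41))) (.lit fl.toNat) (.lit (!fl).toNat)) ≠ 0 ↔
        (L[j] ∈ l ↔ fl = true) := by
      simp only [Exp.ev, State.setReg_arr, State.setReg_reg, if_true, h3, ← h10₂]
      cases fl <;> by_cases h : s₂.arr 10 (code L[j]) = 0 <;> simp [h]
    have hF₂ : HasList (s₂.setReg 41 j) 5 9 F := hF.setReg _ _ (by simp)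
    have hG₂ : HasList (s₂.setReg 41 j) 6 10 G := hG.setReg _ _ (by simp)
    refine wp_ite (fun h => wp_skip ?_) fun h => wp_ite (fun h' => ?_) fun h' => ?_
    · have hlt : ¬ q ≤ L[j].card := by simp [h14₂, h4] at h; omega
      exact ⟨F, G, hF₂, hG₂, by omega, hF'.2 fun h => hlt h.1, hG'.2 fun h => hlt h.1⟩
    · have hle : q ≤ L[j].card := by simp [h14₂, h4] at h; omega
      rw [hcond] at h'
      refine wp_sto_seq (wp_set ⟨F ++ [L[j]], G, ?_, ?_, by simp; omega, hF'.1 ⟨hle, h'⟩,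
        hG'.2 fun h => h.2 h'⟩)
      · exact hF₂.push (by simp) (by simp [h3])
      · exact (hG₂.setArr _ _ _ (by simp)).setReg _ _ (by simp)
    · have hle : q ≤ L[j].card := by simp [h14₂, h4] at h; omega
      have h'' : ¬ (L[j] ∈ l ↔ fl = true) := fun hc => hcond.2 hc h'
      refine wp_sto_seq (wp_set ⟨F, G ++ [L[j]], ?_, ?_, by simp; omega,
        hF'.2 fun h => h'' h.2, hG'.1 ⟨hle, h''⟩⟩)
      · exact (hF₂.setArr _ _ _ (by simp)).setReg _ _ (by simp)
      · exact hG₂.push (by simp) (by simp [h3])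
  · rintro s₂ hf₂ ⟨F, G, hF, hG, hlen, hFm, hGm⟩
    refine ⟨F, G, hF, hG, by omega, ?_, fun S => ?_, fun S => ?_⟩
    · rw [hf₂.reg 14 (by simp)]; simpa using h14
    · rw [hFm, List.mem_iff_getElem (l := L)]
      constructor
      · rintro ⟨i, hi, -, h, h'⟩; exact ⟨⟨i, hi, h⟩, h'⟩
      · rintro ⟨⟨i, hi, h⟩, h'⟩; exact ⟨i, hi, by omega, h, h'⟩
    · rw [hGm, List.mem_iff_getElem (l := L)]
      constructor
      · rintro ⟨i, hi, -, h, h'⟩; exact ⟨⟨i, hi, h⟩, h'⟩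
      · rintro ⟨⟨i, hi, h⟩, h'⟩; exact ⟨i, hi, by omega, h, h'⟩

/-- The memory between two steps of the enumeration, after the solutions in `C` have been found. -/
structure Ctx (A : Cmd) {n : ℕ} (F G : List (Finset (Fin n))) (q r : ℕ)
    (C : List (Finset (Fin n))) (s : State) : Prop where
  env : Env n s
  par : s.reg 2 = r
  min : s.reg 14 = q
  forb : HasList s 5 9 F
  cand : HasList s 6 10 G
  found : HasList s 7 11 C
  fresh : Fresh A s
  seen : ∀ x, s.arr 9 x ≤ s.reg 13

theorem Ctx.frame {A : Cmd} {n : ℕ} {F G C : List (Finset (Fin n))} {q r : ℕ} {R B : List ℕ}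
    {s s' : State} (h : Ctx A F G q r C s) (hf : Frame R B s s') (hR : ∀ x ∈ R, 20 ≤ x ∧ x < 100)
    (hB : ∀ a ∈ B, a = 8) : Ctx A F G q r C s' := by
  have hr (x : ℕ) (hx : x < 20) : x ∉ R := fun h => by have := hR x h; omega
  have ha (a : ℕ) (ha : a ≠ 8) : a ∉ B := fun h => ha (hB a h)
  refine ⟨h.env.frame hf (hr _ (by simp)) (hr _ (by simp)) (ha _ (by simp)), ?_, ?_,
    h.forb.frame hf (hr _ (by simp)) (ha _ (by simp)),
    h.cand.frame hf (hr _ (by simp)) (ha _ (by simp)),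
    h.found.frame hf (hr _ (by simp)) (ha _ (by simp)),
    h.fresh.frame hf (fun x hx => by have := hR x hx; omega)
      (fun a h => by have := hB a h; omega), ?_⟩
  · rw [hf.reg _ (hr _ (by simp)), h.par]
  · rw [hf.reg _ (hr _ (by simp)), h.min]
  · rw [hf.reg _ (hr _ (by simp)), hf.arr _ (ha _ (by simp))]; exact h.seen

theorem Ctx.setReg {A : Cmd} {n : ℕ} {F G C : List (Finset (Fin n))} {q r : ℕ}
    {s : State} (h : Ctx A F G q r C s) (x v : ℕ) (hx : 20 ≤ x) (hx' : x < 100) :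
    Ctx A F G q r C (s.setReg x v) := by
  refine h.frame (R := [x]) (B := []) ⟨fun y hy => ?_, fun _ _ => rfl⟩ (by simp [*]) (by simp)
  simp at hy
  simp [hy]

/-! ### Enumeration: small uncovered sets -/

/-- The candidates for a new solution among the small sets. -/
def Candidate {n : ℕ} (q : ℕ) (C : FinHypergraph n) (S : Finset (Fin n)) : Prop :=
  ¬ Covered C S ∧ (q = 0 → ∀ v ∈ S, Covered C (S.erase v))

/-- Search a candidate in array `6`; register `41` tells whether there is one, and register `46`
gets its code. -/
def searchC : Cmd :=
  setC 41 (.lit 0) ;;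
  forC 42 (.var 10)
    (setC 43 (.get 6 (.var 42)) ;; anyC false 7 11 (.var 43) ;;
     iteC (.var 27) .skip
      (setC 44 (.lit 1) ;;
       iteC (.var 14) .skip
        (forC 45 (.var 0)
          (subC (.get 1 (.var 45)) (.var 43) ;;
           iteC (.var 25)
            (anyC false 7 11 (.sub (.var 43) (.get 1 (.var 45))) ;;
             setC 44 (.cond (.var 27) (.var 44) (.lit 0)))
            .skip)) ;;
       iteC (.var 44) (setC 41 (.lit 1) ;; setC 46 (.var 43)) .skip))

@[simp] theorem mem_wr_searchC (x : ℕ) : x ∈ searchC.wr ↔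
    x ∈ [20, 21, 22, 23, 24, 25, 26, 27, 28, 41, 42, 43, 44, 45, 46] := by
  simp [searchC]; tauto

@[simp] theorem wa_searchC : searchC.wa = [] := by simp [searchC]

/-- A bound for the number of loop iterations of `searchC`. -/
def searchT (n i g : ℕ) : ℕ := g * (i * (n + 1) + n * (n + i * (n + 1) + 1) + 1)

/-- Exhaustive search is affordable here: each set of `G`, and for `q = 0` each of its one-vertex
deletions, is compared only with the solutions found so far. -/
theorem searchC_spec {A : Cmd} {n : ℕ} {F G C : List (Finset (Fin n))} {q r : ℕ} {s : State}
    (h : Ctx A F G q r C s) :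
    Wp searchC (searchT n C.length G.length) s fun s' =>
      (s'.reg 41 ≠ 0 → ∃ S ∈ G, s'.reg 46 = code S ∧ Candidate q C.toFinset S) ∧
      (s'.reg 41 = 0 → ∀ S ∈ G, ¬ Candidate q C.toFinset S) := by
  refine wp_set_seq ?_
  refine wp_for (by simp) G.length (by simp [h.cand.len]) (fun j s' =>
    (s'.reg 41 ≠ 0 → ∃ S ∈ G, s'.reg 46 = code S ∧ Candidate q C.toFinset S) ∧
      (s'.reg 41 = 0 → ∀ i (hi : i < G.length), j ≤ i → ¬ Candidate q C.toFinset G[i]))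
    ?_ ?_ ?_
  · simp
    intro i hi hi'; omega
  · rintro j hj s₁ hf₁ ⟨hI₁, hI₂⟩
    have hc₁ : Ctx A F G q r C s₁ := (h.setReg _ _ (by simp) (by simp)).frame hf₁ (by simp; omega)
      (by simp)
    have hskip (s' : State) (h41 : s'.reg 41 = s₁.reg 41) (h46 : s'.reg 46 = s₁.reg 46)
        (hnc : ¬ Candidate q C.toFinset G[j]) :
        (s'.reg 41 ≠ 0 → ∃ S ∈ G, s'.reg 46 = code S ∧ Candidate q C.toFinset S) ∧
        (s'.reg 41 = 0 → ∀ i (hi : i < G.length), j ≤ i → ¬ Candidate q C.toFinset G[i]) := by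
      rw [h41, h46]
      refine ⟨hI₁, fun h0 i hi hji => ?_⟩
      rcases hji.eq_or_lt with rfl | hlt
      exacts [hnc, hI₂ h0 i hi hlt]
    have h6 : s₁.arr 6 j = code G[j] := hc₁.cand.get j hj
    refine wp_set_seq ?_
    have hc₂ := (hc₁.setReg 42 j (by simp) (by simp)).setReg 43
      (Exp.ev (s₁.setReg 42 j) (.get 6 (.var 42))) (by simp) (by simp)
    refine (anyC_spec hc₂.env false hc₂.found (by simp) G[j] (by simp [h6])).call_seq
      (n * (n + C.length * (n + 1) + 1)) le_rfl fun s₂ hf₂ h27 => ?_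
    replace h27 : s₂.reg 27 ≠ 0 ↔ Covered C.toFinset G[j] := by rw [h27]; simp [Covered]
    have hc₃ : Ctx A F G q r C s₂ := hc₂.frame hf₂ (by simp) (by simp)
    have h41₂ : s₂.reg 41 = s₁.reg 41 := by rw [hf₂.reg 41 (by simp)]; simp
    have h46₂ : s₂.reg 46 = s₁.reg 46 := by rw [hf₂.reg 46 (by simp)]; simp
    have h43₂ : s₂.reg 43 = code G[j] := by rw [hf₂.reg 43 (by simp)]; simp [h6]
    refine wp_ite (fun h => wp_skip (hskip _ h41₂ h46₂ fun hcd => hcd.1 (h27.1 h))) fun h => ?_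
    have hnc : ¬ Covered C.toFinset G[j] := fun hcov => h27.2 hcov h
    have last (s' : State) (h41 : s'.reg 41 = s₁.reg 41) (h46 : s'.reg 46 = s₁.reg 46)
        (h43 : s'.reg 43 = code G[j])
        (h44 : s'.reg 44 ≠ 0 ↔ (q = 0 → ∀ v ∈ G[j], Covered C.toFinset (G[j].erase v))) :
        Wp (iteC (.var 44) (setC 41 (.lit 1) ;; setC 46 (.var 43)) .skip) 0 s' fun s' =>
          (s'.reg 41 ≠ 0 → ∃ S ∈ G, s'.reg 46 = code S ∧ Candidate q C.toFinset S) ∧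
          (s'.reg 41 = 0 → ∀ i (hi : i < G.length), j ≤ i → ¬ Candidate q C.toFinset G[i]) := by
      refine wp_ite (fun h' => wp_set_seq (wp_set ⟨fun _ => ?_, by simp⟩)) fun h' => wp_skip ?_
      · exact ⟨G[j], List.getElem_mem _, by simp [h43], hnc, h44.1 h'⟩
      · exact hskip _ h41 h46 fun hcd => h44.2 hcd.2 h'
    refine wp_set_seq (Wp.ite_seq (fun h14 => Wp.skip_seq ?_) fun h14 => ?_)
    · refine (last _ (by simp [h41₂]) (by simp [h46₂]) (by simp [h43₂]) ?_).mono (by simp)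
        fun _ h => h
      have : q ≠ 0 := by simpa [hc₃.min] using h14
      simp [this]
    have hq : q = 0 := by simpa [hc₃.min] using h14
    have hc₄ := hc₃.setReg 44 (Exp.ev s₂ (.lit 1)) (by simp) (by simp)
    refine wp_for_seq (T := n + C.length * (n + 1)) (T₂ := 0) (by simp) n (by simp [hc₃.env.size])
      (fun v s' => s'.reg 44 ≠ 0 ↔ ∀ u ∈ G[j], v ≤ (u : ℕ) → Covered C.toFinset (G[j].erase u))
      (by simp) le_rfl ?_ ?_
    · rintro v hv s₃ hf₃ h44
      have hc₅ := (hc₄.frame hf₃ (by simp; omega) (by simp)).setReg 45 v (by simp) (by simp)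
      have h1 : s₃.arr 1 v = 2 ^ v := hc₅.env.pow v hv
      have h43₃ : s₃.reg 43 = code G[j] := by rw [hf₃.reg 43 (by simp)]; simp [h43₂]
      have split (P : Fin n → Prop) : (∀ u ∈ G[j], v ≤ (u : ℕ) → P u) ↔
          ((⟨v, hv⟩ : Fin n) ∈ G[j] → P ⟨v, hv⟩) ∧ ∀ u ∈ G[j], v + 1 ≤ (u : ℕ) → P u := by
        constructor
        · exact fun h => ⟨fun h' => h _ h' le_rfl, fun u hu h' => h u hu (by omega)⟩
        · rintro ⟨h, h'⟩ u hu hvu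
          rcases hvu.eq_or_lt with h0 | h0
          · subst h0; exact h hu
          · exact h' u hu h0
      refine (subC_spec hc₅.env {⟨v, hv⟩} G[j] (by simp [h1]) (by simp [h43₃])).call_seq
        (C.length * (n + 1)) le_rfl fun s₄ hf₄ h25 => ?_
      have hc₆ := hc₅.frame hf₄ (by simp) (by simp)
      have h43₄ : s₄.reg 43 = code G[j] := by rw [hf₄.reg 43 (by simp)]; simp [h43₃]
      have h44₄ : s₄.reg 44 = s₃.reg 44 := by rw [hf₄.reg 44 (by simp)]; simp
      have h45₄ : s₄.reg 45 = v := by rw [hf₄.reg 45 (by simp)]; simp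
      have h1₄ : s₄.arr 1 v = 2 ^ v := hc₆.env.pow v hv
      rw [split]
      refine wp_ite (fun h' => ?_) fun h' => wp_skip ?_
      · have hmem : (⟨v, hv⟩ : Fin n) ∈ G[j] := by
          by_contra hm; simp [h25, hm] at h'
        refine (anyC_spec hc₆.env false hc₆.found (by simp) (G[j].erase ⟨v, hv⟩)
          (by simp [h43₄, h45₄, h1₄, code_erase hmem])).call_seq 0 le_rfl fun s₅ hf₅ h27' => wp_set ?_
        have h44₅ : s₅.reg 44 = s₃.reg 44 := by rw [hf₅.reg 44 (by simp), h44₄]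
        have h27'' : s₅.reg 27 ≠ 0 ↔ Covered C.toFinset (G[j].erase ⟨v, hv⟩) := by
          rw [h27']; simp [Covered]
        rw [← h44, ← h27'']
        by_cases h0 : s₅.reg 27 = 0 <;> simp [h0, h44₅, hmem]
      · have hmem : (⟨v, hv⟩ : Fin n) ∉ G[j] := by
          intro hm; simp [h25, hm] at h'
        rw [h44₄, h44]
        simp [hmem]
    · rintro s₃ hf₃ h44
      refine last _ ?_ ?_ ?_ ?_
      · rw [hf₃.reg 41 (by simp)]; simp [h41₂]
      · rw [hf₃.reg 46 (by simp)]; simp [h46₂]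
      · rw [hf₃.reg 43 (by simp)]; simp [h43₂]
      · rw [h44]; simp [hq]
  · rintro s₁ hf₁ ⟨h1, h2⟩
    refine ⟨h1, fun h0 S hS => ?_⟩
    obtain ⟨i, hi, rfl⟩ := List.mem_iff_getElem.1 hS
    exact h2 h0 i hi (by omega)

/-! ### Enumeration: violating sets by self-reduction -/

/-- Put the union of the set number `52` in array `7` and the set in register `49` into
register `53`. -/
def unionC : Cmd :=
  setC 53 (.get 7 (.var 52)) ;;
  forC 54 (.var 0)
    (subC (.get 1 (.var 54)) (.var 49) ;;
     iteC (.var 25)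
      (subC (.get 1 (.var 54)) (.var 53) ;;
       setC 53 (.add (.var 53) (.cond (.var 25) (.lit 0) (.get 1 (.var 54)))))
      .skip)

@[simp] theorem mem_wr_unionC (x : ℕ) :
    x ∈ unionC.wr ↔ x ∈ [20, 21, 22, 23, 24, 25, 53, 54] := by
  simp [unionC]; tauto

@[simp] theorem wa_unionC : unionC.wa = [] := by simp [unionC]

theorem filter_ge_succ {n v : ℕ} (hv : v < n) (W : Finset (Fin n)) :
    W.filter (fun u : Fin n => v ≤ (u : ℕ)) = if (⟨v, hv⟩ : Fin n) ∈ W then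
      insert ⟨v, hv⟩ (W.filter fun u : Fin n => v + 1 ≤ (u : ℕ)) else
      W.filter fun u : Fin n => v + 1 ≤ (u : ℕ) := by
  split_ifs with h
  · ext u
    simp only [Finset.mem_filter, Finset.mem_insert, Fin.ext_iff]
    constructor
    · intro h; have := h.2; grind
    · rintro (h' | h')
      · rw [show u = ⟨v, hv⟩ from Fin.ext h']; exact ⟨h, by simp⟩
      · exact ⟨h'.1, by omega⟩
  · ext u
    simp only [Finset.mem_filter]
    constructor
    · intro h'
      refine ⟨h'.1, ?_⟩
      have : (u : ℕ) ≠ v := by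
        rintro rfl
        exact h h'.1
      omega
    · exact fun h' => ⟨h'.1, by omega⟩

theorem unionC_spec {n : ℕ} {s : State} (hE : Env n s) (S W : Finset (Fin n))
    (hS : s.arr 7 (s.reg 52) = code S) (hW : s.reg 49 = code W) :
    Wp unionC (n * (n + n + 1)) s fun s' => s'.reg 53 = code (S ∪ W) := by
  refine wp_set_seq ?_
  refine wp_for (by simp) n (by simp [hE.size])
    (fun v s' => s'.reg 53 = code (S ∪ W.filter fun u : Fin n => v ≤ (u : ℕ))) ?_ ?_ ?_
  · rw [high_self]
    simp [hS]
  · intro v hv s₁ hf₁ h53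
    have hE₁ : Env n (s₁.setReg 54 v) := Env.setReg (Env.frame (hE.setReg 53 _ (by simp)
      (by simp)) hf₁ (by simp) (by simp) (by simp)) _ _ (by simp) (by simp)
    have h1 : s₁.arr 1 v = 2 ^ v := hE₁.pow v hv
    have h49 : s₁.reg 49 = code W := by rw [hf₁.reg 49 (by simp)]; simp [hW]
    refine (subC_spec hE₁ {⟨v, hv⟩} W (by simp [h1]) (by simp [h49])).call_seq n le_rfl
      fun s₂ hf₂ h25 => ?_
    have hE₂ : Env n s₂ := hE₁.frame hf₂ (by simp) (by simp) (by simp)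
    have h53₂ : s₂.reg 53 = s₁.reg 53 := by rw [hf₂.reg 53 (by simp)]; simp
    have h54₂ : s₂.reg 54 = v := by rw [hf₂.reg 54 (by simp)]; simp
    rw [filter_ge_succ hv]
    refine wp_ite (fun h => ?_) fun h => wp_skip ?_
    · have hm : (⟨v, hv⟩ : Fin n) ∈ W := by
        by_contra hm; simp [h25, hm] at h
      rw [if_pos hm, Finset.union_insert]
      refine (subC_spec hE₂ {⟨v, hv⟩} (S ∪ W.filter fun u : Fin n => v + 1 ≤ (u : ℕ))
        (by simp [h54₂, hE₂.pow v hv]) (by simp [h53₂, h53])).call_seq 0 le_rfl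
        fun s₃ hf₃ h25' => wp_set ?_
      have h53₃ : s₃.reg 53 = s₁.reg 53 := by rw [hf₃.reg 53 (by simp), h53₂]
      have h54₃ : s₃.reg 54 = v := by rw [hf₃.reg 54 (by simp), h54₂]
      have h1₃ : s₃.arr 1 v = 2 ^ v := by rw [hf₃.arr 1 (by simp), hE₂.pow v hv]
      by_cases hin : (⟨v, hv⟩ : Fin n) ∈ S ∪ W.filter fun u : Fin n => v + 1 ≤ (u : ℕ)
      · rw [Finset.insert_eq_of_mem hin]
        simp only [Exp.ev, State.setReg_reg, if_true, h53₃, h53, h25',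
          Finset.singleton_subset_iff, hin]
        simp
      · rw [code_insert hin]
        simp only [Exp.ev, State.setReg_reg, if_true, h53₃, h53, h25', h54₃, h1₃,
          Finset.singleton_subset_iff, hin, if_false]
    · have hm : (⟨v, hv⟩ : Fin n) ∉ W := by
        intro hm; simp [h25, hm] at h
      rw [if_neg hm, h53₂, h53]
  · intro s₁ _ h
    rwa [high_zero] at h

/-- List the unions of the sets in array `7` with the set in register `49`, without repetitions,
in array `8`. -/
def dedupC : Cmd :=
  setC 13 (.add (.var 13) (.lit 1)) ;; setC 12 (.lit 0) ;;
  forC 52 (.var 11)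
    (unionC ;;
     iteC (.sub (.var 13) (.get 9 (.var 53)))
      (stoC 9 (.var 53) (.var 13) ;; stoC 8 (.var 12) (.var 53) ;;
       setC 12 (.add (.var 12) (.lit 1)))
      .skip)

@[simp] theorem mem_wr_dedupC (x : ℕ) :
    x ∈ dedupC.wr ↔ x ∈ [12, 13, 20, 21, 22, 23, 24, 25, 52, 53, 54] := by
  simp [dedupC]; tauto

/-- Entry `code S` of array `9` holds the number of the last round in which `S` occurred, and
register `13` the current round. Increasing the latter invalidates all old marks, so the array need
not be reset. -/
theorem dedupC_spec {A : Cmd} {n : ℕ} {F G C : List (Finset (Fin n))} {q r : ℕ} {s : State}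
    (h : Ctx A F G q r C s) {W : Finset (Fin n)} (hW : s.reg 49 = code W) :
    Wp dedupC (C.length * (n * (n + n + 1) + 1)) s fun s' => Ctx A F G q r C s' ∧
      ∃ D : List (Finset (Fin n)), HasList s' 8 12 D ∧ D.Nodup ∧ D.length ≤ C.length ∧
        D.toFinset = C.toFinset.image (· ∪ W) := by
  refine wp_set_seq (wp_set_seq ?_)
  refine wp_for (by simp) C.length (by simp [h.found.len]) (fun j s' =>
    (∀ x, s'.arr 9 x ≤ s'.reg 13) ∧ ∃ D : List (Finset (Fin n)), HasList s' 8 12 D ∧ D.Nodup ∧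
      D.length + j ≤ C.length ∧
      (∀ S, S ∈ D ↔ ∃ (i : ℕ) (hi : i < C.length), j ≤ i ∧ C[i] ∪ W = S) ∧
      ∀ S : Finset (Fin n), s'.arr 9 (code S) = s'.reg 13 ↔ S ∈ D) ?_ ?_ ?_
  · refine ⟨fun x => ?_, [], .nil (by simp), by simp, by simp, fun S => ?_, fun S => ?_⟩
    · have := h.seen x
      simp; omega
    · simp
      intro i hi hi'; omega
    · have := h.seen (code S)
      simp; omega
  · rintro j hj s₁ hf₁ ⟨h9, D, hD, hDn, hDl, hDm, hDs⟩
    have hE₁ : Env n (s₁.setReg 52 j) := Env.setReg (Env.frame ((h.env.setReg _ _ (by simp)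
      (by simp)).setReg _ _ (by simp) (by simp)) hf₁ (by simp) (by simp) (by simp)) _ _ (by simp)
      (by simp)
    have h7 : s₁.arr 7 j = code C[j] := by rw [hf₁.arr 7 (by simp)]; exact h.found.get j hj
    have h49 : s₁.reg 49 = code W := by rw [hf₁.reg 49 (by simp)]; simp [hW]
    refine (unionC_spec hE₁ C[j] W (by simp [h7]) (by simp [h49])).call_seq 0 le_rfl
      fun s₂ hf₂ h53 => ?_
    have h13 : s₂.reg 13 = s₁.reg 13 := by rw [hf₂.reg 13 (by simp)]; simp
    have h9₂ : s₂.arr 9 = s₁.arr 9 := by rw [hf₂.arr 9 (by simp)]; simp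
    have hD₂ : HasList s₂ 8 12 D := (hD.setReg _ _ (by simp)).frame hf₂ (by simp) (by simp)
    have hin := hDs (C[j] ∪ W)
    have hle := h9 (code (C[j] ∪ W))
    have split (S : Finset (Fin n)) : (∃ (i : ℕ) (hi : i < C.length), j ≤ i ∧ C[i] ∪ W = S) ↔
        S ∈ D ∨ S = C[j] ∪ W := by
      rw [hDm]
      constructor
      · rintro ⟨i, hi, hji, h⟩
        rcases hji.eq_or_lt with rfl | hlt
        · exact .inr h.symm
        · exact .inl ⟨i, hi, hlt, h⟩
      · rintro (⟨i, hi, hji, h⟩ | rfl)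
        · exact ⟨i, hi, by omega, h⟩
        · exact ⟨j, hj, le_rfl, rfl⟩
    refine wp_ite (fun h' => ?_) fun h' => wp_skip ?_
    · simp only [Exp.ev, h13, h9₂, h53] at h'
      have hnot : C[j] ∪ W ∉ D := fun hm => by rw [← hin] at hm; omega
      refine wp_sto_seq (wp_sto_seq (wp_set ⟨fun x => ?_, D ++ [C[j] ∪ W], ?_, ?_, by simp; omega,
        fun S => ?_, fun S => ?_⟩))
      · simp only [Exp.ev, State.setReg_reg, State.setReg_arr, State.setArr_reg,
          State.setArr_arr, Nat.reduceEqDiff, if_true, if_false, Function.update_apply, h9₂, h13]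
        split_ifs
        exacts [le_rfl, h9 x]
      · exact (hD₂.setArr 9 (s₂.reg 53) (s₂.reg 13) (by simp)).push (by simp) (by simp [h53])
      · rw [List.nodup_append]
        refine ⟨hDn, by simp, ?_⟩
        rintro S hS T hT rfl
        rw [List.mem_singleton.1 hT] at hS
        exact hnot hS
      · rw [split]; simp
      · simp only [Exp.ev, State.setReg_reg, State.setReg_arr, State.setArr_reg,
          State.setArr_arr, Nat.reduceEqDiff, if_true, if_false, Function.update_apply, h9₂, h13,
          h53, code_inj]
        rw [List.mem_append, List.mem_singleton, ← hDs]
        by_cases hS : S = C[j] ∪ W <;> simp [hS]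
    · simp only [Exp.ev, h13, h9₂, h53] at h'
      have hin' : C[j] ∪ W ∈ D := hin.1 (by omega)
      refine ⟨fun x => ?_, D, hD₂, hDn, by omega, fun S => ?_, fun S => ?_⟩
      · rw [h9₂, h13]; exact h9 x
      · rw [split]
        exact ⟨.inl, fun h => h.elim id fun h => h ▸ hin'⟩
      · rw [h9₂, h13]; exact hDs S
  · rintro s₁ hf₁ ⟨h9, D, hD, hDn, hDl, hDm, hDs⟩
    refine ⟨⟨?_, ?_, ?_, ?_, ?_, ?_, ?_, h9⟩, D, hD, hDn, by omega, ?_⟩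
    · exact Env.frame ((h.env.setReg _ _ (by simp) (by simp)).setReg _ _ (by simp) (by simp)) hf₁
        (by simp) (by simp) (by simp)
    · rw [hf₁.reg 2 (by simp)]; simp [h.par]
    · rw [hf₁.reg 14 (by simp)]; simp [h.min]
    · exact HasList.frame ((h.forb.setReg _ _ (by simp)).setReg _ _ (by simp)) hf₁ (by simp)
        (by simp)
    · exact HasList.frame ((h.cand.setReg _ _ (by simp)).setReg _ _ (by simp)) hf₁ (by simp)
        (by simp)
    · exact HasList.frame ((h.found.setReg _ _ (by simp)).setReg _ _ (by simp)) hf₁ (by simp)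
        (by simp)
    · exact Fresh.frame ((h.fresh.setReg _ _ (by simp) (by simp) (by simp)).setReg _ _ (by simp)
        (by simp) (by simp)) hf₁ (by simp; omega) (by simp)
    · ext S
      rw [List.mem_toFinset, hDm, Finset.mem_image]
      constructor
      · rintro ⟨i, hi, -, rfl⟩
        exact ⟨C[i], List.mem_toFinset.2 (List.getElem_mem _), rfl⟩
      · rintro ⟨S', hS', rfl⟩
        obtain ⟨i, hi, rfl⟩ := List.mem_iff_getElem.1 (List.mem_toFinset.1 hS')
        exact ⟨i, hi, by omega, rfl⟩

theorem covered_image_union {n : ℕ} {H : FinHypergraph n} {W S : Finset (Fin n)} :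
    Covered (H.image (· ∪ W)) S ↔ Covered H (S \ W) := by
  simp only [Covered, Finset.mem_image, exists_exists_and_eq_and]
  refine exists_congr fun E => and_congr_right fun _ => ?_
  rw [Finset.union_comm]
  exact sdiff_le_iff.symm

/-- In the enlarged hypergraph a set is covered iff its part outside `W` was covered before. So
removing `W` from a violating set leaves one for `H`, while a violating set of `H` disjoint from `W`
stays violating. The number of edges does not grow. -/
theorem isConformal_image_union {n : ℕ} {H : FinHypergraph n} {W : Finset (Fin n)} {k : ℕ} :
    IsConformal (H.image (· ∪ W)) k ↔ ¬ ∃ S, Violates H k S ∧ Disjoint S W := by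
  rw [isConformal_iff]
  refine not_congr ⟨?_, ?_⟩
  · rintro ⟨S, hS, hS'⟩
    refine ⟨S \ W, ⟨covered_image_union.not.1 hS, fun T hT hTk => ?_⟩, Finset.sdiff_disjoint⟩
    have := covered_image_union.1 (hS' T (hT.trans Finset.sdiff_subset) hTk)
    rwa [Finset.sdiff_eq_self_of_disjoint (Finset.sdiff_disjoint.mono_left hT)] at this
  · rintro ⟨S, ⟨hS, hS'⟩, hd⟩
    refine ⟨S, ?_, fun T hT hTk => covered_image_union.2 ((hS' T hT hTk).mono Finset.sdiff_subset)⟩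
    rw [covered_image_union, Finset.sdiff_eq_self_of_disjoint hd]
    exact hS

/-- The program `A` decides `r`-conformality of all hypergraphs on `n` vertices with at most `i`
edges in time `B`. -/
def Oracle (A : Cmd) (n r i B : ℕ) : Prop :=
  ∀ D : List (Finset (Fin n)), D.Nodup → D.length ≤ i → ∃ t s, Run A (encode D r) t s ∧
    (s.reg 0 ≠ 0 ↔ IsConformal D.toFinset r) ∧ t.length ≤ B

/-- Test whether every violating set of the hypergraph in array `7` meets the set in
register `49`. -/
def testC (A : Cmd) : Cmd := dedupC ;; callC A 8 12 (.var 2)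

theorem wr_testC (A : Cmd) (x : ℕ) (h : x ∈ (testC A).wr) :
    100 ≤ x ∨ x ∈ [3, 4, 6, 12, 13, 20, 21, 22, 23, 24, 25, 31, 32, 33, 34, 35, 52, 53, 54] := by
  simp only [testC, wr_seq, List.mem_append] at h
  rcases h with h | h
  · simp at h ⊢; omega
  · have := wr_callC _ _ _ _ _ h
    simp [feedRegs] at this ⊢; omega

/-- A bound for the number of loop iterations of `testC`. -/
def testT (n i B : ℕ) : ℕ := i * (n * (n + n + 1) + 1) + (feedT n i + B)

theorem testC_spec {A : Cmd} {n : ℕ} {F G C : List (Finset (Fin n))} {q r B : ℕ} {s : State}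
    (h : Ctx A F G q r C s) (hA : Oracle A n r C.length B) {W : Finset (Fin n)}
    (hW : s.reg 49 = code W) :
    Wp (testC A) (testT n C.length B) s fun s' => Ctx A F G q r C s' ∧
      (∀ x, 40 ≤ x → x < 52 → s'.reg x = s.reg x) ∧
      (s'.reg 100 = 0 ↔ ∃ S, Violates C.toFinset r S ∧ Disjoint S W) := by
  have key : Wp (testC A) (testT n C.length B) s fun s' => Ctx A F G q r C s' ∧
      (s'.reg 100 = 0 ↔ ∃ S, Violates C.toFinset r S ∧ Disjoint S W) := by
    refine (dedupC_spec h hW).call_seq _ le_rfl fun s₁ hf₁ ⟨hc₁, D, hD, hDn, hDl, hDC⟩ => ?_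
    obtain ⟨t, u, hr, hu, ht⟩ := hA D hDn hDl
    have h2 : (Exp.var 2).ev s₁ = r := hc₁.par
    refine (callC_spec hc₁.env hD hc₁.fresh (by simp) (by simp) (by simp) (by simp)
      (e := .var 2) (h2 ▸ hr)).mono ?_ fun s₂ ⟨h100, hF, hreg, harr⟩ => ?_
    · refine add_le_add ?_ ht
      unfold feedT
      gcongr
    refine ⟨⟨⟨?_, ?_, ?_⟩, ?_, ?_, ⟨?_, ?_⟩, ⟨?_, ?_⟩, ⟨?_, ?_⟩, hF, ?_⟩, ?_⟩
    · rw [hreg _ (by simp) (by simp [feedRegs]), hc₁.env.size]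
    · rw [hreg _ (by simp) (by simp [feedRegs]), hc₁.env.full]
    · rw [harr _ (by simp)]; exact hc₁.env.pow
    · rw [hreg _ (by simp) (by simp [feedRegs]), hc₁.par]
    · rw [hreg _ (by simp) (by simp [feedRegs]), hc₁.min]
    · rw [hreg _ (by simp) (by simp [feedRegs]), hc₁.forb.len]
    · rw [harr _ (by simp)]; exact hc₁.forb.get
    · rw [hreg _ (by simp) (by simp [feedRegs]), hc₁.cand.len]
    · rw [harr _ (by simp)]; exact hc₁.cand.get
    · rw [hreg _ (by simp) (by simp [feedRegs]), hc₁.found.len]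
    · rw [harr _ (by simp)]; exact hc₁.found.get
    · rw [hreg _ (by simp) (by simp [feedRegs]), harr _ (by simp)]; exact hc₁.seen
    · rw [h100, ← not_iff_not, ← isConformal_image_union, ← hDC]
      exact hu
  refine key.call le_rfl fun s' hf h' => ⟨h'.1, fun x h40 h52 => hf.reg x fun hx => ?_, h'.2⟩
  have := wr_testC _ _ hx
  simp at this
  omega

/-- Search a violating set of the hypergraph in array `7`; register `41` tells whether there is
one, and register `46` gets its code. -/
def violatorC (A : Cmd) : Cmd :=
  setC 49 (.lit 0) ;; testC A ;;
  iteC (.var 100) .skip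
    (setC 46 (.lit 0) ;; setC 47 (.lit 0) ;;
     forC 48 (.var 0)
      (setC 49 (.add (.var 47) (.get 1 (.var 48))) ;; testC A ;;
       iteC (.var 100) (setC 46 (.add (.var 46) (.get 1 (.var 48)))) (setC 47 (.var 49))) ;;
     setC 41 (.lit 1))

/-- A bound for the number of loop iterations of `violatorC`. -/
def violatorT (n i B : ℕ) : ℕ := testT n i B + n * (testT n i B + 1)

/-- Self-reduction: a vertex joins `W` as long as some violating set still avoids `W`, and otherwise
goes to `X`, since every violating set avoiding `W` must contain it. When all vertices have been
treated, the violating sets avoiding `W` lie in `X` and contain `X`, so the only one is `X`. -/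
theorem violatorC_spec {A : Cmd} {n : ℕ} {F G C : List (Finset (Fin n))} {q r B : ℕ} {s : State}
    (h : Ctx A F G q r C s) (hA : Oracle A n r C.length B) (h41 : s.reg 41 = 0) :
    Wp (violatorC A) (violatorT n C.length B) s fun s' => Ctx A F G q r C s' ∧
      (s'.reg 41 ≠ 0 → ∃ S, s'.reg 46 = code S ∧ Violates C.toFinset r S) ∧
      (s'.reg 41 = 0 → ¬ ∃ S, Violates C.toFinset r S) := by
  refine wp_set_seq ((testC_spec (W := ∅) (h.setReg 49 _ (by simp) (by simp)) hA
    (by simp)).call_seq _ le_rfl fun s₁ hf₁ ⟨hc₁, hr₁, h100⟩ => wp_ite (fun h' => ?_) fun h' => ?_)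
  · have h41₁ : s₁.reg 41 = 0 := by rw [hr₁ _ (by simp) (by simp)]; simp [h41]
    refine wp_skip ⟨hc₁, fun h => absurd h41₁ h, fun _ ⟨S, hS⟩ => h' (h100.2 ⟨S, hS, by simp⟩)⟩
  obtain ⟨S₀, hS₀, -⟩ := h100.1 h'
  refine wp_set_seq (wp_set_seq ?_)
  refine wp_for_seq (T := testT n C.length B) (T₂ := 0) ?_ n (by simp [hc₁.env.size])
    (fun v s' => Ctx A F G q r C s' ∧ ∃ W X : Finset (Fin n), s'.reg 47 = code W ∧
      s'.reg 46 = code X ∧ (∀ u, (u ∈ W ∨ u ∈ X) ↔ v ≤ (u : ℕ)) ∧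
      (∃ S, Violates C.toFinset r S ∧ Disjoint S W) ∧
      ∀ u ∈ X, ¬ ∃ S, Violates C.toFinset r S ∧ Disjoint S (insert u W)) ?_ le_rfl ?_ ?_
  · intro h
    simp only [wr_seq, wr_setC, wr_iteC, List.mem_append] at h
    have := wr_testC A 48
    simp at h this
    exact this h
  · refine ⟨Ctx.setReg (Ctx.setReg (hc₁.setReg _ _ (by simp) (by simp)) _ _ (by simp) (by simp)) _ _
      (by simp) (by simp), ∅, ∅, by simp, by simp, fun u => ?_, ⟨S₀, hS₀, by simp⟩, by simp⟩
    simp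
  · rintro v hv s₂ hf₂ ⟨hc₂, W, X, h47, h46, hWX, hex, hX⟩
    have h1 : s₂.arr 1 v = 2 ^ v := hc₂.env.pow v hv
    have hvW : (⟨v, hv⟩ : Fin n) ∉ W := fun h => by
      have := (hWX _).1 (.inl h); simp at this
    have hvX : (⟨v, hv⟩ : Fin n) ∉ X := fun h => by
      have := (hWX _).1 (.inr h); simp at this
    have hWX' (u : Fin n) : ((u ∈ W ∨ u ∈ X) ∨ u = ⟨v, hv⟩) ↔ v ≤ (u : ℕ) := by
      rw [hWX, Fin.ext_iff]
      simp; omega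
    refine wp_set_seq ((testC_spec (W := insert ⟨v, hv⟩ W)
      ((hc₂.setReg 48 v (by simp) (by simp)).setReg 49 _ (by simp) (by simp)) hA
      (by simp [h47, h1, code_insert hvW])).call_seq 0 le_rfl fun s₃ hf₃ ⟨hc₃, hr₃, h100'⟩ => ?_)
    have h46₃ : s₃.reg 46 = code X := by rw [hr₃ _ (by simp) (by simp)]; simp [h46]
    have h47₃ : s₃.reg 47 = code W := by rw [hr₃ _ (by simp) (by simp)]; simp [h47]
    have h48₃ : s₃.reg 48 = v := by rw [hr₃ _ (by simp) (by simp)]; simp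
    have h49₃ : s₃.reg 49 = code (insert ⟨v, hv⟩ W) := by
      rw [hr₃ _ (by simp) (by simp)]; simp [h47, h1, code_insert hvW]
    have h1₃ : s₃.arr 1 v = 2 ^ v := hc₃.env.pow v hv
    refine wp_ite (fun h => wp_set ⟨hc₃.setReg _ _ (by simp) (by simp), W, insert ⟨v, hv⟩ X,
      by simp [h47₃], by simp [h46₃, h48₃, h1₃, code_insert hvX], fun u => ?_, hex, fun u hu => ?_⟩)
      fun h => wp_set ⟨hc₃.setReg _ _ (by simp) (by simp), insert ⟨v, hv⟩ W, X,
      by simp [h49₃], by simp [h46₃], fun u => ?_, h100'.1 h, fun u hu => ?_⟩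
    · rw [← hWX', Finset.mem_insert]; tauto
    · rcases Finset.mem_insert.1 hu with rfl | hu
      · exact fun hS => h (h100'.2 hS)
      · exact hX u hu
    · rw [← hWX', Finset.mem_insert]; tauto
    -- A rejection stays justified when `W` grows, as avoiding a larger set is harder.
    · rintro ⟨S, hS, hd⟩
      exact hX u hu ⟨S, hS, hd.mono_right
        (Finset.insert_subset_insert _ (Finset.subset_insert _ _))⟩
  · rintro s₂ hf₂ ⟨hc₂, W, X, h47, h46, hWX, ⟨S, hS, hd⟩, hX⟩
    have hSX : S = X := by
      refine Finset.Subset.antisymm (fun u hu => ?_) fun u hu => ?_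
      · exact ((hWX u).2 (Nat.zero_le _)).resolve_left (Finset.disjoint_left.1 hd hu)
      · by_contra hu'
        exact hX u hu ⟨S, hS, Finset.disjoint_insert_right.2 ⟨hu', hd⟩⟩
    refine wp_set ⟨hc₂.setReg _ _ (by simp) (by simp), fun _ => ⟨X, by simp [h46], hSX ▸ hS⟩, ?_⟩
    simp

/-! ### Enumeration: finding one more solution -/

/-- Extend the set in register `46` to a maximal one that contains no set in array `5`. -/
def extendC : Cmd :=
  forC 55 (.var 0)
    (subC (.get 1 (.var 55)) (.var 46) ;;
     iteC (.var 25) .skip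
      (anyC true 5 9 (.add (.var 46) (.get 1 (.var 55))) ;;
       iteC (.var 27) .skip (setC 46 (.add (.var 46) (.get 1 (.var 55))))))

@[simp] theorem mem_wr_extendC (x : ℕ) :
    x ∈ extendC.wr ↔ x ∈ [20, 21, 22, 23, 24, 25, 26, 27, 28, 46, 55] := by
  simp [extendC]; tauto

@[simp] theorem wa_extendC : extendC.wa = [] := by simp [extendC]

/-- One pass suffices: a rejected vertex would complete a set of `F`, and it still would after the
set has grown. -/
theorem extendC_spec {A : Cmd} {n : ℕ} {F G C : List (Finset (Fin n))} {q r : ℕ} {s : State}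
    (h : Ctx A F G q r C s) {S : Finset (Fin n)} (h46 : s.reg 46 = code S)
    (hS : ∀ E ∈ F, ¬ E ⊆ S) :
    Wp extendC (n * (n + F.length * (n + 1) + 1)) s fun s' =>
      ∃ X, s'.reg 46 = code X ∧ S ⊆ X ∧ Maximal (fun X => ∀ E ∈ F, ¬ E ⊆ X) X := by
  refine wp_for (by simp) n (by simp [h.env.size]) (fun v s' => ∃ X, s'.reg 46 = code X ∧ S ⊆ X ∧
    (∀ E ∈ F, ¬ E ⊆ X) ∧ ∀ u : Fin n, v ≤ (u : ℕ) → u ∉ X → ∃ E ∈ F, E ⊆ insert u X) ?_ ?_ ?_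
  · refine ⟨S, by simp [h46], Finset.Subset.refl _, hS, fun u hu => ?_⟩
    omega
  · rintro v hv s₁ hf₁ ⟨X, h46₁, hSX, hX, hmax⟩
    have hc₁ := (h.frame hf₁ (by simp; omega) (by simp)).setReg 55 v (by simp) (by simp)
    have h1 : s₁.arr 1 v = 2 ^ v := hc₁.env.pow v hv
    have split (Y : Finset (Fin n)) (hXY : X ⊆ Y)
        (hY : (⟨v, hv⟩ : Fin n) ∉ Y → ∃ E ∈ F, E ⊆ insert ⟨v, hv⟩ Y) (u : Fin n) (hu : v ≤ (u : ℕ))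
        (huY : u ∉ Y) : ∃ E ∈ F, E ⊆ insert u Y := by
      rcases hu.eq_or_lt with h0 | h0
      · subst h0; exact hY huY
      · obtain ⟨E, hE, h⟩ := hmax u h0 fun h => huY (hXY h)
        exact ⟨E, hE, h.trans (Finset.insert_subset_insert _ hXY)⟩
    refine (subC_spec hc₁.env {⟨v, hv⟩} X (by simp [h1]) (by simp [h46₁])).call_seq _ le_rfl
      fun s₂ hf₂ h25 => ?_
    have hc₂ := hc₁.frame hf₂ (by simp) (by simp)
    have h46₂ : s₂.reg 46 = code X := by rw [hf₂.reg 46 (by simp)]; simp [h46₁]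
    have h55₂ : s₂.reg 55 = v := by rw [hf₂.reg 55 (by simp)]; simp
    have h1₂ : s₂.arr 1 v = 2 ^ v := hc₂.env.pow v hv
    refine wp_ite (fun h' => wp_skip ?_) fun h' => ?_
    · have hm : (⟨v, hv⟩ : Fin n) ∈ X := by
        by_contra hm; simp [h25, hm] at h'
      exact ⟨X, h46₂, hSX, hX, split X (Finset.Subset.refl _) fun h => absurd hm h⟩
    have hm : (⟨v, hv⟩ : Fin n) ∉ X := by
      intro hm; simp [h25, hm] at h'
    refine (anyC_spec hc₂.env true hc₂.forb (by simp) (insert ⟨v, hv⟩ X)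
      (by simp [h46₂, h55₂, h1₂, code_insert hm])).call_seq 0 le_rfl fun s₃ hf₃ h27 => ?_
    have h46₃ : s₃.reg 46 = code X := by rw [hf₃.reg 46 (by simp), h46₂]
    have h55₃ : s₃.reg 55 = v := by rw [hf₃.reg 55 (by simp), h55₂]
    have h1₃ : s₃.arr 1 v = 2 ^ v := by rw [hf₃.arr 1 (by simp), h1₂]
    simp only [if_true] at h27
    refine wp_ite (fun h => wp_skip ?_) fun h => wp_set ?_
    · exact ⟨X, h46₃, hSX, hX, split X (Finset.Subset.refl _) fun _ => h27.1 h⟩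
    · refine ⟨insert ⟨v, hv⟩ X, by simp [h46₃, h55₃, h1₃, code_insert hm],
        hSX.trans (Finset.subset_insert _ _), fun E hE hEX => h27.2 ⟨E, hE, hEX⟩ h,
        split _ (Finset.subset_insert _ _) fun h => absurd (Finset.mem_insert_self _ _) h⟩
  · rintro s₁ - ⟨X, h46₁, hSX, hX, hmax⟩
    refine ⟨X, h46₁, hSX, hX, fun Y hY hXY => ?_⟩
    by_contra hYX
    obtain ⟨u, huY, huX⟩ := Finset.not_subset.1 hYX
    obtain ⟨E, hE, h⟩ := hmax u (Nat.zero_le _) huX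
    exact hY E hE (h.trans (Finset.insert_subset huY hXY))

/-- The maximal sets with at least `q` vertices that contain no set of `F`. -/
def Sol {n : ℕ} (F : List (Finset (Fin n))) (q : ℕ) (D : Finset (Fin n)) : Prop :=
  Maximal (fun D => q ≤ D.card ∧ ∀ E ∈ F, ¬ E ⊆ D) D

/-- The sets with at least `q` and at most `r` vertices are split into `F` and `G`. -/
structure IsSplit {n : ℕ} (F G : List (Finset (Fin n))) (q r : ℕ) : Prop where
  mem : ∀ S, S ∈ F ∨ S ∈ G ↔ q ≤ S.card ∧ S.card ≤ r
  disj : ∀ S ∈ F, S ∉ G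
  par : q = 0 ∨ q = r

section Split

variable {n : ℕ} {F G C : List (Finset (Fin n))} {q r : ℕ} {S : Finset (Fin n)}

/-- For `q = 0`, a forbidden proper subset of `S` would lie in some `S.erase v`, which the candidate
condition places inside a found solution, and these contain nothing forbidden. For `q = r`, both
sets have exactly `r` elements and would coincide. -/
theorem IsSplit.free_of_candidate (h : IsSplit F G q r) (hC : ∀ D ∈ C, Sol F q D) (hS : S ∈ G)
    (hc : Candidate q C.toFinset S) : ∀ E ∈ F, ¬ E ⊆ S := by
  intro E hE hES
  have hne : E ≠ S := fun h' => h.disj E hE (h' ▸ hS)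
  rcases h.par with hq | rfl
  · obtain ⟨v, hvS, hvE⟩ := Finset.exists_of_ssubset (hES.ssubset_of_ne hne)
    obtain ⟨D, hD, hDS⟩ := hc.2 hq v hvS
    exact (hC D (List.mem_toFinset.1 hD)).prop.2 E hE
      ((Finset.subset_erase.2 ⟨hES, hvE⟩).trans hDS)
  · have h1 := (h.mem E).1 (.inl hE)
    have h2 := (h.mem S).1 (.inr hS)
    exact hne (Finset.eq_of_subset_of_card_le hES (by omega))

theorem Violates.lt_card {H : FinHypergraph n} (h : Violates H r S) : r < S.card := by
  by_contra hr
  exact h.1 (h.2 S (Finset.Subset.refl _) (by omega))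

/-- Forbidden sets have at most `r` elements, so one inside a violating set would be covered by a
found solution. -/
theorem IsSplit.free_of_violates (h : IsSplit F G q r) (hC : ∀ D ∈ C, Sol F q D)
    (hS : Violates C.toFinset r S) : ∀ E ∈ F, ¬ E ⊆ S := by
  intro E hE hES
  obtain ⟨D, hD, hED⟩ := hS.2 E hES ((h.mem E).1 (.inl hE)).2
  exact (hC D (List.mem_toFinset.1 hD)).prop.2 E hE hED

theorem exists_minimal_not_covered {H : FinHypergraph n} {D : Finset (Fin n)}
    (hD : ¬ Covered H D) : ∃ S ⊆ D, ¬ Covered H S ∧ ∀ v ∈ S, Covered H (S.erase v) := by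
  obtain ⟨S, hSD, hS⟩ := exists_minimal_le_of_wellFoundedLT (fun S => ¬ Covered H S) D hD
  refine ⟨S, hSD, hS.prop, fun v hv => ?_⟩
  by_contra hc
  exact Finset.notMem_erase v S (hS.le_of_le hc (Finset.erase_subset _ _) hv)

/-- A covered solution equals the found one that contains it, by maximality. Suppose `S` is not
covered. For `q = 0`, take a minimal uncovered subset `T`: it is a candidate if it has at most `r`
elements, and violating otherwise, because its small subsets are proper. For `q = r`, absence of
candidates means that all `r`-subsets of `S` are covered, hence all smaller subsets too, and `S`
itself is violating. -/
theorem IsSplit.mem_of_sol (h : IsSplit F G q r) (hC : ∀ D ∈ C, Sol F q D)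
    (hcand : ∀ S ∈ G, ¬ Candidate q C.toFinset S) (hviol : ¬ ∃ S, Violates C.toFinset r S)
    (hS : Sol F q S) : S ∈ C := by
  by_cases hcov : Covered C.toFinset S
  · obtain ⟨D, hD, hSD⟩ := hcov
    rw [List.mem_toFinset] at hD
    rwa [Finset.Subset.antisymm hSD (hS.le_of_ge (hC D hD).prop hSD)]
  exfalso
  have small (T : Finset (Fin n)) (hT : T ⊆ S) (hq : q ≤ T.card) (hr : T.card ≤ r) : T ∈ G :=
    ((h.mem T).2 ⟨hq, hr⟩).resolve_left fun hF => hS.prop.2 T hF hT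
  by_cases hq : q = 0
  · obtain ⟨T, hTS, hT, hTe⟩ := exists_minimal_not_covered hcov
    by_cases hr : T.card ≤ r
    · exact hcand T (small T hTS (by omega) hr) ⟨hT, fun _ => hTe⟩
    · refine hviol ⟨T, hT, fun U hU hUr => ?_⟩
      obtain ⟨v, hvT, hvU⟩ := Finset.exists_of_ssubset
        (hU.ssubset_of_ne fun h => hr (h ▸ hUr))
      exact (hTe v hvT).mono (Finset.subset_erase.2 ⟨hU, hvU⟩)
  · obtain rfl := h.par.resolve_left hq
    refine hviol ⟨S, hcov, fun U hU hUr => ?_⟩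
    by_contra hUc
    obtain ⟨T, hUT, hTS, hT⟩ := Finset.exists_subsuperset_card_eq hU hUr hS.prop.1
    exact hcand T (small T hTS hT.ge hT.le) ⟨fun hc => hUc (hc.mono hUT), fun h => absurd h hq⟩

end Split

/-- Search a new solution, and append it to the list in array `7`; register `41` tells whether
there is one, and register `46` gets its code. -/
def stepC (A : Cmd) : Cmd :=
  searchC ;; iteC (.var 41) .skip (violatorC A) ;;
  iteC (.var 41) (extendC ;; stoC 7 (.var 11) (.var 46) ;; setC 11 (.add (.var 11) (.lit 1))) .skip

/-- A bound for the number of loop iterations of `stepC`. -/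
def stepT (n i f g B : ℕ) : ℕ :=
  searchT n i g + (violatorT n i B + n * (n + f * (n + 1) + 1))

/-- The state of the enumeration after `stepC`. -/
structure Stepped (A : Cmd) {n : ℕ} (F G : List (Finset (Fin n))) (q r : ℕ)
    (C : List (Finset (Fin n))) (s : State) : Prop where
  none : s.reg 41 = 0 → ∀ D, Sol F q D → D ∈ C
  some : s.reg 41 ≠ 0 → ∃ X, Sol F q X ∧ X ∉ C ∧ s.reg 46 = code X ∧ Ctx A F G q r (C ++ [X]) s

theorem stepC_spec {A : Cmd} {n : ℕ} {F G C : List (Finset (Fin n))} {q r B : ℕ} {s : State}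
    (hs : IsSplit F G q r) (hC : ∀ D ∈ C, Sol F q D) (h : Ctx A F G q r C s)
    (hA : Oracle A n r C.length B) :
    Wp (stepC A) (stepT n C.length F.length G.length B) s (Stepped A F G q r C) := by
  refine (searchC_spec h).call_seq _ le_rfl fun s₁ hf₁ ⟨h1, h2⟩ => ?_
  have hc₁ : Ctx A F G q r C s₁ := h.frame hf₁ (by simp) (by simp)
  have finish (s₂ : State) (hc₂ : Ctx A F G q r C s₂)
      (hn : s₂.reg 41 = 0 → ∀ D, Sol F q D → D ∈ C)
      (hsome : s₂.reg 41 ≠ 0 → ∃ S, s₂.reg 46 = code S ∧ q ≤ S.card ∧ (∀ E ∈ F, ¬ E ⊆ S) ∧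
        ¬ Covered C.toFinset S) :
      Wp (iteC (.var 41) (extendC ;; stoC 7 (.var 11) (.var 46) ;;
        setC 11 (.add (.var 11) (.lit 1))) .skip) (n * (n + F.length * (n + 1) + 1)) s₂
        (Stepped A F G q r C) := by
    refine wp_ite (fun h41 => ?_) fun h41 => wp_skip ⟨fun _ => hn h41, fun h => absurd h41 h⟩
    obtain ⟨S, h46, hq, hfree, hcov⟩ := hsome h41
    refine (extendC_spec hc₂ h46 hfree).call_seq 0 le_rfl fun s₃ hf₃ ⟨X, h46', hSX, hX⟩ => ?_
    have hc₃ : Ctx A F G q r C s₃ := hc₂.frame hf₃ (by simp) (by simp)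
    have hXsol : Sol F q X :=
      ⟨⟨hq.trans (Finset.card_le_card hSX), hX.prop⟩, fun Y hY hXY => hX.le_of_ge hY.2 hXY⟩
    have h41₃ : s₃.reg 41 ≠ 0 := by rw [hf₃.reg 41 (by simp)]; exact h41
    -- The solution `X` is new because it contains `S`, which lies in no found solution.
    refine wp_sto_seq (wp_set ⟨fun h0 => absurd (by simpa using h0) h41₃,
      fun _ => ⟨X, hXsol, fun hXC => hcov ⟨X, List.mem_toFinset.2 hXC, hSX⟩, by simp [h46'], ?_⟩⟩)
    refine ⟨Env.setReg (hc₃.env.setArr _ _ _ (by simp)) _ _ (by simp) (by simp),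
      by simp [hc₃.par], by simp [hc₃.min], ?_, ?_, ?_, ?_, ?_⟩
    · exact HasList.setReg (hc₃.forb.setArr _ _ _ (by simp)) _ _ (by simp)
    · exact HasList.setReg (hc₃.cand.setArr _ _ _ (by simp)) _ _ (by simp)
    · exact hc₃.found.push (by simp) (by simp [h46'])
    · exact Fresh.setReg (hc₃.fresh.setArr _ _ _ (by simp)) _ _ (by simp) (by simp) (by simp)
    · simpa using hc₃.seen
  refine Wp.ite_seq (fun h41 => Wp.skip_seq ((finish s₁ hc₁ (fun h => absurd h h41) fun _ => ?_).mono
    (by omega) fun _ h => h)) fun h41 => ?_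
  · obtain ⟨S, hSG, h46, hcd⟩ := h1 h41
    exact ⟨S, h46, ((hs.mem S).1 (.inr hSG)).1, hs.free_of_candidate hC hSG hcd, hcd.1⟩
  · refine (violatorC_spec hc₁ hA h41).call_seq _ le_rfl fun s₂ _ ⟨hc₂, h3, h4⟩ => ?_
    refine finish s₂ hc₂ (fun h0 D hD => hs.mem_of_sol hC (h2 h41) (h4 h0) hD) fun h0 => ?_
    obtain ⟨S, h46, hS⟩ := h3 h0
    refine ⟨S, h46, ?_, hs.free_of_violates hC hS, hS.1⟩
    -- A violating set has more than `r` vertices, hence at least `q`.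
    have := hS.lt_card
    rcases hs.par with h | h <;> omega

/-! ### Programs that write -/

/-- Total correctness of a program that writes: started in a memory with view `s`, the program `c`
terminates after at most `T` loop iterations without marking the end of a solution, and the written
numbers and the view of the final memory satisfy `Q`. -/
def WpW (c : Cmd) (T : ℕ) (s : State) (Q : List ℕ → State → Prop) : Prop :=
  ∀ σ, abs σ = s → ∃ t L σ', RunIter c σ t L σ' ∧ (∀ a ∈ t, a.isEmit = false) ∧ L ≤ T ∧
    Q (t.filterMap Action.written?) (abs σ')

theorem Silent.isEmit {t : List Action} (h : Silent t) : ∀ a ∈ t, a.isEmit = false := by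
  intro a ha
  rw [h a ha]
  rfl

theorem Silent.written {t : List Action} (h : Silent t) :
    t.filterMap Action.written? = [] := by
  rw [List.filterMap_eq_nil_iff]
  intro a ha
  rw [h a ha]
  rfl

theorem WpW.mono {c : Cmd} {T T' : ℕ} {s : State} {Q Q' : List ℕ → State → Prop}
    (h : WpW c T s Q) (hT : T ≤ T') (hQ : ∀ w s', Q w s' → Q' w s') : WpW c T' s Q' := by
  intro σ hσ
  obtain ⟨t, L, σ', hr, hs, hL, hq⟩ := h σ hσ
  exact ⟨t, L, σ', hr, hs, hL.trans hT, hQ _ _ hq⟩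

theorem Wp.wpW {c : Cmd} {T : ℕ} {s : State} {Q : List ℕ → State → Prop} (h : Wp c T s (Q [])) :
    WpW c T s Q := by
  intro σ hσ
  obtain ⟨t, L, σ', hr, hs, hL, hq⟩ := h σ hσ
  exact ⟨t, L, σ', hr, hs.isEmit, hL, by rwa [hs.written]⟩

theorem WpW.seq {p q : Cmd} {T₁ T₂ : ℕ} {s : State} {Q : List ℕ → State → Prop}
    (h : WpW p T₁ s fun w s' => WpW q T₂ s' fun w' => Q (w ++ w')) :
    WpW (p ;; q) (T₁ + T₂) s Q := by
  intro σ hσ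
  obtain ⟨t, L, σ', hr, hs, hL, hq⟩ := h σ hσ
  obtain ⟨t', L', σ'', hr', hs', hL', hq'⟩ := hq σ' rfl
  refine ⟨_, _, σ'', hr.seq hr', fun a ha => ?_, by omega, by rwa [List.filterMap_append]⟩
  exact (List.mem_append.1 ha).elim (hs a) (hs' a)

theorem Wp.seqW {p q : Cmd} {T₁ T₂ : ℕ} {s : State} {Q : List ℕ → State → Prop}
    (h : Wp p T₁ s fun s' => WpW q T₂ s' Q) : WpW (p ;; q) (T₁ + T₂) s Q :=
  (Wp.wpW (Q := fun w s' => WpW q T₂ s' fun w' => Q (w ++ w')) (by simpa using h)).seq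

theorem wpW_write {e : Exp} {s : State} {Q : List ℕ → State → Prop} (h : Q [e.ev s] s) :
    WpW (writeC e) 0 s Q := by
  rintro σ rfl
  obtain ⟨t, σ₁, h₁, hs₁, ha₁, hv₁, -⟩ := e.code_run 0 σ
  refine ⟨_, _, σ₁, h₁.seq (.write _ _), fun a ha => ?_, by omega, ?_⟩
  · rcases List.mem_append.1 ha with h | h
    · exact hs₁.isEmit a h
    · rw [List.mem_singleton.1 h]; rfl
  · rw [List.filterMap_append, hs₁.written, ha₁]
    simpa [Action.written?, ← hv₁] using h

theorem wpW_ite {e : Exp} {p q : Cmd} {T : ℕ} {s : State} {Q : List ℕ → State → Prop}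
    (h : e.ev s ≠ 0 → WpW p T s Q) (h' : e.ev s = 0 → WpW q T s Q) : WpW (iteC e p q) T s Q := by
  rintro σ rfl
  obtain ⟨t, σ₁, h₁, hs₁, ha₁, hv₁, -⟩ := e.code_run 0 σ
  have hmem (t' : List Action) (ht' : ∀ a ∈ t', a.isEmit = false) :
      ∀ a ∈ t ++ Action.silent :: t', a.isEmit = false := by
    intro a ha
    simp only [List.mem_append, List.mem_cons] at ha
    rcases ha with h | rfl | h
    exacts [hs₁.isEmit a h, rfl, ht' a h]
  have hwr (t' : List Action) : (t ++ Action.silent :: t').filterMap Action.written? =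
      t'.filterMap Action.written? := by
    rw [List.filterMap_append, hs₁.written]; rfl
  by_cases hz : e.ev (abs σ) = 0
  · obtain ⟨t', L, σ₂, h₂, hs₂, hL, hq⟩ := h' hz σ₁ ha₁
    exact ⟨_, _, σ₂, h₁.seq (.branch_zero (by rw [hv₁, hz]) h₂), hmem _ hs₂, by omega,
      by rwa [hwr]⟩
  · obtain ⟨t', L, σ₂, h₂, hs₂, hL, hq⟩ := h hz σ₁ ha₁
    exact ⟨_, _, σ₂, h₁.seq (.branch_nonzero (by rwa [hv₁]) h₂), hmem _ hs₂, by omega,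
      by rwa [hwr]⟩

theorem wpW_while_succ {e : Exp} {p : Cmd} {T₁ T₂ : ℕ} {s : State} {Q : List ℕ → State → Prop}
    (hz : e.ev s ≠ 0)
    (h : WpW p T₁ s fun w s' => WpW (whileC e p) T₂ s' fun w' => Q (w ++ w')) :
    WpW (whileC e p) (T₁ + T₂ + 1) s Q := by
  rintro σ rfl
  obtain ⟨t, σ₁, h₁, hs₁, ha₁, hv₁, -⟩ := e.code_run 0 σ
  obtain ⟨t', L, σ₂, h₂, hs₂, hL, hq⟩ := h σ₁ ha₁
  obtain ⟨t'', L', σ₃, h₃, hs₃, hL', hq'⟩ := hq σ₂ rfl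
  cases h₃ with
  | @seq _ _ _ _ _ u u' _ _ h₃ h₄ =>
    refine ⟨_, _, σ₃, h₁.seq (.loop_nonzero (by rwa [hv₁]) (h₂.seq h₃) h₄), fun a ha => ?_,
      by omega, ?_⟩
    · simp only [List.mem_append, List.mem_cons] at ha hs₃
      rcases ha with h | rfl | (h | h) | h
      exacts [hs₁.isEmit a h, rfl, hs₂ a h, hs₃ a (.inl h), hs₃ a (.inr h)]
    · rw [List.filterMap_append, hs₁.written, List.nil_append, List.filterMap_cons_none rfl,
        List.append_assoc, List.filterMap_append]
      exact hq'

theorem WpW.frame {c : Cmd} {T : ℕ} {s : State} {Q : List ℕ → State → Prop} (h : WpW c T s Q) :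
    WpW c T s fun w s' => Frame c.wr c.wa s s' ∧ Q w s' := by
  rintro σ rfl
  obtain ⟨t, L, σ', hr, hs, hL, hq⟩ := h σ rfl
  exact ⟨t, L, σ', hr, hs, hL, hr.frame, hq⟩

/-- Write the set in register `46`, or its complement if `co` is true. -/
def outC (co : Bool) : Cmd :=
  forC 56 (.var 0)
    (subC (.get 1 (.var 56)) (.var 46) ;;
     iteC (bif co then .sub (.lit 1) (.var 25) else .var 25) (writeC (.var 56)) .skip)

@[simp] theorem wr_writeC (e : Exp) : (writeC e).wr = [] := by simp [writeC, e.wr_code, Cmd.wr]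

@[simp] theorem wa_writeC (e : Exp) : (writeC e).wa = [] := by simp [writeC, e.wr_code, Cmd.wa]

@[simp] theorem mem_wr_outC (co : Bool) (x : ℕ) :
    x ∈ (outC co).wr ↔ x ∈ [20, 21, 22, 23, 24, 25, 56] := by
  simp [outC]; tauto

@[simp] theorem wa_outC (co : Bool) : (outC co).wa = [] := by simp [outC]

theorem low_succ {n j : ℕ} (hj : j < n) (S : Finset (Fin n)) :
    low (j + 1) S = if (⟨j, hj⟩ : Fin n) ∈ S then insert ⟨j, hj⟩ (low j S) else low j S := by
  ext v
  split_ifs with h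
  · simp only [mem_low, Finset.mem_insert, Fin.ext_iff]
    constructor
    · intro h; have := h.2; grind
    · rintro (h' | h')
      · rw [show v = ⟨j, hj⟩ from Fin.ext h']; exact ⟨h, by simp⟩
      · exact ⟨h'.1, by omega⟩
  · simp only [mem_low]
    constructor
    · intro h'
      refine ⟨h'.1, ?_⟩
      have : (v : ℕ) ≠ j := by
        rintro rfl
        exact h h'.1
      omega
    · exact fun h' => ⟨h'.1, by omega⟩

/-- The counter descends, so what remains to be written at counter value `k` is the part of the set
below `k`. -/
theorem outC_spec {n : ℕ} {s : State} (hE : Env n s) (co : Bool) {X : Finset (Fin n)}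
    (hX : s.reg 46 = code X) : WpW (outC co) (n * (n + 1)) s fun w _ =>
      w.toFinset = (bif co then Xᶜ else X).map Fin.valEmbedding := by
  set Y : Finset (Fin n) := bif co then Xᶜ else X with hY
  have key (k : ℕ) (hk : k ≤ n) : ∀ s, Env n s → s.reg 46 = code X → s.reg 56 = k →
      WpW (whileC (.var 56) (setC 56 (.sub (.var 56) (.lit 1)) ;;
        subC (.get 1 (.var 56)) (.var 46) ;;
        iteC (bif co then .sub (.lit 1) (.var 25) else .var 25) (writeC (.var 56)) .skip))
        (k * (n + 1)) s fun w _ => w.toFinset = (low k Y).map Fin.valEmbedding := by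
    induction k with
    | zero =>
      intro s _ _ h56
      exact Wp.wpW (wp_while_zero (by simpa using h56) (by ext; simp [mem_low]))
    | succ k ih =>
      intro s hE hX h56
      rw [show (k + 1) * (n + 1) = 0 + (n + 0) + k * (n + 1) + 1 by ring]
      refine wpW_while_succ (by simp [h56]) (Wp.seqW (wp_set ?_))
      have h56₁ : (s.setReg 56 (Exp.ev s (.sub (.var 56) (.lit 1)))).reg 56 = k := by simp [h56]
      have hE₁ := hE.setReg 56 (Exp.ev s (.sub (.var 56) (.lit 1))) (by simp) (by simp)
      have h1₁ := hE₁.pow k (by omega)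
      refine Wp.seqW ((subC_spec hE₁ {⟨k, hk⟩} X (by simp [h56] at h1₁ ⊢; exact h1₁)
        (by simp [hX])).call le_rfl fun s₂ hf₂ h25 => ?_)
      have hE₂ : Env n s₂ := hE₁.frame hf₂ (by simp) (by simp) (by simp)
      have hX₂ : s₂.reg 46 = code X := by rw [hf₂.reg 46 (by simp)]; simp [hX]
      have h56₂ : s₂.reg 56 = k := by rw [hf₂.reg 56 (by simp)]; simp [h56]
      have htest : Exp.ev s₂ (bif co then .sub (.lit 1) (.var 25) else .var 25) ≠ 0 ↔
          (⟨k, hk⟩ : Fin n) ∈ Y := by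
        cases co <;> by_cases hm : (⟨k, hk⟩ : Fin n) ∈ X <;> simp [hY, h25, hm]
      refine wpW_ite (fun h => wpW_write ?_) fun h => (wp_skip ?_).wpW
      · refine (ih (by omega) s₂ hE₂ hX₂ h56₂).mono le_rfl fun w _ hw => ?_
        rw [low_succ hk, if_pos (htest.1 h)]
        simp [hw, h56₂]
      · refine (ih (by omega) s₂ hE₂ hX₂ h56₂).mono le_rfl fun w _ hw => ?_
        rw [low_succ hk, if_neg fun hm => htest.2 hm h]
        simpa using hw
  have h0 := key n le_rfl (s.setReg 56 n) (hE.setReg _ _ (by simp) (by simp)) (by simp [hX])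
    (by simp)
  rw [low_self] at h0
  have := Wp.seqW (T₁ := 0) (p := setC 56 (.var 0)) (s := s) (wp_set (by simpa [hE.size] using h0))
  exact this.mono (by simp) fun _ _ h => h

theorem blocks_append_emit {u : List Action} (hu : ∀ a ∈ u, a.isEmit = false) (v : List Action) :
    blocks (u ++ Action.emit :: v) = u :: blocks v :=
  List.splitOnP_append_cons_of_forall_mem hu _ rfl _

theorem blocks_of_not_emit {u : List Action} (hu : ∀ a ∈ u, a.isEmit = false) :
    blocks u = [u] :=
  List.splitOnP_eq_singleton hu

/-- The set that is written for the solution `D`. -/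
def written {n : ℕ} (co : Bool) (D : Finset (Fin n)) : Finset (Fin n) := bif co then Dᶜ else D

/-! ### The main loop and its delays -/

/-- The body of the main loop of the enumeration. -/
def nextC (A : Cmd) (co : Bool) : Cmd := outC co ;; Cmd.emit ;; stepC A

/-- A bound for the time between the first output and the next one. -/
def delayT (A : Cmd) (n i f g B : ℕ) : ℕ :=
  (stepC A ;; (Exp.var 41).code 0).size * (stepT n i f g B + 1)

/-- A bound for the time of an output. -/
def outT (co : Bool) (n : ℕ) : ℕ := (outC co).size * (n * (n + 1) + 1) + 2

/-- At the loop test the next solution is already known but not yet written, and `u` is the silent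
time since the last output, spent on finding it; so `u` belongs to the first block. The number `k`
serves as fuel: the found solutions are distinct, so there are at most `2 ^ n` of them. -/
theorem enumerate_run {A : Cmd} {n : ℕ} {F G : List (Finset (Fin n))} {q r : ℕ} (co : Bool)
    {B : ℕ → ℕ} (hs : IsSplit F G q r) (hA : ∀ i, Oracle A n r i (B i)) (k : ℕ) :
    ∀ C : List (Finset (Fin n)), C.Nodup → (∀ D ∈ C, Sol F q D) →
      2 ^ n < C.length + k →
      ∀ σ, σ.reg 1 = (abs σ).reg 41 → Stepped A F G q r C (abs σ) →
      ∀ u, Silent u → ∃ t σ' ss, Run (.loop 1 (nextC A co ;; (Exp.var 41).code 0)) σ t σ' ∧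
        (C ++ ss).Nodup ∧ (∀ D, D ∈ C ++ ss ↔ Sol F q D) ∧
        outputs (u ++ t) = ss.map (fun D => (written co D).map Fin.valEmbedding) ∧
        ∀ i b, (blocks (u ++ t))[i]? = some b → b.length + 1 ≤
          (if i = 0 then u.length else
            delayT A n (C.length + i) F.length G.length (B (C.length + i))) + outT co n := by
  induction k with
  | zero =>
    intro C hCn _ hk
    have := hCn.length_le_card
    simp at this
    omega
  | succ k ih =>
    intro C hCn hC hk σ h1 hst u hu
    by_cases h41 : (abs σ).reg 41 = 0
    · have hb : blocks (u ++ [Action.silent]) = [u ++ [Action.silent]] :=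
        blocks_of_not_emit (hu.append silent_singleton).isEmit
      refine ⟨_, σ, [], .loop_zero (by rw [h1, h41]), by simpa using hCn, fun D => ?_, ?_, ?_⟩
      · rw [List.append_nil]
        exact ⟨hC D, hst.none h41 D⟩
      · rw [outputs, hb]; rfl
      · intro i b hib
        rw [hb] at hib
        rcases i with _ | i
        · simp at hib
          subst hib
          simp [outT]
        · simp at hib
    · obtain ⟨X, hX, hXC, h46, hc⟩ := hst.some h41
      obtain ⟨w, L, σ₁, hw, hwe, hL, hf, hwX⟩ := (outC_spec hc.env co h46).frame σ rfl
      have hc₁ : Ctx A F G q r (C ++ [X]) (abs σ₁) := hc.frame hf (by simp) (by simp)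
      have hC₁ : ∀ D ∈ C ++ [X], Sol F q D := by
        intro D hD
        rcases List.mem_append.1 hD with h | h
        · exact hC D h
        · rw [List.mem_singleton.1 h]; exact hX
      have hCn₁ : (C ++ [X]).Nodup := by
        rw [List.nodup_append]
        refine ⟨hCn, by simp, ?_⟩
        rintro S hS T hT rfl
        rw [List.mem_singleton.1 hT] at hS
        exact hXC hS
      obtain ⟨t₁, L₁, σ₂, hr₁, hs₁, hL₁, hst₁⟩ := stepC_spec hs hC₁ hc₁ (hA _) σ₁ rfl
      obtain ⟨t₂, σ₃, hr₂, hs₂, ha₂, hv₂, -⟩ := (Exp.var 41).code_run 0 σ₂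
      -- The search performed after this output becomes the silent beginning of the next block.
      obtain ⟨t, σ', ss, ht, hn, hm, ho, hd⟩ := ih (C ++ [X]) hCn₁ hC₁ (by simp; omega) σ₃
        (by rw [ha₂]; exact hv₂) (by rw [ha₂]; exact hst₁) (t₁ ++ t₂) (hs₁.append hs₂)
      have hpre : ∀ a ∈ u ++ Action.silent :: w, a.isEmit = false := by
        intro a ha
        simp only [List.mem_append, List.mem_cons] at ha
        rcases ha with h | rfl | h
        exacts [hu.isEmit a h, rfl, hwe a h]
      have hb : blocks (u ++ Action.silent :: ((w ++ ([Action.emit] ++ t₁) ++ t₂) ++ t)) =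
          (u ++ Action.silent :: w) :: blocks (t₁ ++ t₂ ++ t) := by
        rw [← blocks_append_emit hpre]
        simp
      refine ⟨_, σ', X :: ss, .loop_nonzero (by rwa [h1])
        (.seq (.seq hw.run (.seq (.emit _) hr₁.run)) hr₂.run) ht, ?_, fun D => ?_, ?_, ?_⟩
      · simpa using hn
      · rw [← hm]; simp
      · rw [outputs, hb, List.dropLast_cons_of_ne_nil (blocks_ne_nil _), List.map_cons,
          List.map_cons]
        refine congrArg₂ _ ?_ ho
        rw [List.filterMap_append, hu.written, List.nil_append, List.filterMap_cons_none rfl]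
        exact hwX
      · intro i b hib
        rw [hb] at hib
        rcases i with _ | i
        · simp at hib
          subst hib
          have := hw.length_le.trans (Nat.mul_le_mul_left _ (Nat.add_le_add_right hL 1))
          simp [outT]
          omega
        · simp only [List.getElem?_cons_succ] at hib
          have := hd i b hib
          rcases i with _ | i
          · rw [if_pos rfl] at this
            rw [if_neg (by simp)]
            refine this.trans (Nat.add_le_add_right ?_ _)
            have h2 := (hr₁.seq hr₂).length_le
            refine h2.trans (Nat.mul_le_mul_left _ ?_)
            simpa using hL₁
          · rw [if_neg (by simp)] at this ⊢
            have h3 : (C ++ [X]).length + (i + 1) = C.length + (i + 1 + 1) := by simp; omega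
            rwa [h3] at this

/-- Read the input and search the first solution. -/
def prepareC (A : Cmd) (fl : Bool) (e : Exp) : Cmd :=
  powC ;; readC ;; subsetsC ;; splitC fl e ;; stepC A

/-- A bound for the number of loop iterations of `prepareC`. -/
def prepareT (n M B : ℕ) : ℕ :=
  n + (M + M * (n + 1) + (n * (M + 1) + (M + M + stepT n 0 M M B)))

theorem stepT_mono {n i f f' g g' B : ℕ} (hf : f ≤ f') (hg : g ≤ g') :
    stepT n i f g B ≤ stepT n i f' g' B := by
  unfold stepT searchT
  gcongr

theorem prepareC_spec {A : Cmd} {n r q N B : ℕ} {fl : Bool} {e : Exp} {l : List (Finset (Fin n))}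
    (hN : N = 2 * max n 2 ^ r) (hl : l.length ≤ N) (he : ∀ s : State, s.reg 2 = r → e.ev s = q)
    (hq : q = 0 ∨ q = r) (hA : Oracle A n r 0 B) :
    Wp (prepareC A fl e) (prepareT n N B) (encode l r) fun s => ∃ F G : List (Finset (Fin n)),
      F.length ≤ N ∧ G.length ≤ N ∧
      (∀ S, S ∈ F ↔ q ≤ S.card ∧ S.card ≤ r ∧ (S ∈ l ↔ fl = true)) ∧
      IsSplit F G q r ∧ Stepped A F G q r [] s := by
  have hF₀ : Fresh A (encode l r) := Fresh.encode l r
  refine (powC_spec (n := n) (by simp [encode])).call_seq _ le_rfl fun s₁ hf₁ hE₁ => ?_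
  have h1₁ : s₁.reg 1 = l.length := by rw [hf₁.reg 1 (by simp)]; simp [encode]
  have h0₁ : s₁.arr 0 = (encode l r).arr 0 := by rw [hf₁.arr 0 (by simp)]
  have h2₁ : s₁.reg 2 = r := by rw [hf₁.reg 2 (by simp)]; simp [encode]
  refine (readC_spec hE₁ h1₁ h0₁).call_seq (n * (N + 1) + (N + N + stepT n 0 N N B))
    (by gcongr) fun s₂ hf₂ hl₂ => ?_
  have hE₂ : Env n s₂ := hE₁.frame hf₂ (by simp) (by simp) (by simp)
  have h2₂ : s₂.reg 2 = r := by rw [hf₂.reg 2 (by simp), h2₁]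
  refine (subsetsC_spec hE₂ h2₂).call_seq (N + N + stepT n 0 N N B)
    (by rw [hN]) fun s₃ hf₃ ⟨L, hL, hLn, hLm⟩ => ?_
  have hLlen : L.length ≤ N := hN ▸ length_le_of_card hLn fun S hS => (hLm S).1 hS
  have hE₃ : Env n s₃ := hE₂.frame hf₃ (by simp) (by simp) (by simp)
  have hl₃ : HasList s₃ 2 1 l := hl₂.frame hf₃ (by simp) (by simp)
  have h2₃ : s₃.reg 2 = r := by rw [hf₃.reg 2 (by simp), h2₂]
  have h10₃ : ∀ x, s₃.arr 10 x = 0 := fun x => by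
    rw [hf₃.arr 10 (by simp), hf₂.arr 10 (by simp), hf₁.arr 10 (by simp)]; simp [encode]
  refine (splitC_spec (fl := fl) hl₃ hL (he s₃ h2₃) h10₃).call_seq (stepT n 0 N N B)
    (by omega) fun s₄ hf₄ ⟨F, G, hF, hG, hlen, h14, hFm, hGm⟩ => ?_
  have hs : IsSplit F G q r := by
    refine ⟨fun S => ?_, fun S hS hS' => ((hGm S).1 hS').2.2 ((hFm S).1 hS).2.2, hq⟩
    rw [hFm, hGm, hLm]
    tauto
  have hc : Ctx A F G q r [] s₄ := by
    refine ⟨hE₃.frame hf₄ (by simp) (by simp) (by simp), ?_, h14, hF, hG, .nil ?_, ?_, ?_⟩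
    · rw [hf₄.reg 2 (by simp), h2₃]
    · rw [hf₄.reg 11 (by simp), hf₃.reg 11 (by simp), hf₂.reg 11 (by simp), hf₁.reg 11 (by simp)]
      simp [encode]
    · refine Fresh.frame (Fresh.frame (Fresh.frame (hF₀.frame hf₁ ?_ ?_) hf₂ ?_ ?_) hf₃ ?_ ?_) hf₄
        ?_ ?_ <;> simp
    · intro x
      rw [hf₄.arr 9 (by simp), hf₃.arr 9 (by simp), hf₂.arr 9 (by simp), hf₁.arr 9 (by simp)]
      simp [encode]
  refine (stepC_spec hs (by simp) hc hA).mono (stepT_mono (by omega) (by omega)) fun s₅ hs₅ => ?_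
  refine ⟨F, G, by omega, by omega, fun S => ?_, hs, hs₅⟩
  rw [hFm, hLm]
  tauto

/-! ### Time bounds for the enumeration -/

section Bounds

variable {ι : Type*} {x N e n i M B : ι → ℕ}

theorem PBound.stepT (hN : ∀ a, 2 ≤ N a) (hn : PBound x N 0 n) (hi : PBound x N 0 i)
    (hM : PBound x N e M) (hB : PBound x N e B) :
    PBound x N e (fun a => HG.stepT (n a) (i a) (M a) (M a) (B a)) := by
  have one := PBound.const (x := x) (N := N) 1
  have hn1 := hn.add hN one
  have hin := hi.zmul hn1
  have ht : PBound x N e (fun a => testT (n a) (i a) (B a)) :=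
    ((hi.zmul ((hn.zmul ((hn.add hN hn).add hN one)).add hN one)).up hN).add hN
      (((hi.add hN (hi.zmul ((hn.zmul hn1).add hN one))).up hN).add hN hB)
  refine PBound.add hN ?_ (.add hN (.add hN ht (hn.zmul (ht.add hN (one.up hN)))) ?_)
  · exact hM.mulz ((hin.add hN (hn.zmul ((hn.add hN hin).add hN one))).add hN one)
  · exact hn.zmul (((hn.up hN).add hN (hM.mulz hn1)).add hN (one.up hN))

theorem PBound.delayT (A : Cmd) (hN : ∀ a, 2 ≤ N a) (hn : PBound x N 0 n) (hi : PBound x N 0 i)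
    (hM : PBound x N e M) (hB : PBound x N e B) :
    PBound x N e (fun a => HG.delayT A (n a) (i a) (M a) (M a) (B a)) :=
  (PBound.const _).zmul ((PBound.stepT hN hn hi hM hB).add hN ((PBound.const 1).up hN))

theorem PBound.prepareT (hN : ∀ a, 2 ≤ N a) (hn : PBound x N 0 n)
    (hM : PBound x N e M) (hB : PBound x N e B) :
    PBound x N e (fun a => HG.prepareT (n a) (M a) (B a)) := by
  have one := PBound.const (x := x) (N := N) 1
  refine (hn.up hN).add hN ((hM.add hN (hM.mulz (hn.add hN one))).add hN
    ((hn.zmul (hM.add hN (one.up hN))).add hN ((hM.add hN hM).add hN ?_)))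
  exact PBound.stepT hN hn (PBound.const 0) hM hB

theorem PBound.outT (co : Bool) (hN : ∀ a, 2 ≤ N a) (hn : PBound x N 0 n) :
    PBound x N 0 (fun a => HG.outT co (n a)) := by
  have one := PBound.const (x := x) (N := N) 1
  exact ((PBound.const _).zmul ((hn.zmul (hn.add hN one)).add hN one)).add hN (PBound.const 2)

end Bounds

/-! ### From conformality to the three enumeration problems -/

theorem written_written {n : ℕ} (co : Bool) (D : Finset (Fin n)) :
    written co (written co D) = D := by
  cases co <;> simp [written]

/-- Common frame of three reductions: `fl` tells whether edges or non-edges are forbidden, `par`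
gives the least size of a solution, and `co` tells whether complements are written. The problem
itself enters only through `hsol`. -/
theorem enumerable_of_conformal {Inst : (n : ℕ) → FinHypergraph n → ℕ → Prop}
    {Sol' : (n : ℕ) → FinHypergraph n → ℕ → Finset (Fin n) → Prop}
    (h : DecidableInTime (fun _ H k => IsConformal H k)) (fl co : Bool) (e : Exp) (par : ℕ → ℕ)
    (he : ∀ s : State, e.ev s = par (s.reg 2)) (hpar : ∀ r, par r = 0 ∨ par r = r)
    (hcard : ∀ n H r, Inst n H r → ∀ E ∈ H, E.card ≤ r)
    (hsol : ∀ n H r (F : List (Finset (Fin n))), Inst n H r →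
      (∀ S, S ∈ F ↔ par r ≤ S.card ∧ S.card ≤ r ∧ (S ∈ H ↔ fl = true)) →
      ∀ D, Sol F (par r) D ↔ Sol' n H r (written co D)) :
    EnumerableWithDelay Inst Sol' := by
  obtain ⟨A, p, c, hA⟩ := h
  set ι := ℕ × ℕ × ℕ
  have hN : ∀ a : ι, 2 ≤ max a.1 2 := fun a => le_max_right _ _
  have hn : PBound (fun a : ι => a.2.2) (fun a => max a.1 2) 0 (fun a => a.1) :=
    PBound.base.of_le fun a => le_max_left _ _
  have hM : PBound (fun a : ι => a.2.2) (fun a => max a.1 2) (fun a => a.2.1)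
      (fun a => 2 * max a.1 2 ^ a.2.1) := (PBound.const 2).zmul PBound.pow
  have hB : PBound (fun a : ι => a.2.2) (fun a => max a.1 2) (fun a => a.2.1)
      (fun a => p.eval a.2.2 * max a.1 2 ^ (a.2.1 + c)) := ⟨p, c, fun _ => le_rfl⟩
  -- The first search queries the hypergraph without edges, so its cost involves only the constant
  -- `p.eval 0`.
  have hB₀ : PBound (fun a : ι => a.2.2) (fun a => max a.1 2) (fun a => a.2.1)
      (fun a => p.eval 0 * max a.1 2 ^ (a.2.1 + c)) := ⟨.C (p.eval 0), c, fun _ => by simp⟩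
  obtain ⟨P, d, hP⟩ := PBound.add hN (PBound.add hN
    ((PBound.const ((startC ;; prepareC A fl e ;; (Exp.var 41).code 0).size)).zmul
      ((PBound.prepareT hN hn hM hB₀).add hN ((PBound.const 1).up hN)))
    (PBound.delayT A hN hn PBound.var hM hB)) ((PBound.outT co hN hn).up hN)
  refine ⟨startC ;; prepareC A fl e ;; whileC (.var 41) (nextC A co), P, d,
    fun n l r hl hI => ?_⟩
  set N := 2 * max n 2 ^ r with hNr
  -- The delay must not depend on `m`. As edges have at most `r` vertices, `m` is at most `2 * n ^
  -- r`, and reading the input fits into the first delay.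
  have hlen : l.length ≤ N := length_le_of_card hl fun S hS =>
    hcard n _ r hI S (List.mem_toFinset.2 hS)
  have horacle (i : ℕ) : Oracle A n r i (p.eval i * max n 2 ^ (r + c)) := by
    intro D hD hDi
    obtain ⟨t, s, hr, hs, ht⟩ := hA n D r hD
    exact ⟨t, s, hr, hs, ht.trans (Nat.mul_le_mul_right _ (eval_mono p hDi))⟩
  obtain ⟨σ₀, hr₀, ha₀⟩ := startC_run l r
  obtain ⟨t₁, L₁, σ₁, hr₁, hs₁, hL₁, F, G, hFN, hGN, hFm, hs, hst⟩ :=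
    prepareC_spec (fl := fl) (e := e) hNr hlen (q := par r) (fun s h2 => by rw [he, h2]) (hpar r)
      (horacle 0) σ₀ ha₀
  obtain ⟨t₂, σ₂, hr₂, hs₂, ha₂, hv₂, -⟩ := (Exp.var 41).code_run 0 σ₁
  have hu : Silent ([.silent, .silent] ++ (t₁ ++ t₂)) :=
    (silent_singleton.cons).append (hs₁.append hs₂)
  obtain ⟨t, σ', ss, ht, hn, hm, ho, hd⟩ := enumerate_run co hs horacle (2 ^ n + 1) [] (by simp)
    (by simp) (by simp) σ₂ (by rw [ha₂]; exact hv₂) (by rw [ha₂]; exact hst) _ hu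
  have hrun : Run (startC ;; prepareC A fl e ;; whileC (.var 41) (nextC A co)) (encode l r)
      ([.silent, .silent] ++ (t₁ ++ t₂) ++ t) σ' := by
    have := hr₀.run.seq (hr₁.run.seq (hr₂.run.seq ht))
    simpa [whileC] using this
  refine ⟨_, σ', hrun, ⟨ss.map (written co), ?_, fun D => ?_, ?_⟩, fun i b hib => ?_⟩
  · refine List.Nodup.map (fun D D' h => ?_) hn
    rw [← written_written co D, h, written_written]
  · rw [← written_written co D, ← hsol n l.toFinset r F hI (by simpa using hFm)]
    rw [List.nil_append] at hm
    rw [List.mem_map_of_injective, hm]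
    intro D D' h
    rw [← written_written co D, h, written_written]
  · rw [ho, List.map_map]
    rfl
  · refine (hd i b hib).trans (le_trans (Nat.add_le_add_right ?_ _) (hP (n, r, i)))
    split_ifs
    · refine le_trans ?_ (Nat.le_add_right _ _)
      refine ((hr₀.seq (hr₁.seq hr₂)).length_le).trans (Nat.mul_le_mul_left _ ?_)
      simpa using hL₁
    · refine le_trans ?_ (Nat.le_add_left _ _)
      refine Nat.mul_le_mul_left _ (Nat.add_le_add_right ?_ _)
      simpa using stepT_mono hFN hGN

/-- Minimal hitting sets are the complements of the maximal sets containing no edge, without a size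
condition; the forbidden sets are the edges, all of size at most the rank. -/
theorem minimalHittingSets_of_conformal (h : DecidableInTime (fun _ H k => IsConformal H k)) :
    EnumerableWithDelay (fun _ H r => rank H = r)
      (fun _ H _ T => Minimal (IsHittingSet H) T) := by
  refine enumerable_of_conformal h true true (.lit 0) (fun _ => 0) (by simp) (by simp) ?_ ?_
  · rintro n H r rfl E hE
    exact Finset.le_sup (f := Finset.card) hE
  · rintro n H r F rfl hF D
    have hFH (S : Finset (Fin n)) : S ∈ F ↔ S ∈ H := by
      rw [hF]
      simp only [Nat.zero_le, true_and, iff_true, and_iff_right_iff_imp]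
      exact fun hS => Finset.le_sup (f := Finset.card) hS
    have key (T : Finset (Fin n)) : (0 ≤ T.card ∧ ∀ E ∈ F, ¬ E ⊆ T) ↔ IsHittingSet H Tᶜ := by
      simp [isHittingSet_iff_compl, hFH]
    simp only [Sol, written, cond_true, maximal_iff, minimal_iff, key]
    refine and_congr_right fun _ => ⟨fun h T hT hTD => ?_, fun h T hT hDT => ?_⟩
    · rw [h (y := Tᶜ) (by rwa [compl_compl]) (by simpa using Finset.compl_subset_compl.2 hTD),
        compl_compl]
    · exact compl_injective (h hT (Finset.compl_subset_compl.2 hDT))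

/-- Here the forbidden sets are the `r`-sets that are not edges, and solutions have at least `r`
vertices. -/
theorem maximalHypercliques_of_conformal
    (h : DecidableInTime (fun _ H k => IsConformal H k)) :
    EnumerableWithDelay (fun _ H r => IsUniform H r)
      (fun _ H r C => Maximal (IsHyperclique H r) C) := by
  refine enumerable_of_conformal h false false (.var 2) (fun r => r) (by simp) (by simp)
    (fun n H r hH E hE => (hH E hE).le) fun n H r F hH hF D => ?_
  refine iff_of_eq (congrArg (Maximal · D) (funext fun T => propext (and_congr_right fun _ => ?_)))
  simp only [hF, Bool.false_eq_true, iff_false]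
  refine ⟨fun h S hST hS => ?_, fun h E hE hET => hE.2.2 (h E hET (by omega))⟩
  by_contra hSH
  exact h S ⟨hS.ge, hS.le, hSH⟩ hST

/-- The same with the edges as forbidden sets. -/
theorem maximalIndependentSets_of_conformal
    (h : DecidableInTime (fun _ H k => IsConformal H k)) :
    EnumerableWithDelay (fun _ H r => IsUniform H r)
      (fun _ H r C => Maximal (IsIndependent H r) C) := by
  refine enumerable_of_conformal h true false (.var 2) (fun r => r) (by simp) (by simp)
    (fun n H r hH E hE => (hH E hE).le) fun n H r F hH hF D => ?_
  refine iff_of_eq (congrArg (Maximal · D) (funext fun T => propext (and_congr_right fun _ => ?_)))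
  refine forall_congr' fun E => imp_congr_left ?_
  rw [hF]
  exact ⟨fun h => h.2.2.2 rfl, fun h => ⟨(hH E h).ge, (hH E h).le, by simp [h]⟩⟩

end HG

theorem theorem4 :
    List.TFAE [
      HG.DecidableInTime (fun _ H k => HG.TransversalRankGE H k),
      HG.DecidableInTime (fun _ H k => HG.IsConformal H k),
      HG.EnumerableWithDelay (fun _ H r => HG.rank H = r)
        (fun _ H _ T => Minimal (HG.IsHittingSet H) T),
      HG.EnumerableWithDelay (fun _ H r => HG.IsUniform H r)
        (fun _ H r C => Maximal (HG.IsHyperclique H r) C),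
      HG.EnumerableWithDelay (fun _ H r => HG.IsUniform H r)
        (fun _ H r C => Maximal (HG.IsIndependent H r) C)] := by
  tfae_have 1 → 2 := HG.conformal_of_transversalRank
  tfae_have 2 → 1 := HG.transversalRank_of_conformal
  tfae_have 3 → 2 := HG.conformal_of_minimalHittingSets
  tfae_have 4 → 2 := HG.conformal_of_maximalHypercliques
  tfae_have 5 → 2 := HG.conformal_of_maximalIndependentSets
  tfae_have 2 → 3 := HG.minimalHittingSets_of_conformal
  tfae_have 2 → 4 := HG.maximalHypercliques_of_conformal
  tfae_have 2 → 5 := HG.maximalIndependentSets_of_conformal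
  tfae_finish
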